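/- Let $M$ be a smooth $7$-manifold with a $G_2$-structure, i.e. a smooth $3$-form $\varphi$ that at each point lies in the $GL(7,\mathbb R)$-orbit of $\varphi_0=e^{123}+e^{145}+e^{167}+e^{246}-e^{257}-e^{347}-e^{356}$. Let $g$ be its metric, $g_{ab}=(\det s)^{-1/9}s_{ab}$ with $s_{ab}=\frac1{144}\varphi_{amn}\varphi_{bpq}\varphi_{rst}\hat\varepsilon^{mnpqrst}$, let $\psi=*\varphi$ be its Hodge dual (for the volume form $(\det s)^{1/9}dx^{1\dots7}$), $\nabla$ the Levi-Civita connection of $g$, and $T_a{}^m=\frac1{24}(\nabla_a\varphi_{bcd})\psi^{mbcd}$ its full torsion tensor. Every $2$-tensor decomposes uniquely with respect to $\varphi$ as $W_{ab}=w_1g_{ab}+(w_7)^c\varphi_{cab}+(w_{14})_{ab}+(w_{27})_{ab}$ with $w_1$ a function, $w_7$ a $1$-form, $w_{14}\in\Lambda^2_{14}=\{\omega\in\Lambda^2:\omega^{ab}\varphi_{abc}=0\}$ and $w_{27}$ symmetric and traceless. Let $v$ be a smooth vector field, let $\tau_i$ be the components of $T_{ab}$ and $v_i$ the components of $\nabla_av_b$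 ($i=1,7,14,27$), and put $M=|v|_g^2$, $k=(1+M)^{1/3}$. Let $\tilde\varphi_{bcd}=\varphi_{bcd}+v^e\psi_{bcde}$. Then $\tilde\varphi$ is again a $G_2$-structure. Let $\tilde T$ be any $2$-tensor field, with components $\tilde\tau_1,\tilde\tau_7,\tilde\tau_{14},\tilde\tau_{27}$ with respect to $\tilde\varphi$ and its metric. The full torsion tensor of $\tilde\varphi$ is $\tilde T_{ab}$ if and only if everywhere on the manifold (indices raised and lowered with $g$, round and square brackets denoting symmetrization and antisymmetrization with weight one in $a,b$) $$v_1=\tau_1-\tfrac37(\tau_7)_av^a-\tfrac17\tfrac{7+3M}{k}\tilde\tau_1-\tfrac37(\tilde\tau_7)_av^a+\tfrac1{14}k(\tilde\tau_{27})_{ab}v^av^b,$$ $$\begin{aligned}(v_7)^c={}&(\tau_7)^c-\tfrac13\tau_1v^c+\tfrac13\varphi^c{}_{ab}(\tau_7)^av^b-\tfrac16(\tau_{14})_a{}^cv^a-\tfrac13(\tau_{27})_a{}^cv^a+\tfrac43\tfrac{\tilde\tau_1}{k}v^c\\&-(\tilde\tau_7)^c-\tfrac12\varphi^c{}_{ab}(\tilde\tau_7)^av^b+\tfrac16k(\tilde\tau_{27})_a{}^cv^a,\end{aligned}$$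 $$\begin{aligned}(M+9)(v_{14})_{ab}={}&\tfrac43(M-27)(\tau_7)_{[a}v_{b]}-\tfrac13(M-27)\psi^{mn}{}_{ab}(\tau_7)_mv_n-4M\varphi^m{}_{ab}(\tau_7)_m+4(\tau_7)^mv_m\varphi^n{}_{ab}v_n\\ &-24\varphi^{mn}{}_{[a}v_{b]}(\tau_7)_mv_n+\tfrac12(M+2)(M+9)(\tau_{14})_{ab}+\tfrac12(M+9)\varphi_a{}^{mn}\varphi_b{}^{pq}v_mv_p(\tau_{14})_{nq}\\ &+(M-7)v_m(\tau_{14})^m{}_{[a}v_{b]}-8\varphi^{mn}{}_{[a}v_{b]}v_nv_p(\tau_{14})^p{}_m-\tfrac43Mv_m(\tau_{14})^m{}_n\varphi^n{}_{ab}\\ &+4\psi^{mn}{}_{ab}v_p(\tau_{14})^p{}_mv_n+16v_m(\tau_{27})^m{}_{[a}v_{b]}-\tfrac43v_m\varphi^m{}_{ab}(\tau_{27})_{np}v^nv^p\\ &+\tfrac43Mv_m(\tau_{27})^m{}_n\varphi^n{}_{ab}-4\psi^{mn}{}_{ab}v_p(\tau_{27})^p{}_mv_n+8\varphi^{mn}{}_{[a}v_{b]}v_nv_p(\tau_{27})^p{}_m\\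 &+\bigl(\tfrac16(M+17)k(\tilde\tau_{27})_{mn}v^mv^n-4(\tilde\tau_7)_mv^m\bigr)v_p\varphi^p{}_{ab}+24\varphi^{mn}{}_{[a}v_{b]}(\tilde\tau_7)_mv_n\\ &-2(M-15)(\tilde\tau_7)_{[a}v_{b]}+\tfrac12(M-15)\psi^{mn}{}_{ab}(\tilde\tau_7)_mv_n+4M\varphi^m{}_{ab}(\tilde\tau_7)_m\\ &-k(M+9)\bigl((\tilde\tau_{14})_{ab}+v^m\varphi_{mn[a}(\tilde\tau_{27})^n{}_{b]}\bigr)+16k\,v_m(\tilde\tau_{14})^m{}_{[a}v_{b]}\\ &+8k\,\varphi^{mn}{}_{[a}v_{b]}v_nv_p(\tilde\tau_{14})^p{}_m+(M-3)k\,v_m(\tilde\tau_{14})^m{}_n\varphi^n{}_{ab}-4k\,\psi^{mn}{}_{ab}v_p(\tilde\tau_{14})^p{}_mv_n\\ &-8k\,\varphi^{mn}{}_{[a}v_{b]}v_nv_p(\tilde\tau_{27})^p{}_m-16k\,v_m(\tilde\tau_{27})^m{}_{[a}v_{b]}\\ &-\tfrac16(7M-9)k\,v_m(\tilde\tau_{27})^m{}_n\varphi^n{}_{ab}+4k\,\psi^{mn}{}_{ab}v_p(\tilde\tau_{27})^p{}_mv_n,\end{aligned}$$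 $$\begin{aligned}(v_{27})_{ab}={}&(\tau_{27})_{ab}+4(\tau_7)_{(a}v_{b)}+\bigl(4k^{-1}\tilde\tau_1-\tfrac12k^{-2}(\tilde\tau_{27})_{mn}v^mv^n\bigr)v_av_b\\ &-\tfrac17\bigl(4(\tau_7)_mv^m-3(\tilde\tau_7)_mv^m+4Mk^{-1}\tilde\tau_1+\tfrac12k(\tilde\tau_{27})_{mn}v^mv^n\bigr)g_{ab}-3(\tilde\tau_7)_{(a}v_{b)}\\ &-v^m\varphi_{mn(a}(\tau_{14})^n{}_{b)}-\tfrac12k^{-2}\varphi_a{}^{mn}\varphi_b{}^{pq}(\tilde\tau_{27})_{mp}v_nv_q\\ &-k^{-2}\bigl(\tfrac12(2+M)(\tilde\tau_{27})_{ab}+v_m(\tilde\tau_{27})^m{}_{(a}v_{b)}-v^m\varphi_{mn(a}(\tilde\tau_{27})^n{}_{b)}+\varphi^{mn}{}_{(a}v_{b)}v_nv_p(\tilde\tau_{27})^p{}_m\bigr).\end{aligned}$$ Moreover the necessary condition $d\bigl(v_7\lrcorner\varphi+v_{14}\bigr)=0$ holds, where $(v_7\lrcorner\varphi)_{ab}=(v_7)^c\varphi_{cab}$.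 -/

import Mathlib

open scoped Manifold ContDiff

noncomputable section

namespace G2Deformation

/-! ### Pointwise algebra of positive 3-forms on a 7-dimensional space, in components

Indices run over `Fin 7`.  Except for the components `v a` of a vector and for the inverse metric,
all tensors are given by their components with lower indices. -/

abbrev Tensor1 := Fin 7 → ℝ
abbrev Tensor2 := Fin 7 → Fin 7 → ℝ
abbrev Tensor3 := Fin 7 → Fin 7 → Fin 7 → ℝ
abbrev Tensor4 := Fin 7 → Fin 7 → Fin 7 → Fin 7 → ℝ

/-- `(eⁱ ∧ eʲ ∧ eᵏ)(x, y, z)`. -/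
def elementaryForm (i j k : Fin 7) (x y z : Fin 7 → ℝ) : ℝ :=
  Matrix.det !![x i, x j, x k; y i, y j, y k; z i, z j, z k]

/-- The form `e¹²³ + e¹⁴⁵ + e¹⁶⁷ + e²⁴⁶ - e²⁵⁷ - e³⁴⁷ - e³⁵⁶` on `ℝ⁷` (indices shifted by one). -/
def standardForm (x y z : Fin 7 → ℝ) : ℝ :=
  elementaryForm 0 1 2 x y z + elementaryForm 0 3 4 x y z + elementaryForm 0 5 6 x y z
    + elementaryForm 1 3 5 x y z - elementaryForm 1 4 6 x y z - elementaryForm 2 3 6 x y z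
    - elementaryForm 2 4 5 x y z

/-- A 3-form is positive if it lies in the `GL(7, ℝ)`-orbit of `standardForm`. -/
def IsPositive (φ : Tensor3) : Prop :=
  ∃ A : Matrix (Fin 7) (Fin 7) ℝ, IsUnit A.det ∧
    ∀ a b c, φ a b c = standardForm (fun i => A i a) (fun i => A i b) (fun i => A i c)

/-- `s_ab = (1/144) φ_amn φ_bpq φ_rst ε^mnpqrst`, with the alternating symbol `ε`. -/
def sMatrix (φ : Tensor3) : Matrix (Fin 7) (Fin 7) ℝ := fun a b =>
  (1 / 144) * ∑ σ : Equiv.Perm (Fin 7), ((Equiv.Perm.sign σ : ℤ) : ℝ) *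
    (φ a (σ 0) (σ 1) * φ b (σ 2) (σ 3) * φ (σ 4) (σ 5) (σ 6))

/-- The real ninth root, an odd function. -/
def ninthRoot (x : ℝ) : ℝ := Real.sign x * |x| ^ (1 / 9 : ℝ)

/-- The metric of a positive 3-form: `g_ab = (det s)^(-1/9) s_ab`. -/
def metric (φ : Tensor3) : Matrix (Fin 7) (Fin 7) ℝ := fun a b =>
  (ninthRoot (sMatrix φ).det)⁻¹ * sMatrix φ a b

/-- `g^ab`. -/
def metricInv (φ : Tensor3) : Matrix (Fin 7) (Fin 7) ℝ := (metric φ)⁻¹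

/-- The 4-form `ψ = ∗φ`, for the metric `g` of `φ` and the volume form
`(det s)^(1/9) dx¹ ∧ ⋯ ∧ dx⁷` of `φ`, that is
`ψ_abcd = (1/3!) (det s)^(-1/9) ε^mnpqrst g_am g_bn g_cp g_dq φ_rst`. -/
def psi (φ : Tensor3) : Tensor4 := fun a b c d =>
  (1 / 6) * (ninthRoot (sMatrix φ).det)⁻¹ *
    ∑ σ : Equiv.Perm (Fin 7), ((Equiv.Perm.sign σ : ℤ) : ℝ) *
      (metric φ a (σ 0) * metric φ b (σ 1) * metric φ c (σ 2) * metric φ d (σ 3) *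
        φ (σ 4) (σ 5) (σ 6))

/-- `ψ^abcd`, all indices raised with the metric of `φ`. -/
def psiUp (φ : Tensor3) : Tensor4 := fun a b c d =>
  ∑ m, ∑ n, ∑ p, ∑ q, metricInv φ a m * metricInv φ b n * metricInv φ c p * metricInv φ d q *
    psi φ m n p q

/-- `x_a = g_ab x^b`. -/
def flat (φ : Tensor3) (x : Tensor1) : Tensor1 := fun a => ∑ b, metric φ a b * x b

/-- `α^a = g^ab α_b`. -/
def sharp (φ : Tensor3) (α : Tensor1) : Tensor1 := fun a => ∑ b, metricInv φ a b * α b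

/-- `W^ab`. -/
def raise2 (φ : Tensor3) (W : Tensor2) : Tensor2 := fun a b =>
  ∑ m, ∑ n, metricInv φ a m * metricInv φ b n * W m n

/-- `W_[ab]`. -/
def altPart (W : Tensor2) : Tensor2 := fun a b => (W a b - W b a) / 2

/-- `W_(ab)`. -/
def symPart (W : Tensor2) : Tensor2 := fun a b => (W a b + W b a) / 2

/-- `α_a x^a`. -/
def pair (α x : Tensor1) : ℝ := ∑ a, α a * x a

/-- `α_a β_b`. -/
def outer (α β : Tensor1) : Tensor2 := fun a b => α a * β b

/-- `x^m W_mb`. -/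
def contract (x : Tensor1) (W : Tensor2) : Tensor1 := fun b => ∑ m, x m * W m b

/-- `φ_cab x^a y^b`. -/
def phiCross (φ : Tensor3) (x y : Tensor1) : Tensor1 := fun c => ∑ a, ∑ b, φ c a b * x a * y b

/-- `x^m φ_mab`. -/
def phiContr (φ : Tensor3) (x : Tensor1) : Tensor2 := fun a b => ∑ m, x m * φ m a b

/-- `ψ_mnab x^m y^n`. -/
def psiContr (φ : Tensor3) (x y : Tensor1) : Tensor2 := fun a b =>
  ∑ m, ∑ n, psi φ m n a b * x m * y n

/-- `x^m φ_mna W^n_b`. -/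
def phiMul (φ : Tensor3) (x : Tensor1) (W : Tensor2) : Tensor2 := fun a b =>
  ∑ m, ∑ n, ∑ p, x m * φ m n a * metricInv φ n p * W p b

/-- `φ_amn φ_bpq x^m x^p W^nq`. -/
def phiPhi (φ : Tensor3) (x : Tensor1) (W : Tensor2) : Tensor2 := fun a b =>
  ∑ m, ∑ n, ∑ p, ∑ q, φ a m n * φ b p q * x m * x p * raise2 φ W n q

/-- The components of a 2-tensor in the irreducible `G₂`-representations of dimensions
1, 7, 14 and 27. -/
@[ext] structure Components where
  c1 : ℝ
  c7 : Tensor1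
  c14 : Tensor2
  c27 : Tensor2

/-- The components of `W` with respect to `φ`, that is
`W_ab = c₁ g_ab + c₇^c φ_cab + (c₁₄)_ab + (c₂₇)_ab` with a scalar `c₁`, a 1-form `c₇`,
`c₁₄` in `Λ²₁₄` and `c₂₇` symmetric and traceless:
`c₁ = (1/7) g^ab W_ab` and `(c₇)_c = (1/6) W^ab φ_abc`. -/
def components (φ : Tensor3) (W : Tensor2) : Components :=
  let c1 : ℝ := (1 / 7) * ∑ a, ∑ b, metricInv φ a b * W a b
  let c7 : Tensor1 := fun c => (1 / 6) * ∑ a, ∑ b, raise2 φ W a b * φ a b c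
  { c1 := c1
    c7 := c7
    c14 := fun a b => altPart W a b - phiContr φ (sharp φ c7) a b
    c27 := fun a b => symPart W a b - c1 * metric φ a b }

/-- `φ + v_e ψ_bcd^e`. -/
def deform (φ : Tensor3) (v : Tensor1) : Tensor3 := fun b c d =>
  φ b c d + ∑ e, v e * psi φ b c d e

/-! ### The algebraic formulas

`φ` is the original 3-form, `v` the deformation vector `v^a`, `τ` the components of the torsion
of `φ`, and `ρ` the components of the torsion of the deformed form (with respect to the deformed
form).  Indices are raised and lowered with the metric of `φ`. -/

/-- `M = |v|²`. -/
def normSq (φ : Tensor3) (v : Tensor1) : ℝ := ∑ a, ∑ b, metric φ a b * v a * v b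

/-- `(1 + M)^(1/3)`. -/
def kappa (φ : Tensor3) (v : Tensor1) : ℝ := (1 + normSq φ v) ^ (1 / 3 : ℝ)

def formula1 (φ : Tensor3) (v : Tensor1) (τ ρ : Components) : ℝ :=
  let M := normSq φ v
  let k := kappa φ v
  τ.c1 - (3 / 7) * pair τ.c7 v - (1 / 7) * ((7 + 3 * M) / k) * ρ.c1 - (3 / 7) * pair ρ.c7 v
    + (1 / 14) * k * pair (contract v ρ.c27) v

def formula7 (φ : Tensor3) (v : Tensor1) (τ ρ : Components) : Tensor1 := fun c =>
  let k := kappa φ v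
  τ.c7 c - (1 / 3) * τ.c1 * flat φ v c + (1 / 3) * phiCross φ (sharp φ τ.c7) v c
    - (1 / 6) * contract v τ.c14 c - (1 / 3) * contract v τ.c27 c
    + (4 / 3) * (ρ.c1 / k) * flat φ v c - ρ.c7 c
    - (1 / 2) * phiCross φ (sharp φ ρ.c7) v c + (1 / 6) * k * contract v ρ.c27 c

def formula14 (φ : Tensor3) (v : Tensor1) (τ ρ : Components) : Tensor2 := fun a b =>
  let M := normSq φ v
  let k := kappa φ v
  let vf := flat φ v
  let t7 := sharp φ τ.c7
  let r7 := sharp φ ρ.c7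
  let t14 := contract v τ.c14
  let t27 := contract v τ.c27
  let r14 := contract v ρ.c14
  let r27 := contract v ρ.c27
  (1 / (M + 9)) *
    ((4 / 3) * (M - 27) * altPart (outer τ.c7 vf) a b
      - (1 / 3) * (M - 27) * psiContr φ t7 v a b
      - 4 * M * phiContr φ t7 a b
      + 4 * pair τ.c7 v * phiContr φ v a b
      - 24 * altPart (outer (phiCross φ t7 v) vf) a b
      + (1 / 2) * (M + 2) * (M + 9) * τ.c14 a b
      + (1 / 2) * (M + 9) * phiPhi φ v τ.c14 a b
      + (M - 7) * altPart (outer t14 vf) a b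
      - 8 * altPart (outer (phiCross φ (sharp φ t14) v) vf) a b
      - (4 / 3) * M * phiContr φ (sharp φ t14) a b
      + 4 * psiContr φ (sharp φ t14) v a b
      + 16 * altPart (outer t27 vf) a b
      - (4 / 3) * pair t27 v * phiContr φ v a b
      + (4 / 3) * M * phiContr φ (sharp φ t27) a b
      - 4 * psiContr φ (sharp φ t27) v a b
      + 8 * altPart (outer (phiCross φ (sharp φ t27) v) vf) a b
      + ((1 / 6) * (M + 17) * k * pair r27 v - 4 * pair ρ.c7 v) * phiContr φ v a b
      + 24 * altPart (outer (phiCross φ r7 v) vf) a b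
      - 2 * (M - 15) * altPart (outer ρ.c7 vf) a b
      + (1 / 2) * (M - 15) * psiContr φ r7 v a b
      + 4 * M * phiContr φ r7 a b
      - k * (M + 9) * (ρ.c14 a b + altPart (phiMul φ v ρ.c27) a b)
      + 16 * k * altPart (outer r14 vf) a b
      + 8 * k * altPart (outer (phiCross φ (sharp φ r14) v) vf) a b
      + (M - 3) * k * phiContr φ (sharp φ r14) a b
      - 4 * k * psiContr φ (sharp φ r14) v a b
      - 8 * k * altPart (outer (phiCross φ (sharp φ r27) v) vf) a b
      - 16 * k * altPart (outer r27 vf) a b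
      - (1 / 6) * (7 * M - 9) * k * phiContr φ (sharp φ r27) a b
      + 4 * k * psiContr φ (sharp φ r27) v a b)

def formula27 (φ : Tensor3) (v : Tensor1) (τ ρ : Components) : Tensor2 := fun a b =>
  let M := normSq φ v
  let k := kappa φ v
  let vf := flat φ v
  let r27 := contract v ρ.c27
  τ.c27 a b + 4 * symPart (outer τ.c7 vf) a b
    + (4 / k * ρ.c1 - (1 / 2) / k ^ 2 * pair r27 v) * (vf a * vf b)
    - (1 / 7) * (4 * pair τ.c7 v - 3 * pair ρ.c7 v + 4 * M / k * ρ.c1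
        + (1 / 2) * k * pair r27 v) * metric φ a b
    - 3 * symPart (outer ρ.c7 vf) a b
    - symPart (phiMul φ v τ.c14) a b
    - (1 / 2) / k ^ 2 * phiPhi φ v ρ.c27 a b
    - 1 / k ^ 2 * ((1 / 2) * (2 + M) * ρ.c27 a b + symPart (outer r27 vf) a b
        - symPart (phiMul φ v ρ.c27) a b
        + symPart (outer (phiCross φ (sharp φ r27) v) vf) a b)

/-! ### Tensor fields in local coordinates -/

/-- The coordinate space `ℝ⁷`. -/
abbrev Coords := EuclideanSpace ℝ (Fin 7)

/-- `∂_a f` at `x`. -/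
def partialDeriv (a : Fin 7) (f : Coords → ℝ) (x : Coords) : ℝ :=
  fderiv ℝ f x (EuclideanSpace.single a 1)

/-- The Christoffel symbol `Γ^b_ac = (1/2) g^bd (∂_c g_da + ∂_a g_dc - ∂_d g_ac)` of the metric
of the field of 3-forms `φ`. -/
def christoffel (φ : Coords → Tensor3) (x : Coords) (b a c : Fin 7) : ℝ :=
  (1 / 2) * ∑ d, metricInv (φ x) b d *
    (partialDeriv c (fun y => metric (φ y) d a) x + partialDeriv a (fun y => metric (φ y) d c) x
      - partialDeriv d (fun y => metric (φ y) a c) x)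

/-- `∇_a φ_bcd`, for the Levi-Civita connection of the metric of `φ`. -/
def covDerivPhi (φ : Coords → Tensor3) (x : Coords) (a b c d : Fin 7) : ℝ :=
  partialDeriv a (fun y => φ y b c d) x
    - ∑ e, (christoffel φ x e a b * φ x e c d + christoffel φ x e a c * φ x b e d
        + christoffel φ x e a d * φ x b c e)

/-- The full torsion tensor `T_an = T_a^m g_mn`, where `T_a^m = (1/24) (∇_a φ_bcd) ψ^mbcd`. -/
def torsion (φ : Coords → Tensor3) (x : Coords) : Tensor2 := fun a n =>
  ∑ m, ((1 / 24) * ∑ b, ∑ c, ∑ d, covDerivPhi φ x a b c d * psiUp (φ x) m b c d) *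
    metric (φ x) m n

/-- `∇_a v_b = ∂_a v_b - Γ^c_ab v_c`, for the Levi-Civita connection of the metric of `φ` and
the vector field with components `v^b`. -/
def covDerivVector (φ : Coords → Tensor3) (v : Coords → Tensor1) (x : Coords) : Tensor2 :=
  fun a b => partialDeriv a (fun y => flat (φ y) (v y) b) x
    - ∑ c, christoffel φ x c a b * flat (φ x) (v x) c

/-- `(dβ)_abc`, for a field `β` of 2-forms. -/
def extDeriv2 (β : Coords → Tensor2) (x : Coords) (a b c : Fin 7) : ℝ :=
  partialDeriv a (fun y => β y b c) x + partialDeriv b (fun y => β y c a) x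
    + partialDeriv c (fun y => β y a b) x

/-- `φ` is a smooth field of positive 3-forms on `U`. -/
def IsG2StructureOn (U : Set Coords) (φ : Coords → Tensor3) : Prop :=
  (∀ a b c, ContDiffOn ℝ ∞ (fun x => φ x a b c) U) ∧ ∀ x ∈ U, IsPositive (φ x)

/-! ### Tensor fields on a manifold and their components in a chart -/

section Manifold

variable {M : Type*} [TopologicalSpace M] [ChartedSpace Coords M]

/-- The coordinate vector field `∂_a` of a chart `e`, at the point with coordinates `x`. -/
def frame (e : OpenPartialHomeomorph M Coords) (x : Coords) (a : Fin 7) :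
    TangentSpace (𝓡 7) (e.symm x) :=
  mfderiv (𝓡 7) (𝓡 7) e.symm x (EuclideanSpace.single a (1 : ℝ) : Coords)

/-- The components `φ_abc` of a 3-form in a chart. -/
def formCoord (φ : ∀ p : M, (TangentSpace (𝓡 7) p) [⋀^Fin 3]→L[ℝ] ℝ)
    (e : OpenPartialHomeomorph M Coords) : Coords → Tensor3 := fun x a b c =>
  φ (e.symm x) ![frame e x a, frame e x b, frame e x c]

/-- The components `v^a` of a vector field in a chart. -/
def vectorCoord (v : ∀ p : M, TangentSpace (𝓡 7) p)
    (e : OpenPartialHomeomorph M Coords) : Coords → Tensor1 := fun x a =>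
  (show Coords from mfderiv (𝓡 7) (𝓡 7) e (e.symm x) (v (e.symm x))) a

/-- The components `W_ab` of a 2-tensor field in a chart. -/
def tensorCoord (W : ∀ p : M, TangentSpace (𝓡 7) p →L[ℝ] TangentSpace (𝓡 7) p →L[ℝ] ℝ)
    (e : OpenPartialHomeomorph M Coords) : Coords → Tensor2 := fun x a b =>
  W (e.symm x) (frame e x a) (frame e x b)

/-- `φ` is a smooth positive 3-form on `M`. -/
def IsG2Structure (φ : ∀ p : M, (TangentSpace (𝓡 7) p) [⋀^Fin 3]→L[ℝ] ℝ) : Prop :=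
  ∀ e ∈ IsManifold.maximalAtlas (𝓡 7) ∞ M, IsG2StructureOn e.target (formCoord φ e)

/-- `φ̃ = φ + v_e ψ_bcd^e` in a chart. -/
def deformCoord (φ : ∀ p : M, (TangentSpace (𝓡 7) p) [⋀^Fin 3]→L[ℝ] ℝ)
    (v : ∀ p : M, TangentSpace (𝓡 7) p) (e : OpenPartialHomeomorph M Coords) :
    Coords → Tensor3 := fun x =>
  deform (formCoord φ e x) (vectorCoord v e x)

/-- The components `v₁, v₇, v₁₄, v₂₇` of `∇v` with respect to `φ`, in a chart. -/
def gradComponents (φ : ∀ p : M, (TangentSpace (𝓡 7) p) [⋀^Fin 3]→L[ℝ] ℝ)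
    (v : ∀ p : M, TangentSpace (𝓡 7) p) (e : OpenPartialHomeomorph M Coords) (x : Coords) :
    Components :=
  components (formCoord φ e x) (covDerivVector (formCoord φ e) (vectorCoord v e) x)

/-- The components `τ₁, τ₇, τ₁₄, τ₂₇` of the torsion of `φ`, in a chart. -/
def torsionComponents (φ : ∀ p : M, (TangentSpace (𝓡 7) p) [⋀^Fin 3]→L[ℝ] ℝ)
    (e : OpenPartialHomeomorph M Coords) (x : Coords) : Components :=
  components (formCoord φ e x) (torsion (formCoord φ e) x)

/-- The components `τ̃₁, τ̃₇, τ̃₁₄, τ̃₂₇` of the 2-tensor `W` with respect to `φ̃`, in a chart. -/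
def deformedComponents (φ : ∀ p : M, (TangentSpace (𝓡 7) p) [⋀^Fin 3]→L[ℝ] ℝ)
    (v : ∀ p : M, TangentSpace (𝓡 7) p)
    (W : ∀ p : M, TangentSpace (𝓡 7) p →L[ℝ] TangentSpace (𝓡 7) p →L[ℝ] ℝ)
    (e : OpenPartialHomeomorph M Coords) (x : Coords) : Components :=
  components (deformCoord φ v e x) (tensorCoord W e x)

end Manifold

end G2Deformation

end

open scoped Manifold ContDiff

noncomputable section

namespace G2Deformation

open Finset Matrix Filter Topology

/-! ### Alternating sums over permutations -/

/-! Every object in the statement is built naturally from `φ` and `v`, so it commutes with pull-back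
by an invertible matrix: the powers of the determinant carried by the alternating symbol and by the
ninth root cancel. A pointwise identity may therefore be checked in one frame. Positivity brings `φ`
to the standard form, and products of explicit rotations preserving that form turn any vector into
`t e₀` (`exists_isStdIsometry_mulVec`, `IsPositive.exists_gauge`). One parameter `t` remains.

In this frame write `φ₀ = e₀ ∧ ω + Re Ω`, where `Ω` is the product of the three complex coordinate
forms. The deformation replaces `Re Ω` by `Re ((1 - i t) Ω)`. Multiplying the complex coordinates by
a cube root of `1 - i t`, and rescaling `e₀`, shows that the new form is positive with metric `diag
(k⁻², k, …, k)`. Invariantly the new metric is `k⁻² ((1 + M) g - v♭ ⊗ v♭)`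
(`IsPositive.metric_deform`).

Covariant derivatives are obtained without normal coordinates. Pulling tensors back along a
coordinate line by `1 - u Γ` gives a curve whose derivative at `0` is the covariant derivative, and
naturality then permits ordinary product and chain rules. Along such a curve the metric is
stationary. Differentiating `φ_amn φ_b^mn = 6 g_ab` confines `∇φ` to the seven-dimensional span of
the contractions of `ψ` with vectors, so the torsion determines it (`deriv_eq_sum_psi`). The
derivatives of the new metric give the difference of the two connections, and seven well-chosen
components of the derivative of the new form give its torsion: `k⁻¹` times an explicit expression
`stdTorsion t T W` in the old torsion `T` and in `W = ∇v` (`IsG2StructureAt.torsion_deform`).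

Substituting this torsion into the four formulas returns the components of `W`, identically in `T`
and `W` (`components_eq_formulas_stdForm`). That is one direction. It also shows, at `T = 0`, that
the linear map sending `W` to its contribution to the new torsion is injective, hence bijective in
finite dimension. Every prescribed tensor is thus the new torsion for some `W'`; if `W` satisfies
the formulas, then `W` and `W'` have equal components, so `W = W'`. This is the converse
(`components_eq_formulas_stdForm_iff`).

The final condition holds because the Christoffel symbols are symmetric: the components of `∇v` of
types 7 and 14 together form its alternating part, which is half of `dv♭` and so is closed. -/

theorem altSum_pull {n : ℕ} (P : Matrix (Fin n) (Fin n) ℝ) (C : (Fin n → Fin n) → ℝ) :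
    ∑ σ : Equiv.Perm (Fin n), ((Equiv.Perm.sign σ : ℤ) : ℝ) *
        ∑ g : Fin n → Fin n, (∏ k, P (g k) (σ k)) * C g
      = P.det * ∑ σ : Equiv.Perm (Fin n), ((Equiv.Perm.sign σ : ℤ) : ℝ) * C σ := by
  have h1 : ∑ σ : Equiv.Perm (Fin n), ((Equiv.Perm.sign σ : ℤ) : ℝ) *
        ∑ g : Fin n → Fin n, (∏ k, P (g k) (σ k)) * C g
      = ∑ g : Fin n → Fin n, C g * (P.submatrix g id).det := by
    -- Summing over the permutation first turns the coefficient of `C g` into the determinant of the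
    -- rows of `P` chosen by `g`.
    simp_rw [mul_sum]
    rw [sum_comm]
    refine sum_congr rfl fun g _ => ?_
    rw [← det_transpose, det_apply', mul_sum]
    refine sum_congr rfl fun σ _ => ?_
    simp only [transpose_apply, submatrix_apply, id]
    ring
  have h2 : ∀ g : Fin n → Fin n, ¬ Function.Bijective g → (P.submatrix g id).det = 0 := by
    intro g hg
    -- A choice of rows that is not a permutation repeats a row, so only permutations survive; each
    -- contributes its sign times `P.det`.
    have : ¬ Function.Injective g := fun h => hg (Finite.injective_iff_bijective.1 h)
    simp only [Function.Injective, not_forall] at this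
    obtain ⟨i, j, hij, hne⟩ := this
    exact det_zero_of_row_eq hne (by funext k; simp [hij])
  rw [h1, mul_sum]
  rw [← sum_filter_add_sum_filter_not univ (fun g : Fin n → Fin n => Function.Bijective g)]
  rw [sum_eq_zero (s := univ.filter fun g : Fin n → Fin n => ¬ Function.Bijective g)
    (fun g hg => by rw [h2 g (by simpa using hg), mul_zero]), add_zero]
  symm
  refine sum_bij (fun σ _ => (σ : Fin n → Fin n)) ?_ ?_ ?_ ?_
  · intro σ _; exact mem_filter.2 ⟨mem_univ _, σ.bijective⟩
  · intro σ _ τ _ h; exact Equiv.coe_fn_injective h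
  · intro g hg
    exact ⟨Equiv.ofBijective g (mem_filter.1 hg).2, mem_univ _, rfl⟩
  · intro σ _
    rw [det_permute]
    ring

/-- Used repeatedly, this unfolds a sum over functions on `Fin 7` into seven nested sums, in which
products of pull-backs can be compared term by term. -/
theorem sum_pi_succ {n : ℕ} {α R : Type*} [Fintype α] [AddCommMonoid R]
    (F : (Fin (n + 1) → α) → R) :
    ∑ f, F f = ∑ i, ∑ g : Fin n → α, F (vecCons i g) := by
  rw [← (Fin.consEquiv fun _ : Fin (n + 1) => α).sum_comp, Fintype.sum_prod_type]
  rfl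

/-! ### Pull-back of covariant tensors -/

/-- The tower is nested one index at a time, so that each property in rank `n + 1` follows from rank
`n` by exchanging a single pair of sums. -/
def pull1 (P : Matrix (Fin 7) (Fin 7) ℝ) (α : Tensor1) : Tensor1 := fun a => ∑ i, P i a * α i

def pull2 (P : Matrix (Fin 7) (Fin 7) ℝ) (W : Tensor2) : Tensor2 := fun a b =>
  ∑ i, P i a * pull1 P (W i) b

def pull3 (P : Matrix (Fin 7) (Fin 7) ℝ) (φ : Tensor3) : Tensor3 := fun a b c =>
  ∑ i, P i a * pull2 P (φ i) b c

def pull4 (P : Matrix (Fin 7) (Fin 7) ℝ) (ψ : Tensor4) : Tensor4 := fun a b c d =>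
  ∑ i, P i a * pull3 P (ψ i) b c d

theorem pull2_eq (P : Matrix (Fin 7) (Fin 7) ℝ) (W : Tensor2) :
    Matrix.of (pull2 P W) = Pᵀ * Matrix.of W * P := by
  ext a b
  simp only [of_apply, pull2, pull1, Matrix.mul_apply, transpose_apply, sum_mul, mul_sum]
  rw [sum_comm]
  exact sum_congr rfl fun _ _ => sum_congr rfl fun _ _ => by ring

theorem pull2_matrix (P G : Matrix (Fin 7) (Fin 7) ℝ) (a b : Fin 7) :
    pull2 P (fun i j => G i j) a b = (Pᵀ * G * P) a b :=
  congrFun (congrFun (pull2_eq P fun i j => G i j) a) b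

theorem pull1_eq (P : Matrix (Fin 7) (Fin 7) ℝ) (α : Tensor1) : pull1 P α = Pᵀ *ᵥ α := rfl

theorem pull1_sum_smul (P : Matrix (Fin 7) (Fin 7) ℝ) (x : Fin 7 → ℝ) (α : Fin 7 → Tensor1)
    (b : Fin 7) :
    pull1 P (fun j => ∑ i, x i * α i j) b = ∑ i, x i * pull1 P (α i) b := by
  simp only [pull1, mul_sum]
  rw [sum_comm]
  exact sum_congr rfl fun _ _ => sum_congr rfl fun _ _ => by ring

theorem pull2_sum_smul (P : Matrix (Fin 7) (Fin 7) ℝ) (x : Fin 7 → ℝ) (W : Fin 7 → Tensor2)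
    (b c : Fin 7) :
    pull2 P (fun j k => ∑ i, x i * W i j k) b c = ∑ i, x i * pull2 P (W i) b c := by
  simp only [pull2, pull1_sum_smul, mul_sum]
  rw [sum_comm]
  exact sum_congr rfl fun _ _ => sum_congr rfl fun _ _ => by ring

theorem pull3_sum_smul (P : Matrix (Fin 7) (Fin 7) ℝ) (x : Fin 7 → ℝ) (W : Fin 7 → Tensor3)
    (b c d : Fin 7) :
    pull3 P (fun j k l => ∑ i, x i * W i j k l) b c d = ∑ i, x i * pull3 P (W i) b c d := by
  simp only [pull3, pull2_sum_smul, mul_sum]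
  rw [sum_comm]
  exact sum_congr rfl fun _ _ => sum_congr rfl fun _ _ => by ring

theorem pull1_pull1 (P Q : Matrix (Fin 7) (Fin 7) ℝ) (α : Tensor1) :
    pull1 P (pull1 Q α) = pull1 (Q * P) α := by
  simp only [pull1_eq, mulVec_mulVec, transpose_mul]

theorem sum_mul_apply_mul (P Q : Matrix (Fin 7) (Fin 7) ℝ) (x : Fin 7 → ℝ) (a : Fin 7) :
    ∑ i, P i a * ∑ j, Q j i * x j = ∑ j, (Q * P) j a * x j := by
  simp only [Matrix.mul_apply, sum_mul, mul_sum]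
  rw [sum_comm]
  exact sum_congr rfl fun _ _ => sum_congr rfl fun _ _ => by ring

theorem pull2_pull2 (P Q : Matrix (Fin 7) (Fin 7) ℝ) (W : Tensor2) :
    pull2 P (pull2 Q W) = pull2 (Q * P) W := by
  funext a b
  have h : ∀ i, pull1 P (pull2 Q W i) b = ∑ j, Q j i * pull1 (Q * P) (W j) b := fun i => by
    simp only [← pull1_pull1]; exact pull1_sum_smul P _ _ b
  rw [pull2]
  simp only [h, sum_mul_apply_mul, pull2]

theorem pull3_pull3 (P Q : Matrix (Fin 7) (Fin 7) ℝ) (φ : Tensor3) :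
    pull3 P (pull3 Q φ) = pull3 (Q * P) φ := by
  funext a b c
  have h : ∀ i, pull2 P (pull3 Q φ i) b c = ∑ j, Q j i * pull2 (Q * P) (φ j) b c := fun i => by
    simp only [← pull2_pull2]; exact pull2_sum_smul P _ _ b c
  rw [pull3]
  simp only [h, sum_mul_apply_mul, pull3]

theorem pull4_pull4 (P Q : Matrix (Fin 7) (Fin 7) ℝ) (ψ : Tensor4) :
    pull4 P (pull4 Q ψ) = pull4 (Q * P) ψ := by
  funext a b c d
  have h : ∀ i, pull3 P (pull4 Q ψ i) b c d = ∑ j, Q j i * pull3 (Q * P) (ψ j) b c d := fun i => by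
    simp only [← pull3_pull3]; exact pull3_sum_smul P _ _ b c d
  rw [pull4]
  simp only [h, sum_mul_apply_mul, pull4]

theorem pull1_one (α : Tensor1) : pull1 1 α = α := by
  funext a; simp [pull1, Matrix.one_apply]

theorem pull2_one (W : Tensor2) : pull2 1 W = W := by
  funext a b; simp [pull2, pull1_one, Matrix.one_apply]

theorem pull3_one (φ : Tensor3) : pull3 1 φ = φ := by
  funext a b c; simp [pull3, pull2_one, Matrix.one_apply]

theorem pull4_one (ψ : Tensor4) : pull4 1 ψ = ψ := by
  funext a b c d; simp [pull4, pull3_one, Matrix.one_apply]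

/-- Contraction of the first index with a vector. -/
theorem sum_mul_pull1 (P : Matrix (Fin 7) (Fin 7) ℝ) (x : Fin 7 → ℝ) (α : Tensor1) :
    ∑ m, x m * pull1 P α m = ∑ i, (P *ᵥ x) i * α i := by
  simp only [pull1, mulVec, dotProduct, sum_mul, mul_sum]
  rw [sum_comm]
  exact sum_congr rfl fun _ _ => sum_congr rfl fun _ _ => by ring

theorem sum_mul_pull2 (P : Matrix (Fin 7) (Fin 7) ℝ) (x : Fin 7 → ℝ) (W : Tensor2) (b : Fin 7) :
    ∑ m, x m * pull2 P W m b = pull1 P (fun j => ∑ i, (P *ᵥ x) i * W i j) b := by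
  rw [pull1_sum_smul]
  exact sum_mul_pull1 P x fun i => pull1 P (W i) b

theorem sum_mul_pull3 (P : Matrix (Fin 7) (Fin 7) ℝ) (x : Fin 7 → ℝ) (φ : Tensor3)
    (b c : Fin 7) :
    ∑ m, x m * pull3 P φ m b c = pull2 P (fun j k => ∑ i, (P *ᵥ x) i * φ i j k) b c := by
  rw [pull2_sum_smul]
  exact sum_mul_pull1 P x fun i => pull2 P (φ i) b c

theorem sum_mul_pull4 (P : Matrix (Fin 7) (Fin 7) ℝ) (x : Fin 7 → ℝ) (ψ : Tensor4)
    (b c d : Fin 7) :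
    ∑ m, x m * pull4 P ψ m b c d = pull3 P (fun j k l => ∑ i, (P *ᵥ x) i * ψ i j k l) b c d := by
  rw [pull3_sum_smul]
  exact sum_mul_pull1 P x fun i => pull3 P (ψ i) b c d

/-- Contraction of the last index with a vector. -/
theorem sum_mul_pull2_last (P : Matrix (Fin 7) (Fin 7) ℝ) (x : Fin 7 → ℝ) (W : Tensor2)
    (a : Fin 7) :
    ∑ m, x m * pull2 P W a m = pull1 P (fun i => ∑ j, (P *ᵥ x) j * W i j) a := by
  simp only [pull2, mul_sum]
  rw [sum_comm]
  simp only [pull1, ← sum_mul_pull1]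
  simp only [mul_sum]
  exact sum_congr rfl fun _ _ => sum_congr rfl fun _ _ => sum_congr rfl fun _ _ => by ring

theorem sum_mul_pull3_last (P : Matrix (Fin 7) (Fin 7) ℝ) (x : Fin 7 → ℝ) (φ : Tensor3)
    (a b : Fin 7) :
    ∑ m, x m * pull3 P φ a b m = pull2 P (fun i j => ∑ k, (P *ᵥ x) k * φ i j k) a b := by
  simp only [pull3, mul_sum]
  rw [sum_comm]
  rw [pull2]
  simp only [← sum_mul_pull2_last, mul_sum]
  exact sum_congr rfl fun _ _ => sum_congr rfl fun _ _ => by ring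

theorem sum_mul_pull4_last (P : Matrix (Fin 7) (Fin 7) ℝ) (x : Fin 7 → ℝ) (ψ : Tensor4)
    (a b c : Fin 7) :
    ∑ m, x m * pull4 P ψ a b c m = pull3 P (fun i j k => ∑ l, (P *ᵥ x) l * ψ i j k l) a b c := by
  simp only [pull4, mul_sum]
  rw [sum_comm]
  rw [pull3]
  simp only [← sum_mul_pull3_last, mul_sum]
  exact sum_congr rfl fun _ _ => sum_congr rfl fun _ _ => by ring

/-! ### Behaviour of the algebraic constructions under pull-back -/

theorem pull1_mul (P : Matrix (Fin 7) (Fin 7) ℝ) (A : Tensor1) (a : Fin 7) (r : ℝ) :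
    pull1 P A a * r = ∑ i, P i a * (A i * r) := by
  simp only [pull1, sum_mul, mul_assoc]

theorem pull2_mul (P : Matrix (Fin 7) (Fin 7) ℝ) (A : Tensor2) (a b : Fin 7) (r : ℝ) :
    pull2 P A a b * r = ∑ i, P i a * ∑ j, P j b * (A i j * r) := by
  simp only [pull2, sum_mul, mul_assoc, pull1_mul]

/-- The index pattern of `sMatrix`: seven contracted slots split as 2 + 2 + 3. All seven factors of
`P` are collected by `altSum_pull` into one determinant. -/
theorem altSum_pull223 (P : Matrix (Fin 7) (Fin 7) ℝ) (A B : Tensor2) (D : Tensor3) :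
    ∑ σ : Equiv.Perm (Fin 7), ((Equiv.Perm.sign σ : ℤ) : ℝ) *
        (pull2 P A (σ 0) (σ 1) * pull2 P B (σ 2) (σ 3) * pull3 P D (σ 4) (σ 5) (σ 6))
      = P.det * ∑ σ : Equiv.Perm (Fin 7), ((Equiv.Perm.sign σ : ℤ) : ℝ) *
        (A (σ 0) (σ 1) * B (σ 2) (σ 3) * D (σ 4) (σ 5) (σ 6)) := by
  rw [← altSum_pull P fun g => A (g 0) (g 1) * B (g 2) (g 3) * D (g 4) (g 5) (g 6)]
  refine sum_congr rfl fun σ _ => congrArg _ ?_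
  rw [mul_assoc, pull2_mul]
  simp only [pull2_mul]
  simp only [pull3, pull2, pull1]
  simp only [sum_pi_succ, Fintype.sum_unique, Fin.prod_univ_seven, mul_sum]
  refine sum_congr rfl fun i0 _ => sum_congr rfl fun i1 _ => sum_congr rfl fun i2 _ =>
    sum_congr rfl fun i3 _ => sum_congr rfl fun i4 _ => sum_congr rfl fun i5 _ =>
    sum_congr rfl fun i6 _ => ?_
  simp only [Matrix.cons_val]
  ring

/-- The index pattern of `psi`: four rows of the metric and the 3-form fill the seven slots of the
alternating symbol. -/
theorem altSum_pull11113 (P : Matrix (Fin 7) (Fin 7) ℝ) (x y z w : Tensor1) (D : Tensor3) :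
    ∑ σ : Equiv.Perm (Fin 7), ((Equiv.Perm.sign σ : ℤ) : ℝ) *
        (pull1 P x (σ 0) * pull1 P y (σ 1) * pull1 P z (σ 2) * pull1 P w (σ 3) *
          pull3 P D (σ 4) (σ 5) (σ 6))
      = P.det * ∑ σ : Equiv.Perm (Fin 7), ((Equiv.Perm.sign σ : ℤ) : ℝ) *
        (x (σ 0) * y (σ 1) * z (σ 2) * w (σ 3) * D (σ 4) (σ 5) (σ 6)) := by
  rw [← altSum_pull P fun g => x (g 0) * y (g 1) * z (g 2) * w (g 3) * D (g 4) (g 5) (g 6)]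
  refine sum_congr rfl fun σ _ => congrArg _ ?_
  rw [mul_assoc, mul_assoc, mul_assoc]
  simp only [pull1_mul]
  simp only [pull3, pull2, pull1]
  simp only [sum_pi_succ, Fintype.sum_unique, Fin.prod_univ_seven, mul_sum]
  refine sum_congr rfl fun i0 _ => sum_congr rfl fun i1 _ => sum_congr rfl fun i2 _ =>
    sum_congr rfl fun i3 _ => sum_congr rfl fun i4 _ => sum_congr rfl fun i5 _ =>
    sum_congr rfl fun i6 _ => ?_
  simp only [Matrix.cons_val]
  ring

theorem sum_mul_sum_mul_sum {ι κ : Type*} [Fintype ι] [Fintype κ] (f Z : ι → ℝ) (p q : κ → ℝ)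
    (X Y : κ → ι → ℝ) :
    ∑ σ, f σ * ((∑ i, p i * X i σ) * (∑ j, q j * Y j σ) * Z σ)
      = ∑ i, p i * ∑ j, q j * ∑ σ, f σ * (X i σ * Y j σ * Z σ) := by
  have h : ∀ σ, f σ * ((∑ i, p i * X i σ) * (∑ j, q j * Y j σ) * Z σ)
      = ∑ i, ∑ j, p i * (q j * (f σ * (X i σ * Y j σ * Z σ))) := fun σ => by
    rw [sum_mul_sum]
    simp only [mul_sum, sum_mul]
    exact sum_congr rfl fun _ _ => sum_congr rfl fun _ _ => by ring
  simp only [h]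
  rw [sum_comm]
  refine sum_congr rfl fun i _ => ?_
  rw [sum_comm, mul_sum]
  refine sum_congr rfl fun j _ => ?_
  simp only [mul_sum]

/-- The two free indices transform as those of a bilinear form, while the seven slots of the
alternating symbol give one factor `P.det`: `s` is a bilinear form with values in densities. -/
theorem sMatrix_pull3 (P : Matrix (Fin 7) (Fin 7) ℝ) (φ : Tensor3) :
    sMatrix (pull3 P φ) = P.det • (Pᵀ * sMatrix φ * P) := by
  have key : ∀ a b, sMatrix (pull3 P φ) a b
      = P.det * pull2 P (fun i j => sMatrix φ i j) a b := by
    intro a b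
    have h := sum_mul_sum_mul_sum
      (fun σ : Equiv.Perm (Fin 7) => ((Equiv.Perm.sign σ : ℤ) : ℝ))
      (fun σ => pull3 P φ (σ 4) (σ 5) (σ 6)) (fun i => P i a) (fun j => P j b)
      (fun i σ => pull2 P (φ i) (σ 0) (σ 1)) (fun j σ => pull2 P (φ j) (σ 2) (σ 3))
    simp only [altSum_pull223] at h
    refine (congrArg (fun r : ℝ => 1 / 144 * r) h).trans ?_
    simp only [pull2, pull1, sMatrix, mul_sum]
    exact sum_congr rfl fun _ _ => sum_congr rfl fun _ _ => sum_congr rfl fun _ _ => by ring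
  ext a b
  rw [key, Matrix.smul_apply, smul_eq_mul, pull2_matrix]

/-! ### The signed ninth root and the resulting true tensors. -/

theorem ninthRoot_mul (x y : ℝ) : ninthRoot (x * y) = ninthRoot x * ninthRoot y := by
  have hs : (x * y).sign = x.sign * y.sign := by
    rcases lt_trichotomy x 0 with hx | hx | hx <;> rcases lt_trichotomy y 0 with hy | hy | hy <;>
      simp [Real.sign_of_neg, Real.sign_of_pos, hx, hy, mul_pos_of_neg_of_neg,
        mul_neg_of_neg_of_pos, mul_neg_of_pos_of_neg]
  simp only [ninthRoot, hs, abs_mul, Real.mul_rpow (abs_nonneg x) (abs_nonneg y)]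
  ring

theorem ninthRoot_pow_nine (x : ℝ) : ninthRoot (x ^ 9) = x := by
  have h : (|x| ^ 9) ^ (1 / 9 : ℝ) = |x| := by
    rw [← Real.rpow_natCast, ← Real.rpow_mul (abs_nonneg x)]; norm_num
  rw [ninthRoot, abs_pow, h]
  rcases lt_trichotomy x 0 with hx | hx | hx
  · rw [Real.sign_of_neg (Odd.pow_neg (by decide) hx), abs_of_neg hx]; ring
  · simp [hx]
  · rw [Real.sign_of_pos (by positivity), abs_of_pos hx]; ring

theorem pow_nine_ninthRoot (x : ℝ) : ninthRoot x ^ 9 = x := by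
  have h : (|x| ^ (1 / 9 : ℝ)) ^ 9 = |x| := by
    rw [← Real.rpow_natCast, ← Real.rpow_mul (abs_nonneg x)]; norm_num
  rw [ninthRoot, mul_pow, h]
  rcases lt_trichotomy x 0 with hx | hx | hx
  · rw [Real.sign_of_neg hx, abs_of_neg hx]; ring
  · simp [hx]
  · rw [Real.sign_of_pos hx, abs_of_pos hx]; ring

theorem ninthRoot_ne_zero {x : ℝ} (hx : x ≠ 0) : ninthRoot x ≠ 0 := fun h =>
  hx (by rw [← pow_nine_ninthRoot x, h]; norm_num)

/-- The determinant of `s` picks up `7 + 2 = 9` factors `P.det`. Since the ninth root is odd, the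
sign of `P.det` survives as well. -/
theorem ninthRoot_det_sMatrix_pull3 (P : Matrix (Fin 7) (Fin 7) ℝ) (φ : Tensor3) :
    ninthRoot (sMatrix (pull3 P φ)).det = P.det * ninthRoot (sMatrix φ).det := by
  have : (sMatrix (pull3 P φ)).det = P.det ^ 9 * (sMatrix φ).det := by
    rw [sMatrix_pull3, det_smul, det_mul, det_mul, det_transpose, Fintype.card_fin]; ring
  rw [this, ninthRoot_mul, ninthRoot_pow_nine]

theorem metric_eq_smul (φ : Tensor3) :
    metric φ = (ninthRoot (sMatrix φ).det)⁻¹ • sMatrix φ := rfl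

/-- The factor `P.det` of `s` cancels against that of the ninth root, also when `P` reverses the
orientation. -/
theorem metric_pull3 {P : Matrix (Fin 7) (Fin 7) ℝ} (hP : P.det ≠ 0) (φ : Tensor3) :
    metric (pull3 P φ) = Pᵀ * metric φ * P := by
  rw [metric_eq_smul, metric_eq_smul, ninthRoot_det_sMatrix_pull3, sMatrix_pull3, smul_smul,
    Matrix.mul_smul, Matrix.smul_mul]
  congr 1
  field_simp

theorem metricInv_pull3 {P : Matrix (Fin 7) (Fin 7) ℝ} (hP : P.det ≠ 0) (φ : Tensor3) :
    metricInv (pull3 P φ) = P⁻¹ * metricInv φ * P⁻¹ᵀ := by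
  rw [metricInv, metric_pull3 hP, Matrix.mul_inv_rev, Matrix.mul_inv_rev, ← transpose_nonsing_inv,
    metricInv, Matrix.mul_assoc]

theorem metric_pull3_apply {P : Matrix (Fin 7) (Fin 7) ℝ} (hP : P.det ≠ 0) (φ : Tensor3)
    (a b : Fin 7) : metric (pull3 P φ) a b = pull2 P (fun i j => metric φ i j) a b := by
  rw [metric_pull3 hP, pull2_matrix]

theorem sum_mul_sum_pow_four {ι κ : Type*} [Fintype ι] [Fintype κ] (f Z : ι → ℝ)
    (p q r s : κ → ℝ) (X : κ → ι → ℝ) (Y : κ → ι → ℝ) (V W : κ → ι → ℝ) :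
    ∑ σ, f σ * ((∑ i, p i * X i σ) * (∑ j, q j * Y j σ) * (∑ j, r j * V j σ) *
        (∑ j, s j * W j σ) * Z σ)
      = ∑ i, p i * ∑ j, q j * ∑ k, r k * ∑ l, s l *
          ∑ σ, f σ * (X i σ * Y j σ * V k σ * W l σ * Z σ) := by
  have h1 := fun Z' : ι → ℝ => sum_mul_sum_mul_sum f Z' p q X Y
  have h2 := fun k l => sum_mul_sum_mul_sum (fun σ => f σ * (X k σ * Y l σ)) Z r s V W
  calc _ = ∑ σ, f σ * ((∑ i, p i * X i σ) * (∑ j, q j * Y j σ) * ((∑ j, r j * V j σ) *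
        (∑ j, s j * W j σ) * Z σ)) := sum_congr rfl fun _ _ => by ring
    _ = ∑ i, p i * ∑ j, q j * ∑ σ, (f σ * (X i σ * Y j σ)) * ((∑ j, r j * V j σ) *
        (∑ j, s j * W j σ) * Z σ) := by rw [h1]; simp only [mul_assoc]
    _ = _ := by simp only [h2]; simp only [mul_assoc]

/-- The alternating symbol contributes `P.det` and the inverse volume factor contributes its
inverse. The volume form is the one attached to `φ`, so no orientation has to be preserved. -/
theorem psi_pull3 {P : Matrix (Fin 7) (Fin 7) ℝ} (hP : P.det ≠ 0) (φ : Tensor3) :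
    psi (pull3 P φ) = pull4 P (psi φ) := by
  funext a b c d
  have hg : ∀ a b, metric (pull3 P φ) a b
      = pull1 P (fun j => ∑ i, P i a * metric φ i j) b := fun a b => by
    rw [metric_pull3_apply hP, pull1_sum_smul P _ fun i j => metric φ i j]; rfl
  simp only [psi, hg, altSum_pull11113, ninthRoot_det_sMatrix_pull3]
  rw [sum_mul_sum_pow_four (fun σ : Equiv.Perm (Fin 7) => ((Equiv.Perm.sign σ : ℤ) : ℝ))
    (fun σ => φ (σ 4) (σ 5) (σ 6)) _ _ _ _ (fun i σ => metric φ i (σ 0))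
    (fun i σ => metric φ i (σ 1)) (fun i σ => metric φ i (σ 2)) (fun i σ => metric φ i (σ 3))]
  have e : 1 / 6 * (P.det * ninthRoot (sMatrix φ).det)⁻¹ * P.det
      = 1 / 6 * (ninthRoot (sMatrix φ).det)⁻¹ := by field_simp
  simp only [← mul_assoc, e]
  simp only [pull4, pull3, pull2, pull1]
  rw [mul_sum]
  refine sum_congr rfl fun i _ => ?_
  rw [← mul_assoc, mul_comm _ (P i a), mul_assoc, mul_sum]
  refine congrArg _ (sum_congr rfl fun j _ => ?_)
  rw [← mul_assoc, mul_comm _ (P j b), mul_assoc, mul_sum]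
  refine congrArg _ (sum_congr rfl fun k _ => ?_)
  rw [← mul_assoc, mul_comm _ (P k c), mul_assoc, mul_sum]
  refine congrArg _ (sum_congr rfl fun l _ => ?_)
  rw [← mul_assoc, mul_comm _ (P l d), mul_assoc]
  simp only [psi, mul_assoc]

theorem psiUp_eq_pull4 (φ : Tensor3) : psiUp φ = pull4 (metricInv φ)ᵀ (psi φ) := by
  funext a b c d
  simp only [psiUp, pull4, pull3, pull2, pull1, transpose_apply, mul_sum]
  exact sum_congr rfl fun _ _ => sum_congr rfl fun _ _ => sum_congr rfl fun _ _ =>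
    sum_congr rfl fun _ _ => by ring

theorem psiUp_pull3 {P : Matrix (Fin 7) (Fin 7) ℝ} (hP : P.det ≠ 0) (φ : Tensor3) :
    psiUp (pull3 P φ) = pull4 P⁻¹ᵀ (psiUp φ) := by
  have hu : IsUnit P.det := hP.isUnit
  rw [psiUp_eq_pull4, psiUp_eq_pull4, psi_pull3 hP, pull4_pull4, pull4_pull4, metricInv_pull3 hP]
  congr 1
  simp only [transpose_mul, transpose_transpose]
  rw [← Matrix.mul_assoc, Matrix.mul_nonsing_inv _ hu, Matrix.one_mul]

theorem flat_eq (φ : Tensor3) (x : Tensor1) : flat φ x = metric φ *ᵥ x := rfl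

theorem sharp_eq (φ : Tensor3) (α : Tensor1) : sharp φ α = metricInv φ *ᵥ α := rfl

theorem flat_pull3 {P : Matrix (Fin 7) (Fin 7) ℝ} (hP : P.det ≠ 0) (φ : Tensor3) (x : Tensor1) :
    flat (pull3 P φ) x = pull1 P (flat φ (P *ᵥ x)) := by
  simp only [flat_eq, pull1_eq, metric_pull3 hP, mulVec_mulVec, Matrix.mul_assoc]

theorem sharp_pull3 {P : Matrix (Fin 7) (Fin 7) ℝ} (hP : P.det ≠ 0) (φ : Tensor3) (α : Tensor1) :
    P *ᵥ sharp (pull3 P φ) (pull1 P α) = sharp φ α := by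
  have hu : IsUnit P.det := hP.isUnit
  have h : P⁻¹ᵀ * Pᵀ = 1 := by
    rw [← transpose_mul, Matrix.mul_nonsing_inv _ hu, transpose_one]
  simp only [sharp_eq, pull1_eq, metricInv_pull3 hP, mulVec_mulVec, Matrix.mul_assoc]
  rw [h, Matrix.mul_one, ← Matrix.mul_assoc P, Matrix.mul_nonsing_inv _ hu, Matrix.one_mul]

theorem pair_pull1 (P : Matrix (Fin 7) (Fin 7) ℝ) (α x : Tensor1) :
    pair (pull1 P α) x = pair α (P *ᵥ x) := by
  have := sum_mul_pull1 P x α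
  simp only [pair]
  simp only [mul_comm] at this ⊢
  exact this

theorem normSq_eq (φ : Tensor3) (v : Tensor1) : normSq φ v = pair (flat φ v) v := by
  simp only [normSq, pair, flat, sum_mul]
  exact sum_congr rfl fun _ _ => sum_congr rfl fun _ _ => by ring

theorem normSq_pull3 {P : Matrix (Fin 7) (Fin 7) ℝ} (hP : P.det ≠ 0) (φ : Tensor3) (x : Tensor1) :
    normSq (pull3 P φ) x = normSq φ (P *ᵥ x) := by
  rw [normSq_eq, normSq_eq, flat_pull3 hP, pair_pull1]

theorem kappa_pull3 {P : Matrix (Fin 7) (Fin 7) ℝ} (hP : P.det ≠ 0) (φ : Tensor3) (x : Tensor1) :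
    kappa (pull3 P φ) x = kappa φ (P *ᵥ x) := by
  rw [kappa, kappa, normSq_pull3 hP]

theorem pull3_add (P : Matrix (Fin 7) (Fin 7) ℝ) (φ χ : Tensor3) (a b c : Fin 7) :
    pull3 P (fun i j k => φ i j k + χ i j k) a b c = pull3 P φ a b c + pull3 P χ a b c := by
  simp only [pull3, pull2, pull1, mul_add, sum_add_distrib]

/-- Forms are pulled back and vectors are pushed forward, hence `P *ᵥ v` on the right. -/
theorem deform_pull3 {P : Matrix (Fin 7) (Fin 7) ℝ} (hP : P.det ≠ 0) (φ : Tensor3) (v : Tensor1) :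
    deform (pull3 P φ) v = pull3 P (deform φ (P *ᵥ v)) := by
  funext a b c
  simp only [deform]
  rw [psi_pull3 hP, sum_mul_pull4_last, ← pull3_add]
  rfl

/-! ### The standard form in components -/

/-- The components of `standardForm`. -/
def stdZ (a b c : Fin 7) : ℤ :=
  match a.val, b.val, c.val with
  | 0, 1, 2 | 1, 2, 0 | 2, 0, 1 | 0, 3, 4 | 3, 4, 0 | 4, 0, 3 | 0, 5, 6 | 5, 6, 0 | 6, 0, 5
  | 1, 3, 5 | 3, 5, 1 | 5, 1, 3 | 4, 1, 6 | 1, 6, 4 | 6, 4, 1 | 3, 2, 6 | 2, 6, 3 | 6, 3, 2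
  | 4, 2, 5 | 2, 5, 4 | 5, 4, 2 => 1
  | 1, 0, 2 | 0, 2, 1 | 2, 1, 0 | 3, 0, 4 | 0, 4, 3 | 4, 3, 0 | 5, 0, 6 | 0, 6, 5 | 6, 5, 0
  | 3, 1, 5 | 1, 5, 3 | 5, 3, 1 | 1, 4, 6 | 4, 6, 1 | 6, 1, 4 | 2, 3, 6 | 3, 6, 2 | 6, 2, 3
  | 2, 4, 5 | 4, 5, 2 | 5, 2, 4 => -1
  | _, _, _ => 0

/-- Integer entries allow finite identities to be decided by evaluation over `ℤ` and cast
afterwards. -/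
def stdForm : Tensor3 := fun a b c => (stdZ a b c : ℝ)

/-- The nonzero components of `standardForm`. -/
def stdTerms : List (Fin 7 × Fin 7 × Fin 7 × ℤ) := [
  (0, 1, 2, 1), (0, 2, 1, -1), (0, 3, 4, 1), (0, 4, 3, -1), (0, 5, 6, 1), (0, 6, 5, -1),
  (1, 0, 2, -1), (1, 2, 0, 1), (1, 3, 5, 1), (1, 4, 6, -1), (1, 5, 3, -1), (1, 6, 4, 1),
  (2, 0, 1, 1), (2, 1, 0, -1), (2, 3, 6, -1), (2, 4, 5, -1), (2, 5, 4, 1), (2, 6, 3, 1),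
  (3, 0, 4, -1), (3, 1, 5, -1), (3, 2, 6, 1), (3, 4, 0, 1), (3, 5, 1, 1), (3, 6, 2, -1),
  (4, 0, 3, 1), (4, 1, 6, 1), (4, 2, 5, 1), (4, 3, 0, -1), (4, 5, 2, -1), (4, 6, 1, -1),
  (5, 0, 6, -1), (5, 1, 3, 1), (5, 2, 4, -1), (5, 3, 1, -1), (5, 4, 2, 1), (5, 6, 0, 1),
  (6, 0, 5, 1), (6, 1, 4, -1), (6, 2, 3, -1), (6, 3, 2, 1), (6, 4, 1, 1), (6, 5, 0, -1)]

/-- Only 42 of the 343 entries are nonzero; this sparse form keeps the enumerations below small. -/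
theorem sum_stdZ (F : Fin 7 → Fin 7 → Fin 7 → ℤ) :
    ∑ a, ∑ b, ∑ c, stdZ a b c * F a b c
      = (stdTerms.map fun t => t.2.2.2 * F t.1 t.2.1 t.2.2.1).sum := by
  have h : ∀ a b c, stdZ a b c
      = (stdTerms.map fun t => if t.1 = a ∧ t.2.1 = b ∧ t.2.2.1 = c then t.2.2.2 else 0).sum := by
    decide +kernel
  simp only [h]
  generalize stdTerms = L
  induction L with
  | nil => simp
  | cons t L ih =>
    simp only [List.map_cons, List.sum_cons, add_mul, sum_add_distrib, ih]
    congr 1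
    rw [sum_eq_single t.1, sum_eq_single t.2.1, sum_eq_single t.2.2.1]
    · simp
    all_goals simp +contextual [eq_comm]

/-- The sign of `b - a`. -/
def sgnZ (a b : Fin 7) : ℤ := cond (Nat.ble b.val a.val) (cond (Nat.beq a.val b.val) 0 (-1)) 1

/-- The product `x * y`, which evaluates `y` only if it has to. -/
def lazyMul (x y : ℤ) : ℤ := if x = 0 then 0 else x * y

theorem lazyMul_eq (x y : ℤ) : lazyMul x y = x * y := by
  unfold lazyMul; split_ifs with h <;> simp [h]

/-- The alternating symbol. -/
def epsZ (a b c d e f g : Fin 7) : ℤ :=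
  lazyMul (sgnZ a b) <| lazyMul (sgnZ a c) <| lazyMul (sgnZ a d) <| lazyMul (sgnZ b c) <|
  lazyMul (sgnZ b d) <| lazyMul (sgnZ c d) <| lazyMul (sgnZ a e) <| lazyMul (sgnZ b e) <|
  lazyMul (sgnZ c e) <| lazyMul (sgnZ d e) <| lazyMul (sgnZ a f) <| lazyMul (sgnZ b f) <|
  lazyMul (sgnZ c f) <| lazyMul (sgnZ d f) <| lazyMul (sgnZ e f) <| lazyMul (sgnZ a g) <|
  lazyMul (sgnZ b g) <| lazyMul (sgnZ c g) <| lazyMul (sgnZ d g) <| lazyMul (sgnZ e g) <| sgnZ f g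

theorem sgnZ_comm (a b : Fin 7) : sgnZ a b = - sgnZ b a := by
  revert a b; decide

theorem epsZ_eq (f : Fin 7 → Fin 7) :
    epsZ (f 0) (f 1) (f 2) (f 3) (f 4) (f 5) (f 6)
      = ∏ j, ∏ i ∈ Finset.Iio j, sgnZ (f i) (f j) := by
  simp only [epsZ, lazyMul_eq, Fin.prod_univ_seven]
  rw [show Finset.Iio (0 : Fin 7) = ∅ by decide, show Finset.Iio (1 : Fin 7) = {0} by decide,
    show Finset.Iio (2 : Fin 7) = {0, 1} by decide, show Finset.Iio (3 : Fin 7) = {0, 1, 2} by decide,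
    show Finset.Iio (4 : Fin 7) = {0, 1, 2, 3} by decide,
    show Finset.Iio (5 : Fin 7) = {0, 1, 2, 3, 4} by decide,
    show Finset.Iio (6 : Fin 7) = {0, 1, 2, 3, 4, 5} by decide]
  simp [Finset.prod_insert]
  ring

/-- The sign of a permutation compares an antisymmetric product over pairs with its value at the
identity, and the latter is `1` here. -/
theorem epsZ_perm (σ : Equiv.Perm (Fin 7)) :
    epsZ (σ 0) (σ 1) (σ 2) (σ 3) (σ 4) (σ 5) (σ 6) = Equiv.Perm.sign σ := by
  rw [epsZ_eq, σ.prod_Iio_comp_eq_sign_mul_prod sgnZ_comm]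
  have := epsZ_eq id
  simp only [id] at this
  rw [← this, show epsZ 0 1 2 3 4 5 6 = 1 by decide, mul_one, Int.cast_id]

theorem epsZ_of_not_injective {f : Fin 7 → Fin 7} (hf : ¬ Function.Injective f) :
    epsZ (f 0) (f 1) (f 2) (f 3) (f 4) (f 5) (f 6) = 0 := by
  simp only [Function.Injective, not_forall] at hf
  obtain ⟨i, j, hij, hne⟩ := hf
  have h0 : ∀ a, sgnZ a a = 0 := by decide
  rw [epsZ_eq]
  rcases lt_or_gt_of_ne hne with h | h
  · exact prod_eq_zero (mem_univ j) (prod_eq_zero (Finset.mem_Iio.2 h) (by rw [hij, h0]))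
  · exact prod_eq_zero (mem_univ i) (prod_eq_zero (Finset.mem_Iio.2 h) (by rw [hij, h0]))

/-- The symbol vanishes on repeated indices, so the signed sum over permutations is a free sum over
seven indices. The free sum can be rearranged along the sparse support of `stdZ`. -/
theorem altSum_eq_epsZ (C : (Fin 7 → Fin 7) → ℤ) :
    ∑ σ : Equiv.Perm (Fin 7), ((Equiv.Perm.sign σ : ℤ) : ℝ) * ((C σ : ℤ) : ℝ)
      = ((∑ a, ∑ b, ∑ c, ∑ d, ∑ e, ∑ f, ∑ g, epsZ a b c d e f g * C ![a, b, c, d, e, f, g] : ℤ)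
        : ℝ) := by
  have h : ∑ g : Fin 7 → Fin 7, epsZ (g 0) (g 1) (g 2) (g 3) (g 4) (g 5) (g 6) * C g
      = ∑ a, ∑ b, ∑ c, ∑ d, ∑ e, ∑ f, ∑ g, epsZ a b c d e f g * C ![a, b, c, d, e, f, g] := by
    simp only [sum_pi_succ, Fintype.sum_unique]
    rfl
  rw [← h, ← sum_filter_add_sum_filter_not univ (fun g : Fin 7 → Fin 7 => Function.Bijective g)]
  rw [sum_eq_zero (s := univ.filter fun g : Fin 7 → Fin 7 => ¬ Function.Bijective g)
    (fun g hg => by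
      rw [epsZ_of_not_injective (fun hi => (mem_filter.1 hg).2 (Finite.injective_iff_bijective.1 hi)),
        zero_mul]), add_zero]
  push_cast
  refine sum_bij (fun σ _ => (σ : Fin 7 → Fin 7)) ?_ ?_ ?_ ?_
  · intro σ _; exact mem_filter.2 ⟨mem_univ _, σ.bijective⟩
  · intro σ _ τ _ h; exact Equiv.coe_fn_injective h
  · intro g hg
    exact ⟨Equiv.ofBijective g (mem_filter.1 hg).2, mem_univ _, rfl⟩
  · intro σ _
    rw [epsZ_perm]

/-- The components of the dual of `standardForm`. -/
def stdDualZ (a b c d : Fin 7) : ℤ :=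
  (∑ e, stdZ a b e * stdZ e c d)
    - (if a = c then 1 else 0) * (if b = d then 1 else 0)
    + (if a = d then 1 else 0) * (if b = c then 1 else 0)


theorem sum_stdZ_mul_stdZ :
    ∀ a b, ∑ m, ∑ n, stdZ a m n * stdZ b m n = if a = b then 6 else 0 := by decide +kernel

/-- Only entries with last index `0` are enumerated; transitivity of the stabilizer on directions
supplies the others in `psi_stdForm`. -/
theorem altSum_stdZ_zero (b c d : Fin 7) :
    ∑ i, ∑ j, ∑ k, stdZ i j k * epsZ b c d 0 i j k = 6 * stdDualZ b c d 0 := by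
  rw [sum_stdZ]
  revert b c d
  decide +kernel

/-- The column of `144 s` with index `0`. As for the dual form, the other columns come from symmetry
and not from enumeration. -/
theorem altSum_stdZ_stdZ_stdZ (a : Fin 7) :
    ∑ i, ∑ j, stdZ a i j * ∑ k, ∑ l, stdZ 0 k l * ∑ m, ∑ n, ∑ p, stdZ m n p * epsZ i j k l m n p
      = if a = 0 then 144 else 0 := by
  have h : ∀ (a : Fin 7) (F : Fin 7 → Fin 7 → ℤ), ∑ i, ∑ j, stdZ a i j * F i j
      = (stdTerms.map fun t => if t.1 = a then t.2.2.2 * F t.2.1 t.2.2.1 else 0).sum := by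
    intro a F
    have := sum_stdZ fun i j k => if i = a then F j k else 0
    simpa using this
  simp only [sum_stdZ]
  simp only [h]
  -- If the two pairs share an index, both sides vanish; otherwise the inserted squares are `1`. The
  -- guard lets `lazyMul` skip the inner sum in the first case.
  have h2 : ∀ i j k l, (stdTerms.map fun t => t.2.2.2 * epsZ i j k l t.1 t.2.1 t.2.2.1).sum
      = lazyMul (sgnZ i k ^ 2 * sgnZ j k ^ 2 * sgnZ i l ^ 2 * sgnZ j l ^ 2)
        (stdTerms.map fun t => t.2.2.2 * epsZ i j k l t.1 t.2.1 t.2.2.1).sum := by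
    intro i j k l
    by_cases hz : sgnZ i k = 0 ∨ sgnZ j k = 0 ∨ sgnZ i l = 0 ∨ sgnZ j l = 0
    · rcases hz with hz | hz | hz | hz <;> simp [lazyMul_eq, hz, epsZ]
    · have hs : ∀ a b, sgnZ a b ≠ 0 → sgnZ a b ^ 2 = 1 := by decide
      simp only [not_or] at hz
      rw [hs _ _ hz.1, hs _ _ hz.2.1, hs _ _ hz.2.2.1, hs _ _ hz.2.2.2, lazyMul_eq]
      simp
  have h3 : ∀ a : Fin 7, (stdTerms.map fun t => if t.1 = a then t.2.2.2 *
      (stdTerms.map fun u => if u.1 = 0 then u.2.2.2 *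
        lazyMul (sgnZ t.2.1 u.2.1 ^ 2 * sgnZ t.2.2.1 u.2.1 ^ 2 * sgnZ t.2.1 u.2.2.1 ^ 2 *
          sgnZ t.2.2.1 u.2.2.1 ^ 2) (stdTerms.map fun w => w.2.2.2 *
            epsZ t.2.1 t.2.2.1 u.2.1 u.2.2.1 w.1 w.2.1 w.2.2.1).sum else 0).sum else 0).sum
      = if a = 0 then 144 else 0 := by decide +kernel
  simpa only [← h2] using h3 a

theorem sMatrix_stdForm_zero (a : Fin 7) : sMatrix stdForm a 0 = if a = 0 then 1 else 0 := by
  have h := altSum_eq_epsZ fun f => stdZ a (f 0) (f 1) * stdZ 0 (f 2) (f 3) * stdZ (f 4) (f 5) (f 6)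
  have h2 : ∑ i, ∑ j, ∑ k, ∑ l, ∑ m, ∑ n, ∑ p, epsZ i j k l m n p *
        (stdZ a i j * stdZ 0 k l * stdZ m n p)
      = if a = 0 then 144 else 0 := by
    rw [← altSum_stdZ_stdZ_stdZ]
    simp only [mul_sum]
    refine sum_congr rfl fun i _ => sum_congr rfl fun j _ => sum_congr rfl fun k _ =>
      sum_congr rfl fun l _ => sum_congr rfl fun m _ => sum_congr rfl fun n _ =>
      sum_congr rfl fun p _ => by ring
  have h3 := h.trans (congrArg (Int.cast : ℤ → ℝ) h2)
  have h4 : sMatrix stdForm a 0 = 1 / 144 * ((if a = 0 then 144 else 0 : ℤ) : ℝ) := by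
    rw [← h3, sMatrix]
    simp only [stdForm]
    push_cast
    rfl
  rw [h4]
  split_ifs <;> norm_num

def stdDual : Tensor4 := fun a b c d => (stdDualZ a b c d : ℝ)

theorem altSum_stdForm_zero (b c d : Fin 7) :
    ∑ σ : Equiv.Perm (Fin 7), ((Equiv.Perm.sign σ : ℤ) : ℝ) *
      ((1 : Matrix (Fin 7) (Fin 7) ℝ) b (σ 0) * (1 : Matrix (Fin 7) (Fin 7) ℝ) c (σ 1) *
        (1 : Matrix (Fin 7) (Fin 7) ℝ) d (σ 2) * (1 : Matrix (Fin 7) (Fin 7) ℝ) 0 (σ 3) *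
        stdForm (σ 4) (σ 5) (σ 6)) = 6 * stdDual b c d 0 := by
  have h := altSum_eq_epsZ fun f => (if b = f 0 then 1 else 0) * (if c = f 1 then 1 else 0) *
    (if d = f 2 then 1 else 0) * (if 0 = f 3 then 1 else 0) * stdZ (f 4) (f 5) (f 6)
  have h2 : ∑ i, ∑ j, ∑ k, ∑ l, ∑ m, ∑ n, ∑ p, epsZ i j k l m n p *
      ((if b = i then 1 else 0) * (if c = j then 1 else 0) *
    (if d = k then 1 else 0) * (if 0 = l then 1 else 0) * stdZ m n p) = 6 * stdDualZ b c d 0 := by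
    rw [← altSum_stdZ_zero, sum_eq_single b, sum_eq_single c, sum_eq_single d, sum_eq_single 0]
    · simp only [if_true, one_mul]
      exact sum_congr rfl fun _ _ => sum_congr rfl fun _ _ => sum_congr rfl fun _ _ => by ring
    all_goals simp +contextual [eq_comm]
  have h3 := h.trans (congrArg (Int.cast : ℤ → ℝ) h2)
  simp only [Matrix.one_apply, stdForm, stdDual]
  push_cast at h3
  exact h3

/-! ### The stabilizer of the standard form is transitive on directions -/

theorem sum_stdForm (F : Fin 7 → Fin 7 → Fin 7 → ℝ) : ∑ a, ∑ b, ∑ c, stdForm a b c * F a b c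
    = (stdTerms.map fun t => (t.2.2.2 : ℝ) * F t.1 t.2.1 t.2.2.1).sum := by
  have h : ∀ a b c, stdZ a b c
      = (stdTerms.map fun t => if t.1 = a ∧ t.2.1 = b ∧ t.2.2.1 = c then t.2.2.2 else 0).sum := by
    decide +kernel
  simp only [stdForm, h]
  generalize stdTerms = L
  induction L with
  | nil => simp
  | cons t L ih =>
    simp only [List.map_cons, List.sum_cons, add_mul, sum_add_distrib, ih, Int.cast_add]
    congr 1
    rw [sum_eq_single t.1, sum_eq_single t.2.1, sum_eq_single t.2.2.1]
    · simp
    all_goals simp +contextual [eq_comm]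

theorem standardForm_eq_sum (x y z : Fin 7 → ℝ) :
    standardForm x y z = ∑ i, x i * ∑ j, y j * ∑ k, z k * stdForm i j k := by
  have h2 : ∑ i, x i * ∑ j, y j * ∑ k, z k * stdForm i j k
      = ∑ a, ∑ b, ∑ c, stdForm a b c * (x a * y b * z c) := by
    simp only [mul_sum]
    exact sum_congr rfl fun _ _ => sum_congr rfl fun _ _ => sum_congr rfl fun _ _ => by ring
  rw [h2, sum_stdForm]
  simp only [stdTerms, List.map_cons, List.map_nil, List.sum_cons, List.sum_nil, standardForm,
    elementaryForm, det_fin_three, of_apply, cons_val', cons_val_zero, cons_val_one,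
    Matrix.cons_val, Int.cast_one, Int.cast_neg]
  ring

theorem pull3_stdForm (P : Matrix (Fin 7) (Fin 7) ℝ) (a b c : Fin 7) :
    pull3 P stdForm a b c
      = standardForm (fun i => P i a) (fun i => P i b) (fun i => P i c) := by
  rw [standardForm_eq_sum]; rfl

theorem isPositive_iff (φ : Tensor3) :
    IsPositive φ ↔ ∃ A : Matrix (Fin 7) (Fin 7) ℝ, A.det ≠ 0 ∧ φ = pull3 A stdForm := by
  simp only [IsPositive, isUnit_iff_ne_zero, ← pull3_stdForm]
  refine exists_congr fun A => and_congr_right fun _ => ⟨fun h => ?_, fun h a b c => by rw [h]⟩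
  funext a b c; exact h a b c

/-- `P` is orthogonal and preserves the standard form. -/
structure IsStdIsometry (P : Matrix (Fin 7) (Fin 7) ℝ) : Prop where
  form : ∀ x y z, standardForm (P *ᵥ x) (P *ᵥ y) (P *ᵥ z) = standardForm x y z
  orth : ∀ x y, (P *ᵥ x) ⬝ᵥ (P *ᵥ y) = x ⬝ᵥ y

theorem IsStdIsometry.mul {P Q : Matrix (Fin 7) (Fin 7) ℝ} (hP : IsStdIsometry P)
    (hQ : IsStdIsometry Q) : IsStdIsometry (P * Q) :=
  ⟨fun x y z => by simp only [← mulVec_mulVec, hP.form, hQ.form],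
    fun x y => by simp only [← mulVec_mulVec, hP.orth, hQ.orth]⟩

theorem IsStdIsometry.pull3 {P : Matrix (Fin 7) (Fin 7) ℝ} (hP : IsStdIsometry P) :
    pull3 P stdForm = stdForm := by
  funext a b c
  have h := hP.form (Pi.single a 1) (Pi.single b 1) (Pi.single c 1)
  simp only [mulVec_single_one] at h
  have h2 := pull3_stdForm 1 a b c
  rw [pull3_one] at h2
  rw [pull3_stdForm, h2]
  refine h.trans ?_
  congr 1 <;> funext i <;> simp [Matrix.one_apply, Pi.single_apply]

theorem IsStdIsometry.transpose_mul {P : Matrix (Fin 7) (Fin 7) ℝ} (hP : IsStdIsometry P) :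
    Pᵀ * P = 1 := by
  ext a b
  have h := hP.orth (Pi.single a 1) (Pi.single b 1)
  simpa [mulVec_single_one, Matrix.mul_apply, dotProduct, Matrix.one_apply, Pi.single_apply,
    eq_comm] using h

theorem IsStdIsometry.det_mul_det {P : Matrix (Fin 7) (Fin 7) ℝ} (hP : IsStdIsometry P) :
    P.det * P.det = 1 := by
  have := congrArg det hP.transpose_mul
  rwa [det_mul, det_transpose, det_one] at this

theorem IsStdIsometry.det_ne_zero {P : Matrix (Fin 7) (Fin 7) ℝ} (hP : IsStdIsometry P) :
    P.det ≠ 0 := fun h => by simpa [h] using hP.det_mul_det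

theorem elementaryForm_eq (i j k : Fin 7) (x y z : Fin 7 → ℝ) :
    elementaryForm i j k x y z = x i * y j * z k - x i * z j * y k - y i * x j * z k
      + y i * z j * x k + z i * x j * y k - z i * y j * x k := by
  simp only [elementaryForm, det_fin_three, of_apply, cons_val', cons_val_zero, cons_val_one,
    Matrix.cons_val]
  ring

/-- Any vector is carried to a vector with vanishing coordinate `q` by a rotation in the plane of
`p` and `q`. -/
theorem exists_rotation (a b : ℝ) : ∃ c s : ℝ, c ^ 2 + s ^ 2 = 1 ∧ -s * a + c * b = 0 := by
  -- Rotation by the polar angle of `(a, b)`. At the origin every angle works, so the default value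
  -- of `arg` does no harm.
  refine ⟨Real.cos (Complex.arg ⟨a, b⟩), Real.sin (Complex.arg ⟨a, b⟩),
    Real.cos_sq_add_sin_sq _, ?_⟩
  have h1 := Complex.norm_mul_cos_arg ⟨a, b⟩
  have h2 := Complex.norm_mul_sin_arg ⟨a, b⟩
  simp only at h1 h2
  set θ := Complex.arg ⟨a, b⟩
  linear_combination Real.sin θ * h1 - Real.cos θ * h2

/-- With `e₀, e₁, e₂` fixed, the form involves the remaining coordinates only through the area forms
of the planes `34` and `56` and through the real and imaginary parts of `(e₃ + i e₄) ∧ (e₅ + i e₆)`.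
Rotations by opposite angles preserve all of these. Each of the next five lemmas likewise fixes the
three coordinates of one term of the form and rotates two planes among the other four. -/
theorem exists_isStdIsometry_3_4 (x : Fin 7 → ℝ) : ∃ (P : Matrix (Fin 7) (Fin 7) ℝ)
    (c s : ℝ), IsStdIsometry P ∧ -s * x 3 + c * x 4 = 0 ∧
      P *ᵥ x = ![x 0, x 1, x 2, c * x 3 + s * x 4,
        -s * x 3 + c * x 4, c * x 5 - s * x 6, s * x 5 + c * x 6] := by
  obtain ⟨c, s, h, h0⟩ := exists_rotation (x 3) (x 4)
  have key : ∀ x, !![1, 0, 0, 0, 0, 0, 0; 0, 1, 0, 0, 0, 0, 0; 0, 0, 1, 0, 0, 0, 0;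
    0, 0, 0, c, s, 0, 0; 0, 0, 0, -s, c, 0, 0; 0, 0, 0, 0, 0, c, -s; 0, 0, 0, 0, 0, s, c] *ᵥ x
      = ![x 0, x 1, x 2, c * x 3 + s * x 4,
        -s * x 3 + c * x 4, c * x 5 - s * x 6, s * x 5 + c * x 6] := by
    intro x
    funext i
    fin_cases i <;> simp [mulVec, dotProduct, Fin.sum_univ_seven] <;> ring
  refine ⟨_, c, s, ⟨fun x y z => ?_, fun x y => ?_⟩, h0, key x⟩
  · simp only [key, standardForm, elementaryForm_eq, Matrix.cons_val]
    -- The term of the fixed triple is unchanged; all the others are multiplied by `c² + s²`.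
    linear_combination (norm := skip) h * (standardForm x y z - (elementaryForm 0 1 2 x y z))
    simp only [standardForm, elementaryForm_eq]
    ring
  · simp only [key, dotProduct, Fin.sum_univ_seven, Matrix.cons_val]
    linear_combination h * (x 3 * y 3 + x 4 * y 4 + x 5 * y 5 + x 6 * y 6)

theorem exists_isStdIsometry_5_6 (x : Fin 7 → ℝ) : ∃ (P : Matrix (Fin 7) (Fin 7) ℝ)
    (c s : ℝ), IsStdIsometry P ∧ -s * x 5 + c * x 6 = 0 ∧
      P *ᵥ x = ![x 0, c * x 1 - s * x 2, s * x 1 + c * x 2, x 3,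
        x 4, c * x 5 + s * x 6, -s * x 5 + c * x 6] := by
  obtain ⟨c, s, h, h0⟩ := exists_rotation (x 5) (x 6)
  have key : ∀ x, !![1, 0, 0, 0, 0, 0, 0; 0, c, -s, 0, 0, 0, 0; 0, s, c, 0, 0, 0, 0;
    0, 0, 0, 1, 0, 0, 0; 0, 0, 0, 0, 1, 0, 0; 0, 0, 0, 0, 0, c, s; 0, 0, 0, 0, 0, -s, c] *ᵥ x
      = ![x 0, c * x 1 - s * x 2, s * x 1 + c * x 2, x 3,
        x 4, c * x 5 + s * x 6, -s * x 5 + c * x 6] := by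
    intro x
    funext i
    fin_cases i <;> simp [mulVec, dotProduct, Fin.sum_univ_seven] <;> ring
  refine ⟨_, c, s, ⟨fun x y z => ?_, fun x y => ?_⟩, h0, key x⟩
  · simp only [key, standardForm, elementaryForm_eq, Matrix.cons_val]
    linear_combination (norm := skip) h * (standardForm x y z - (elementaryForm 0 3 4 x y z))
    simp only [standardForm, elementaryForm_eq]
    ring
  · simp only [key, dotProduct, Fin.sum_univ_seven, Matrix.cons_val]
    linear_combination h * (x 5 * y 5 + x 6 * y 6 + x 1 * y 1 + x 2 * y 2)

theorem exists_isStdIsometry_3_5 (x : Fin 7 → ℝ) : ∃ (P : Matrix (Fin 7) (Fin 7) ℝ)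
    (c s : ℝ), IsStdIsometry P ∧ -s * x 3 + c * x 5 = 0 ∧
      P *ᵥ x = ![x 0, x 1, x 2, c * x 3 + s * x 5,
        s * x 6 + c * x 4, -s * x 3 + c * x 5, c * x 6 - s * x 4] := by
  obtain ⟨c, s, h, h0⟩ := exists_rotation (x 3) (x 5)
  have key : ∀ x, !![1, 0, 0, 0, 0, 0, 0; 0, 1, 0, 0, 0, 0, 0; 0, 0, 1, 0, 0, 0, 0;
    0, 0, 0, c, 0, s, 0; 0, 0, 0, 0, c, 0, s; 0, 0, 0, -s, 0, c, 0; 0, 0, 0, 0, -s, 0, c] *ᵥ x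
      = ![x 0, x 1, x 2, c * x 3 + s * x 5,
        s * x 6 + c * x 4, -s * x 3 + c * x 5, c * x 6 - s * x 4] := by
    intro x
    funext i
    fin_cases i <;> simp [mulVec, dotProduct, Fin.sum_univ_seven] <;> ring
  refine ⟨_, c, s, ⟨fun x y z => ?_, fun x y => ?_⟩, h0, key x⟩
  · simp only [key, standardForm, elementaryForm_eq, Matrix.cons_val]
    linear_combination (norm := skip) h * (standardForm x y z - (elementaryForm 0 1 2 x y z))
    simp only [standardForm, elementaryForm_eq]
    ring
  · simp only [key, dotProduct, Fin.sum_univ_seven, Matrix.cons_val]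
    linear_combination h * (x 3 * y 3 + x 5 * y 5 + x 6 * y 6 + x 4 * y 4)

theorem exists_isStdIsometry_1_2 (x : Fin 7 → ℝ) : ∃ (P : Matrix (Fin 7) (Fin 7) ℝ)
    (c s : ℝ), IsStdIsometry P ∧ -s * x 1 + c * x 2 = 0 ∧
      P *ᵥ x = ![x 0, c * x 1 + s * x 2, -s * x 1 + c * x 2, x 3,
        x 4, c * x 5 - s * x 6, s * x 5 + c * x 6] := by
  obtain ⟨c, s, h, h0⟩ := exists_rotation (x 1) (x 2)
  have key : ∀ x, !![1, 0, 0, 0, 0, 0, 0; 0, c, s, 0, 0, 0, 0; 0, -s, c, 0, 0, 0, 0;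
    0, 0, 0, 1, 0, 0, 0; 0, 0, 0, 0, 1, 0, 0; 0, 0, 0, 0, 0, c, -s; 0, 0, 0, 0, 0, s, c] *ᵥ x
      = ![x 0, c * x 1 + s * x 2, -s * x 1 + c * x 2, x 3,
        x 4, c * x 5 - s * x 6, s * x 5 + c * x 6] := by
    intro x
    funext i
    fin_cases i <;> simp [mulVec, dotProduct, Fin.sum_univ_seven] <;> ring
  refine ⟨_, c, s, ⟨fun x y z => ?_, fun x y => ?_⟩, h0, key x⟩
  · simp only [key, standardForm, elementaryForm_eq, Matrix.cons_val]
    linear_combination (norm := skip) h * (standardForm x y z - (elementaryForm 0 3 4 x y z))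
    simp only [standardForm, elementaryForm_eq]
    ring
  · simp only [key, dotProduct, Fin.sum_univ_seven, Matrix.cons_val]
    linear_combination h * (x 1 * y 1 + x 2 * y 2 + x 5 * y 5 + x 6 * y 6)

theorem exists_isStdIsometry_0_3 (x : Fin 7 → ℝ) : ∃ (P : Matrix (Fin 7) (Fin 7) ℝ)
    (c s : ℝ), IsStdIsometry P ∧ -s * x 0 + c * x 3 = 0 ∧
      P *ᵥ x = ![c * x 0 + s * x 3, x 1, c * x 2 - s * x 5, -s * x 0 + c * x 3,
        x 4, s * x 2 + c * x 5, x 6] := by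
  obtain ⟨c, s, h, h0⟩ := exists_rotation (x 0) (x 3)
  have key : ∀ x, !![c, 0, 0, s, 0, 0, 0; 0, 1, 0, 0, 0, 0, 0; 0, 0, c, 0, 0, -s, 0;
    -s, 0, 0, c, 0, 0, 0; 0, 0, 0, 0, 1, 0, 0; 0, 0, s, 0, 0, c, 0; 0, 0, 0, 0, 0, 0, 1] *ᵥ x
      = ![c * x 0 + s * x 3, x 1, c * x 2 - s * x 5, -s * x 0 + c * x 3,
        x 4, s * x 2 + c * x 5, x 6] := by
    intro x
    funext i
    fin_cases i <;> simp [mulVec, dotProduct, Fin.sum_univ_seven] <;> ring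
  refine ⟨_, c, s, ⟨fun x y z => ?_, fun x y => ?_⟩, h0, key x⟩
  · simp only [key, standardForm, elementaryForm_eq, Matrix.cons_val]
    linear_combination (norm := skip) h * (standardForm x y z - (-elementaryForm 1 4 6 x y z))
    simp only [standardForm, elementaryForm_eq]
    ring
  · simp only [key, dotProduct, Fin.sum_univ_seven, Matrix.cons_val]
    linear_combination h * (x 0 * y 0 + x 3 * y 3 + x 2 * y 2 + x 5 * y 5)

theorem exists_isStdIsometry_0_1 (x : Fin 7 → ℝ) : ∃ (P : Matrix (Fin 7) (Fin 7) ℝ)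
    (c s : ℝ), IsStdIsometry P ∧ -s * x 0 + c * x 1 = 0 ∧
      P *ᵥ x = ![c * x 0 + s * x 1, -s * x 0 + c * x 1, x 2, s * x 6 + c * x 3,
        x 4, x 5, c * x 6 - s * x 3] := by
  obtain ⟨c, s, h, h0⟩ := exists_rotation (x 0) (x 1)
  have key : ∀ x, !![c, s, 0, 0, 0, 0, 0; -s, c, 0, 0, 0, 0, 0; 0, 0, 1, 0, 0, 0, 0;
    0, 0, 0, c, 0, 0, s; 0, 0, 0, 0, 1, 0, 0; 0, 0, 0, 0, 0, 1, 0; 0, 0, 0, -s, 0, 0, c] *ᵥ x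
      = ![c * x 0 + s * x 1, -s * x 0 + c * x 1, x 2, s * x 6 + c * x 3,
        x 4, x 5, c * x 6 - s * x 3] := by
    intro x
    funext i
    fin_cases i <;> simp [mulVec, dotProduct, Fin.sum_univ_seven] <;> ring
  refine ⟨_, c, s, ⟨fun x y z => ?_, fun x y => ?_⟩, h0, key x⟩
  · simp only [key, standardForm, elementaryForm_eq, Matrix.cons_val]
    linear_combination (norm := skip) h * (standardForm x y z - (-elementaryForm 2 4 5 x y z))
    simp only [standardForm, elementaryForm_eq]
    ring
  · simp only [key, dotProduct, Fin.sum_univ_seven, Matrix.cons_val]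
    linear_combination h * (x 0 * y 0 + x 1 * y 1 + x 6 * y 6 + x 3 * y 3)

/-- Every vector is carried to a multiple of the first basis vector. -/
theorem exists_isStdIsometry_mulVec (x : Fin 7 → ℝ) :
    ∃ (P : Matrix (Fin 7) (Fin 7) ℝ) (t : ℝ), IsStdIsometry P ∧ P *ᵥ x = t • Pi.single 0 1 := by
  -- Coordinates 4, 6, 5, 2, 3, 1 are removed in this order. From the third rotation on, the second
  -- rotated plane contains only coordinates that already vanish, so nothing is reintroduced.
  obtain ⟨P1, c1, s1, h1, e1, p1⟩ := exists_isStdIsometry_3_4 x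
  obtain ⟨P2, c2, s2, h2, e2, p2⟩ := exists_isStdIsometry_5_6 (P1 *ᵥ x)
  obtain ⟨P3, c3, s3, h3, e3, p3⟩ := exists_isStdIsometry_3_5 (P2 *ᵥ P1 *ᵥ x)
  obtain ⟨P4, c4, s4, h4, e4, p4⟩ := exists_isStdIsometry_1_2 (P3 *ᵥ P2 *ᵥ P1 *ᵥ x)
  obtain ⟨P5, c5, s5, h5, e5, p5⟩ := exists_isStdIsometry_0_3 (P4 *ᵥ P3 *ᵥ P2 *ᵥ P1 *ᵥ x)
  obtain ⟨P6, c6, s6, h6, e6, p6⟩ := exists_isStdIsometry_0_1 (P5 *ᵥ P4 *ᵥ P3 *ᵥ P2 *ᵥ P1 *ᵥ x)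
  refine ⟨P6 * (P5 * (P4 * (P3 * (P2 * P1)))), (P6 *ᵥ P5 *ᵥ P4 *ᵥ P3 *ᵥ P2 *ᵥ P1 *ᵥ x) 0,
    h6.mul (h5.mul (h4.mul (h3.mul (h2.mul h1)))), ?_⟩
  simp only [← mulVec_mulVec]
  generalize P1 *ᵥ x = x1 at *
  generalize P2 *ᵥ x1 = x2 at *
  generalize P3 *ᵥ x2 = x3 at *
  generalize P4 *ᵥ x3 = x4 at *
  generalize P5 *ᵥ x4 = x5 at *
  subst p1 p2 p3 p4 p5
  simp only [Matrix.cons_val] at *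
  funext i
  fin_cases i <;> simp_all

/-! ### Metric and dual of positive forms -/

/-- Every vector is carried to a multiple of `e₀` by an isometry `P` fixing the form, and `e₀` is
fixed by `s`; so every vector is an eigenvector, with eigenvalue `P.det`. The sign of `P.det` is not
known, but comparing `e₀`, `e_b` and `e₀ + e_b` forces the eigenvalue `1`. -/
theorem sMatrix_stdForm : sMatrix stdForm = 1 := by
  have h0 : sMatrix stdForm *ᵥ Pi.single 0 1 = Pi.single 0 1 := by
    rw [mulVec_single_one]
    funext a
    simp [sMatrix_stdForm_zero, Pi.single_apply]
  have key : ∀ w, ∃ ε : ℝ, sMatrix stdForm *ᵥ w = ε • w := by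
    intro w
    obtain ⟨P, t, hP, hw⟩ := exists_isStdIsometry_mulVec w
    refine ⟨P.det, ?_⟩
    have h := sMatrix_pull3 P stdForm
    rw [hP.pull3] at h
    rw [h, smul_mulVec, ← mulVec_mulVec, ← mulVec_mulVec, hw, mulVec_smul, h0, ← hw,
      mulVec_mulVec, hP.transpose_mul, one_mulVec]
  have entry : ∀ a b, (sMatrix stdForm *ᵥ Pi.single b 1) a = sMatrix stdForm a b := by
    intro a b; rw [mulVec_single_one]; rfl
  ext a b
  by_cases hb : b = 0
  · subst hb; rw [sMatrix_stdForm_zero, Matrix.one_apply]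
  obtain ⟨ε, hε⟩ := key (Pi.single b 1)
  obtain ⟨δ, hδ⟩ := key (Pi.single 0 1 + Pi.single b 1)
  rw [mulVec_add] at hδ
  have e1 := congrFun hε 0
  have e2 := congrFun hδ 0
  have e3 := congrFun hδ a
  simp only [Pi.add_apply, Pi.smul_apply, entry, sMatrix_stdForm_zero, Pi.single_apply,
    smul_eq_mul, if_true, Ne.symm hb, if_false] at e1 e2 e3
  rw [e1] at e2
  have : δ = 1 := by linarith
  rw [this] at e3
  rw [Matrix.one_apply]
  linarith

theorem metric_stdForm : metric stdForm = 1 := by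
  have h : ninthRoot 1 = 1 := by simpa using ninthRoot_pow_nine 1
  rw [metric_eq_smul, sMatrix_stdForm, det_one, h, inv_one, one_smul]

theorem metricInv_stdForm : metricInv stdForm = 1 := by
  rw [metricInv, metric_stdForm, inv_one]

theorem metric_pull3_stdForm {P : Matrix (Fin 7) (Fin 7) ℝ} (hP : P.det ≠ 0) :
    metric (pull3 P stdForm) = Pᵀ * P := by
  rw [metric_pull3 hP, metric_stdForm, Matrix.mul_one]

theorem psi_stdForm_zero (b c d : Fin 7) : psi stdForm b c d 0 = stdDual b c d 0 := by
  have h : ninthRoot 1 = 1 := by simpa using ninthRoot_pow_nine 1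
  rw [psi, metric_stdForm, sMatrix_stdForm, det_one, h, altSum_stdForm_zero]
  ring

/-- `φ_abe h^ef φ_fcd - g_ac g_bd + g_ad g_bc`. -/
def formSquare (φ : Tensor3) (G H : Matrix (Fin 7) (Fin 7) ℝ) : Tensor4 := fun a b c d =>
  ∑ e, φ a b e * ∑ f, H e f * φ f c d - G a c * G b d + G a d * G b c

/-- At a contracted pair of indices the matrix `P` meets its inverse, so only the free indices are
transformed. -/
theorem sum_pull3_mul_pull3 {P : Matrix (Fin 7) (Fin 7) ℝ} (hP : P.det ≠ 0) (φ : Tensor3)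
    (H : Matrix (Fin 7) (Fin 7) ℝ) (a b c d : Fin 7) :
    ∑ e, pull3 P φ a b e * ∑ f, (P⁻¹ * H * P⁻¹ᵀ) e f * pull3 P φ f c d
      = pull4 P (fun a b c d => ∑ e, φ a b e * ∑ f, H e f * φ f c d) a b c d := by
  have hu : IsUnit P.det := hP.isUnit
  have h1 : ∀ e, ∑ f, (P⁻¹ * H * P⁻¹ᵀ) e f * pull3 P φ f c d
      = ∑ j, P⁻¹ e j * ∑ i, H j i * pull2 P (φ i) c d := by
    intro e
    rw [sum_mul_pull3, pull2_sum_smul]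
    have : P *ᵥ (P⁻¹ * H * P⁻¹ᵀ) e = (P⁻¹ * H) e := by
      have h2 : (P⁻¹ * H * P⁻¹ᵀ) * Pᵀ = P⁻¹ * H := by
        rw [Matrix.mul_assoc, ← transpose_mul, Matrix.mul_nonsing_inv _ hu, transpose_one,
          Matrix.mul_one]
      funext i
      refine Eq.trans ?_ (congrFun (congrFun h2 e) i)
      rw [Matrix.mul_apply]
      simp only [mulVec, dotProduct, transpose_apply]
      exact sum_congr rfl fun j _ => mul_comm (P i j) ((P⁻¹ * H * P⁻¹ᵀ) e j)
    rw [this]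
    simp only [Matrix.mul_apply, sum_mul, mul_sum]
    rw [sum_comm]
    exact sum_congr rfl fun _ _ => sum_congr rfl fun _ _ => by ring
  have h3 : ∀ j, ∑ e, P⁻¹ e j * pull3 P φ a b e = pull2 P (fun p q => φ p q j) a b := by
    intro j
    rw [sum_mul_pull3_last P (fun e => P⁻¹ e j)]
    have : P *ᵥ (fun e => P⁻¹ e j) = Pi.single j 1 := by
      funext i
      have := congrFun (congrFun (Matrix.mul_nonsing_inv _ hu) i) j
      rw [Matrix.mul_apply] at this
      simpa [mulVec, dotProduct, Matrix.one_apply, Pi.single_apply, eq_comm] using this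
    rw [this]
    simp [Pi.single_apply]
  simp only [h1]
  calc _ = ∑ j, (∑ e, P⁻¹ e j * pull3 P φ a b e) * ∑ i, H j i * pull2 P (φ i) c d := by
        simp only [sum_mul]
        simp only [mul_sum]
        rw [sum_comm]
        exact sum_congr rfl fun _ _ => sum_congr rfl fun _ _ => sum_congr rfl fun _ _ => by ring
    _ = ∑ j, pull2 P (fun p q => φ p q j) a b * pull2 P (fun k l => ∑ i, H j i * φ i k l) c d := by
        simp only [h3, pull2_sum_smul]
    _ = _ := by
        rw [pull4]
        simp only [pull3]
        have : ∀ i p, pull2 P (fun c d => ∑ e, φ i p e * ∑ f, H e f * φ f c d) c d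
            = ∑ e, φ i p e * pull2 P (fun c d => ∑ f, H e f * φ f c d) c d := fun i p =>
          pull2_sum_smul P _ (fun e c d => ∑ f, H e f * φ f c d) c d
        simp only [this]
        obtain ⟨K, hK⟩ : ∃ K : Fin 7 → ℝ, ∀ j, pull2 P (fun k l => ∑ i, H j i * φ i k l) c d = K j :=
          ⟨_, fun _ => rfl⟩
        simp only [hK]
        simp only [pull2, pull1, mul_sum, sum_mul]
        rw [sum_comm]
        refine sum_congr rfl fun _ _ => ?_
        rw [sum_comm]
        exact sum_congr rfl fun _ _ => sum_congr rfl fun _ _ => by ring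

theorem sum_mul_mul_pull (P : Matrix (Fin 7) (Fin 7) ℝ) (α : Tensor1) (a : Fin 7) (r : ℝ) :
    ∑ i, P i a * (r * α i) = r * pull1 P α a := by
  simp only [pull1, mul_sum]
  exact sum_congr rfl fun _ _ => by ring

theorem pull4_mul_mul (P : Matrix (Fin 7) (Fin 7) ℝ) (U V : Tensor2) (a b c d : Fin 7) :
    pull4 P (fun a b c d => U a c * V b d) a b c d = pull2 P U a c * pull2 P V b d := by
  have h1 : ∀ i j, pull2 P (fun c d => U i c * V j d) c d = pull1 P (U i) c * pull1 P (V j) d := by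
    intro i j
    rw [pull1_mul, pull2]
    exact sum_congr rfl fun k _ => congrArg _ (sum_mul_mul_pull P (V j) d (U i k))
  rw [pull4]
  simp only [pull3, h1]
  have h2 : ∀ i, ∑ j, P j b * (pull1 P (U i) c * pull1 P (V j) d)
      = pull1 P (U i) c * pull2 P V b d := fun i =>
    sum_mul_mul_pull P (fun j => pull1 P (V j) d) b _
  simp only [h2]
  exact (pull1_mul P (fun i => pull1 P (U i) c) a _).symm

theorem pull4_mul_mul' (P : Matrix (Fin 7) (Fin 7) ℝ) (U V : Tensor2) (a b c d : Fin 7) :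
    pull4 P (fun a b c d => U a d * V b c) a b c d = pull2 P U a d * pull2 P V b c := by
  have h1 : ∀ i j, pull2 P (fun c d => U i d * V j c) c d = pull1 P (U i) d * pull1 P (V j) c := by
    intro i j
    rw [mul_comm, pull1_mul, pull2]
    refine sum_congr rfl fun k _ => congrArg _ ?_
    rw [← sum_mul_mul_pull]
    exact sum_congr rfl fun l _ => by ring
  rw [pull4]
  simp only [pull3, h1]
  have h2 : ∀ i, ∑ j, P j b * (pull1 P (U i) d * pull1 P (V j) c)
      = pull1 P (U i) d * pull2 P V b c := fun i =>
    sum_mul_mul_pull P (fun j => pull1 P (V j) c) b _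
  simp only [h2]
  exact (pull1_mul P (fun i => pull1 P (U i) d) a _).symm

theorem formSquare_pull3 {P : Matrix (Fin 7) (Fin 7) ℝ} (hP : P.det ≠ 0) (φ : Tensor3)
    (G H : Matrix (Fin 7) (Fin 7) ℝ) :
    formSquare (pull3 P φ) (Pᵀ * G * P) (P⁻¹ * H * P⁻¹ᵀ) = pull4 P (formSquare φ G H) := by
  funext a b c d
  have e : pull4 P (formSquare φ G H) a b c d
      = pull4 P (fun a b c d => ∑ e, φ a b e * ∑ f, H e f * φ f c d) a b c d
        - pull4 P (fun a b c d => G a c * G b d) a b c d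
        + pull4 P (fun a b c d => G a d * G b c) a b c d := by
    simp only [formSquare, pull4, pull3, pull2, pull1, mul_add, mul_sub, sum_add_distrib,
      sum_sub_distrib]
  rw [e, ← sum_pull3_mul_pull3 hP, pull4_mul_mul P (fun i j => G i j) fun i j => G i j,
    pull4_mul_mul' P (fun i j => G i j) fun i j => G i j]
  simp only [pull2_matrix]
  rfl

theorem formSquare_stdForm : formSquare stdForm 1 1 = stdDual := by
  funext a b c d
  simp only [formSquare, stdDual, stdDualZ, stdForm, Matrix.one_apply]
  push_cast
  simp

/-- Both sides are invariant under isometries of the standard form and agree when the last index is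
`0`. An isometry carrying `e_d` to a multiple of `e₀` reduces the general entry to that case. -/
theorem psi_stdForm : psi stdForm = stdDual := by
  funext a b c d
  obtain ⟨P, t, hP, hw⟩ := exists_isStdIsometry_mulVec (Pi.single d 1)
  have hdet := hP.det_ne_zero
  have h1 : psi stdForm = pull4 P (psi stdForm) := by
    conv_lhs => rw [← hP.pull3, psi_pull3 hdet]
  have h2 : stdDual = pull4 P stdDual := by
    have := formSquare_pull3 hdet stdForm 1 1
    have hi : P⁻¹ * P⁻¹ᵀ = 1 := by
      rw [transpose_nonsing_inv, ← Matrix.mul_inv_rev, hP.transpose_mul, inv_one]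
    rw [hP.pull3, Matrix.mul_one, Matrix.mul_one, hP.transpose_mul, hi, formSquare_stdForm] at this
    exact this
  have e : ∀ X : Tensor4, X = pull4 P X → X a b c d
      = pull3 P (fun i j k => t * X i j k 0) a b c := by
    intro X hX
    have := sum_mul_pull4_last P (Pi.single d 1) X a b c
    rw [← hX, hw] at this
    simpa [Pi.single_apply] using this
  rw [e _ h1, e _ h2]
  simp only [psi_stdForm_zero]

/-- The contraction identity of `G₂` geometry, transported from the standard form by naturality. It
replaces the sum over permutations by a polynomial in `φ`, `g` and `g⁻¹`, suited to evaluation and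
to differentiation. -/
theorem IsPositive.psi_eq {φ : Tensor3} (h : IsPositive φ) :
    psi φ = formSquare φ (metric φ) (metricInv φ) := by
  obtain ⟨A, hA, rfl⟩ := (isPositive_iff φ).1 h
  rw [psi_pull3 hA, metric_pull3 hA, metricInv_pull3 hA, formSquare_pull3 hA, metric_stdForm,
    metricInv_stdForm, formSquare_stdForm, psi_stdForm]

/-! ### The norm identity for positive forms. -/

/-- `φ_amn φ_bpq h^mp h^nq`. -/
def formNorm (φ : Tensor3) (H : Matrix (Fin 7) (Fin 7) ℝ) : Tensor2 := fun a b =>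
  ∑ m, ∑ n, φ a m n * ∑ p, ∑ q, H m p * H n q * φ b p q

theorem formNorm_eq_trace (φ : Tensor3) (H : Matrix (Fin 7) (Fin 7) ℝ) (a b : Fin 7) :
    formNorm φ H a b = ((Matrix.of (φ a))ᵀ * (H * Matrix.of (φ b) * Hᵀ)).trace := by
  simp only [formNorm, trace, Matrix.diag, Matrix.mul_apply, transpose_apply, of_apply, sum_mul, mul_sum]
  rw [sum_comm]
  refine sum_congr rfl fun _ _ => sum_congr rfl fun _ _ => ?_
  rw [sum_comm]
  exact sum_congr rfl fun _ _ => sum_congr rfl fun _ _ => by ring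

/-- Written as a trace, the double contraction loses `P` and its inverse by cyclicity; the two free
indices remain. -/
theorem formNorm_pull3 {P : Matrix (Fin 7) (Fin 7) ℝ} (hP : P.det ≠ 0) (φ : Tensor3)
    (H : Matrix (Fin 7) (Fin 7) ℝ) :
    formNorm (pull3 P φ) (P⁻¹ * H * P⁻¹ᵀ) = pull2 P (formNorm φ H) := by
  have hu : IsUnit P.det := hP.isUnit
  have hi : P⁻¹ᵀ * Pᵀ = 1 := by
    rw [← transpose_mul, Matrix.mul_nonsing_inv _ hu, transpose_one]
  have hi2 : P * P⁻¹ = 1 := Matrix.mul_nonsing_inv _ hu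
  have key : ∀ X Y : Matrix (Fin 7) (Fin 7) ℝ,
      ((Pᵀ * X * P)ᵀ * ((P⁻¹ * H * P⁻¹ᵀ) * (Pᵀ * Y * P) * (P⁻¹ * H * P⁻¹ᵀ)ᵀ)).trace
        = (Xᵀ * (H * Y * Hᵀ)).trace := by
    intro X Y
    have : (Pᵀ * X * P)ᵀ * ((P⁻¹ * H * P⁻¹ᵀ) * (Pᵀ * Y * P) * (P⁻¹ * H * P⁻¹ᵀ)ᵀ)
        = Pᵀ * (Xᵀ * ((P * P⁻¹) * (H * ((P⁻¹ᵀ * Pᵀ) * (Y * ((P * P⁻¹) * (Hᵀ * P⁻¹ᵀ))))))) := by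
      simp only [transpose_mul, transpose_transpose, Matrix.mul_assoc]
    rw [this, hi, hi2, Matrix.one_mul, Matrix.one_mul, Matrix.one_mul, trace_mul_comm]
    simp only [Matrix.mul_assoc, hi, Matrix.mul_one]
  have expand : ∀ a, Matrix.of (pull3 P φ a) = Pᵀ * (∑ i, P i a • Matrix.of (φ i)) * P := by
    intro a
    rw [show ∑ i, P i a • Matrix.of (φ i) = Matrix.of (fun j k => ∑ i, P i a * φ i j k) by
      ext j k; simp [Matrix.sum_apply], ← pull2_eq]
    ext j k
    simp only [of_apply, pull2_sum_smul]
    rfl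
  funext a b
  rw [formNorm_eq_trace, expand, expand, key]
  simp only [pull2, pull1, formNorm_eq_trace, transpose_sum, transpose_smul,
    Matrix.sum_mul, trace_sum, Matrix.smul_mul, Matrix.mul_smul, trace_smul, smul_eq_mul, mul_sum]
  rw [sum_comm]
  exact sum_congr rfl fun _ _ => sum_congr rfl fun _ _ => by ring

theorem formNorm_stdForm : formNorm stdForm 1 = fun a b => if a = b then 6 else 0 := by
  funext a b
  have h := congrArg (Int.cast : ℤ → ℝ) (sum_stdZ_mul_stdZ a b)
  push_cast at h
  simpa [formNorm, Matrix.one_apply, stdForm, ite_and] using h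

/-- Its derivative with stationary metric is the linear constraint that `∇φ` has to satisfy. -/
theorem IsPositive.formNorm_eq {φ : Tensor3} (h : IsPositive φ) :
    formNorm φ (metricInv φ) = fun a b => 6 * metric φ a b := by
  obtain ⟨A, hA, rfl⟩ := (isPositive_iff φ).1 h
  rw [metricInv_pull3 hA, formNorm_pull3 hA, metricInv_stdForm, formNorm_stdForm,
    metric_pull3_stdForm hA]
  funext a b
  simp [pull2, pull1, Matrix.mul_apply, mul_sum]
  exact sum_congr rfl fun _ _ => by ring

/-! ### The deformed form -/

/-- The components of `elementaryForm i j k`. -/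
def elementaryZ (i j k a b c : Fin 7) : ℤ :=
  let δ : Fin 7 → Fin 7 → ℤ := fun m n => if m = n then 1 else 0
  δ a i * δ b j * δ c k - δ a i * δ c j * δ b k - δ b i * δ a j * δ c k + δ b i * δ c j * δ a k
    + δ c i * δ a j * δ b k - δ c i * δ b j * δ a k

theorem elementaryForm_single (i j k a b c : Fin 7) :
    elementaryForm i j k (Pi.single a 1) (Pi.single b 1) (Pi.single c 1)
      = elementaryZ i j k a b c := by
  rw [elementaryForm_eq, elementaryZ]
  push_cast
  simp only [Pi.single_apply, eq_comm]

/-- With `Ω = (e₁ + i e₂) ∧ (e₃ + i e₄) ∧ (e₅ + i e₆)`, the standard form is `e₀ ∧ ω + Re Ω`, and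
the right side here is `Im Ω`. Deforming along `t e₀` therefore replaces `Re Ω` by `Re ((1 - i t)
Ω)`. -/
theorem stdDualZ_zero : ∀ a b c, stdDualZ a b c 0 = elementaryZ 1 3 6 a b c
    + elementaryZ 1 4 5 a b c + elementaryZ 2 3 5 a b c - elementaryZ 2 4 6 a b c := by
  decide +kernel

/-- The cube roots of `1 - t i`. -/
theorem exists_cubeRoot (t : ℝ) : ∃ p q : ℝ, p ^ 3 - 3 * p * q ^ 2 = 1 ∧
    3 * p ^ 2 * q - q ^ 3 = -t ∧ p ^ 2 + q ^ 2 = (1 + t ^ 2) ^ (1 / 3 : ℝ) := by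
  obtain ⟨z, hz⟩ := IsAlgClosed.exists_pow_nat_eq (⟨1, -t⟩ : ℂ) (n := 3) (by norm_num)
  have h1 : z.re ^ 3 - 3 * z.re * z.im ^ 2 = 1 := by
    have := congrArg Complex.re hz
    simp [pow_succ] at this
    linarith
  have h2 : 3 * z.re ^ 2 * z.im - z.im ^ 3 = -t := by
    have := congrArg Complex.im hz
    simp [pow_succ] at this
    linarith
  refine ⟨z.re, z.im, h1, h2, ?_⟩
  -- The squared modulus of `1 - i t` is the cube of that of its cube root.
  have h3 : 1 + t ^ 2 = (z.re ^ 2 + z.im ^ 2) ^ 3 := by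
    have : t ^ 2 = (3 * z.re ^ 2 * z.im - z.im ^ 3) ^ 2 := by rw [h2]; ring
    rw [this, show (1 : ℝ) = (z.re ^ 3 - 3 * z.re * z.im ^ 2) ^ 2 by rw [h1]; ring]
    ring
  rw [h3, ← Real.rpow_natCast _ 3, ← Real.rpow_mul (by positivity)]
  norm_num

theorem cube_rpow_third {x : ℝ} (hx : 0 ≤ x) : (x ^ (1 / 3 : ℝ)) ^ 3 = x := by
  rw [← Real.rpow_natCast, ← Real.rpow_mul hx]; norm_num

/-- Multiplication of the three complex coordinates by `p + i q`. When this is a cube root of `1 - i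
t`, it multiplies `Ω` by `1 - i t` and `ω` by `p² + q² = k`; the factor `k⁻¹` on `e₀` restores `e₀ ∧
ω`. -/
def deformMatrix (k p q : ℝ) : Matrix (Fin 7) (Fin 7) ℝ :=
  !![k⁻¹, 0, 0, 0, 0, 0, 0; 0, p, -q, 0, 0, 0, 0; 0, q, p, 0, 0, 0, 0; 0, 0, 0, p, -q, 0, 0;
    0, 0, 0, q, p, 0, 0; 0, 0, 0, 0, 0, p, -q; 0, 0, 0, 0, 0, q, p]

theorem deformMatrix_mulVec (k p q : ℝ) (x : Fin 7 → ℝ) :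
    deformMatrix k p q *ᵥ x = ![k⁻¹ * x 0, p * x 1 - q * x 2, q * x 1 + p * x 2,
      p * x 3 - q * x 4, q * x 3 + p * x 4, p * x 5 - q * x 6, q * x 5 + p * x 6] := by
  funext i
  fin_cases i <;> simp [deformMatrix, mulVec, dotProduct, Fin.sum_univ_seven, sub_eq_add_neg]

theorem deform_stdForm (t : ℝ) (a b c : Fin 7) :
    deform stdForm (t • Pi.single 0 1) a b c = stdForm a b c + t * stdDual a b c 0 := by
  simp [deform, psi_stdForm, Pi.single_apply]

theorem deform_stdForm_eq_pull3 {t k p q : ℝ} (hk : k ≠ 0) (h1 : p ^ 3 - 3 * p * q ^ 2 = 1)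
    (h2 : 3 * p ^ 2 * q - q ^ 3 = -t) (h3 : p ^ 2 + q ^ 2 = k) :
    deform stdForm (t • Pi.single 0 1) = pull3 (deformMatrix k p q) stdForm := by
  have hk1 : k⁻¹ * (p ^ 2 + q ^ 2) = 1 := by rw [h3]; exact inv_mul_cancel₀ hk
  have key : ∀ x y z : Fin 7 → ℝ, standardForm (deformMatrix k p q *ᵥ x)
      (deformMatrix k p q *ᵥ y) (deformMatrix k p q *ᵥ z) = standardForm x y z
      + t * (elementaryForm 1 3 6 x y z + elementaryForm 1 4 5 x y z + elementaryForm 2 3 5 x y z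
        - elementaryForm 2 4 6 x y z) := by
    intro x y z
    simp only [deformMatrix_mulVec, standardForm, elementaryForm_eq, Matrix.cons_val]
    linear_combination (norm := skip) hk1 * (elementaryForm 0 1 2 x y z + elementaryForm 0 3 4 x y z
      + elementaryForm 0 5 6 x y z) + h1 * (elementaryForm 1 3 5 x y z - elementaryForm 1 4 6 x y z
      - elementaryForm 2 3 6 x y z - elementaryForm 2 4 5 x y z) - h2 * (elementaryForm 1 3 6 x y z
      + elementaryForm 1 4 5 x y z + elementaryForm 2 3 5 x y z - elementaryForm 2 4 6 x y z)
    simp only [elementaryForm_eq]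
    ring
  funext a b c
  have h := key (Pi.single a 1) (Pi.single b 1) (Pi.single c 1)
  have h0 := pull3_stdForm 1 a b c
  rw [pull3_one] at h0
  have h4 : ∀ d : Fin 7, (fun i => (1 : Matrix (Fin 7) (Fin 7) ℝ) i d) = Pi.single d 1 := by
    intro d; funext i; simp [Matrix.one_apply, Pi.single_apply]
  simp only [h4] at h0
  have h5 := congrArg (Int.cast : ℤ → ℝ) (stdDualZ_zero a b c)
  push_cast at h5
  rw [deform_stdForm, pull3_stdForm, h0, stdDual, h5]
  simp only [mulVec_single_one, elementaryForm_single] at h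
  exact h.symm

theorem deformMatrix_transpose_mul (k p q : ℝ) (h : p ^ 2 + q ^ 2 = k) :
    (deformMatrix k p q)ᵀ * deformMatrix k p q
      = Matrix.diagonal ![(k ^ 2)⁻¹, k, k, k, k, k, k] := by
  ext i j
  fin_cases i <;> fin_cases j <;>
    simp [deformMatrix, Matrix.mul_apply, Fin.sum_univ_seven, Matrix.diagonal] <;>
    first | ring1 | linear_combination h

theorem deformMatrix_det_ne_zero {k p q : ℝ} (hk : k ≠ 0) (h : p ^ 2 + q ^ 2 = k) :
    (deformMatrix k p q).det ≠ 0 := by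
  intro h0
  have := congrArg det (deformMatrix_transpose_mul k p q h)
  rw [det_mul, h0, mul_zero, det_diagonal, Fin.prod_univ_seven] at this
  simp [hk] at this

/-- The normal form at a point. An identity between natural constructions of `φ` and `v` need only
be checked for the standard form and `t e₀`. -/
theorem IsPositive.exists_gauge {φ : Tensor3} (h : IsPositive φ) (v : Tensor1) :
    ∃ (A : Matrix (Fin 7) (Fin 7) ℝ) (t : ℝ), A.det ≠ 0 ∧ φ = pull3 A stdForm ∧
      A *ᵥ v = t • Pi.single 0 1 := by
  obtain ⟨A, hA, rfl⟩ := (isPositive_iff φ).1 h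
  obtain ⟨P, t, hP, hw⟩ := exists_isStdIsometry_mulVec (A *ᵥ v)
  refine ⟨P * A, t, ?_, ?_, ?_⟩
  · rw [det_mul]; exact mul_ne_zero hP.det_ne_zero hA
  · rw [← pull3_pull3, hP.pull3]
  · rw [← mulVec_mulVec, hw]

theorem normSq_stdForm (t : ℝ) : normSq stdForm (t • Pi.single 0 1) = t ^ 2 := by
  simp [normSq, metric_stdForm, Matrix.one_apply, Pi.single_apply, sq]

theorem IsPositive.pull3 {φ : Tensor3} (h : IsPositive φ) {P : Matrix (Fin 7) (Fin 7) ℝ}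
    (hP : P.det ≠ 0) : IsPositive (pull3 P φ) := by
  obtain ⟨A, hA, rfl⟩ := (isPositive_iff φ).1 h
  exact (isPositive_iff _).2 ⟨A * P, by rw [det_mul]; exact mul_ne_zero hA hP, pull3_pull3 _ _ _⟩

theorem isPositive_stdForm : IsPositive stdForm :=
  (isPositive_iff _).2 ⟨1, by simp, (pull3_one _).symm⟩

theorem kappa_stdForm (t : ℝ) :
    kappa stdForm (t • Pi.single 0 1) = (1 + t ^ 2) ^ (1 / 3 : ℝ) := by
  rw [kappa, normSq_stdForm]

theorem metric_deform_stdForm {t k : ℝ} (hk : k = (1 + t ^ 2) ^ (1 / 3 : ℝ)) :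
    IsPositive (deform stdForm (t • Pi.single 0 1)) ∧
    metric (deform stdForm (t • Pi.single 0 1))
      = Matrix.diagonal ![(k ^ 2)⁻¹, k, k, k, k, k, k] := by
  obtain ⟨p, q, h1, h2, h3⟩ := exists_cubeRoot t
  rw [← hk] at h3
  have hk0 : k ≠ 0 := by rw [hk]; positivity
  rw [deform_stdForm_eq_pull3 hk0 h1 h2 h3]
  have hd := deformMatrix_det_ne_zero hk0 h3
  exact ⟨isPositive_stdForm.pull3 hd,
    by rw [metric_pull3_stdForm hd, deformMatrix_transpose_mul k p q h3]⟩

theorem IsPositive.deform {φ : Tensor3} (h : IsPositive φ) (v : Tensor1) :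
    IsPositive (deform φ v) := by
  obtain ⟨A, t, hA, rfl, hv⟩ := h.exists_gauge v
  rw [deform_pull3 hA, hv]
  exact (metric_deform_stdForm rfl).1.pull3 hA

theorem kappa_pow_three {φ : Tensor3} (h : IsPositive φ) (v : Tensor1) :
    0 < kappa φ v ∧ kappa φ v ^ 3 = 1 + normSq φ v := by
  obtain ⟨A, t, hA, rfl, hv⟩ := h.exists_gauge v
  rw [kappa_pull3 hA, normSq_pull3 hA, hv, kappa_stdForm, normSq_stdForm]
  exact ⟨by positivity, cube_rpow_third (by positivity)⟩

/-- In the normal form this reads `diag (k⁻², k, …, k)`, since `1 + t² = k³`. The invariant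
expression is needed because the normal form holds at one point only, whereas the metric has to be
differentiated. -/
theorem IsPositive.metric_deform {φ : Tensor3} (h : IsPositive φ) (v : Tensor1) (a b : Fin 7) :
    metric (G2Deformation.deform φ v) a b
      = (kappa φ v ^ 2)⁻¹ * ((1 + normSq φ v) * metric φ a b - flat φ v a * flat φ v b) := by
  obtain ⟨A, t, hA, rfl, hv⟩ := h.exists_gauge v
  rw [deform_pull3 hA, hv, metric_pull3_apply hA, metric_pull3_apply hA, flat_pull3 hA,
    kappa_pull3 hA, normSq_pull3 hA, hv]
  obtain ⟨hk, hk3⟩ := kappa_pow_three isPositive_stdForm (t • Pi.single 0 1)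
  rw [(metric_deform_stdForm (kappa_stdForm t)).2]
  have key : ∀ i j : Fin 7, Matrix.diagonal ![(kappa stdForm (t • Pi.single 0 1) ^ 2)⁻¹,
      kappa stdForm (t • Pi.single 0 1), kappa stdForm (t • Pi.single 0 1),
      kappa stdForm (t • Pi.single 0 1), kappa stdForm (t • Pi.single 0 1),
      kappa stdForm (t • Pi.single 0 1), kappa stdForm (t • Pi.single 0 1)] i j
      = (kappa stdForm (t • Pi.single 0 1) ^ 2)⁻¹ * ((1 + normSq stdForm (t • Pi.single 0 1)) *
        metric stdForm i j - flat stdForm (t • Pi.single 0 1) i * flat stdForm (t • Pi.single 0 1) j) := by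
    intro i j
    rw [← hk3]
    have ht : t ^ 2 = kappa stdForm (t • Pi.single 0 1) ^ 3 - 1 := by
      rw [hk3, normSq_stdForm]; ring
    generalize kappa stdForm (t • Pi.single 0 1) = k at *
    have hk0 := hk.ne'
    simp only [flat_eq, metric_stdForm, one_mulVec]
    by_cases hij : i = j
    · subst hij
      rw [Matrix.diagonal_apply_eq, Matrix.one_apply_eq]
      by_cases hi : i = 0
      · subst hi
        simp
        linear_combination (k ^ 2)⁻¹ * ht
      · have : ![(k ^ 2)⁻¹, k, k, k, k, k, k] i = k := by
          fin_cases i <;> simp at hi ⊢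
        rw [this]
        simp [hi]
        field_simp
    · rw [Matrix.diagonal_apply_ne _ hij, Matrix.one_apply_ne hij]
      have : i ≠ 0 ∨ j ≠ 0 := by
        by_contra hc
        push Not at hc
        exact hij (hc.1.trans hc.2.symm)
      rcases this with h' | h' <;> simp [Pi.single_apply, h']
  simp only [key]
  generalize (kappa stdForm (t • Pi.single 0 1) ^ 2)⁻¹ = r
  generalize 1 + normSq stdForm (t • Pi.single 0 1) = s
  generalize flat stdForm (t • Pi.single 0 1) = x
  rw [pull1_mul]
  simp only [pull2, pull1, mul_sum, ← sum_sub_distrib]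
  exact sum_congr rfl fun _ _ => sum_congr rfl fun _ _ => by ring

/-! ### Smoothness of the metric and of the dual -/

theorem contDiffAt_ninthRoot {x : ℝ} (hx : x ≠ 0) : ContDiffAt ℝ ∞ ninthRoot x := by
  rcases lt_or_gt_of_ne hx with h | h
  · have h1 : ContDiffAt ℝ ∞ (fun y : ℝ => -(-y) ^ (1 / 9 : ℝ)) x :=
      ((contDiffAt_id.neg).rpow_const_of_ne (by simpa using hx)).neg
    refine h1.congr_of_eventuallyEq ?_
    filter_upwards [Iio_mem_nhds h] with y hy
    rw [ninthRoot, Real.sign_of_neg hy, abs_of_neg hy]; ring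
  · have h1 : ContDiffAt ℝ ∞ (fun y : ℝ => y ^ (1 / 9 : ℝ)) x :=
      contDiffAt_id.rpow_const_of_ne hx
    refine h1.congr_of_eventuallyEq ?_
    filter_upwards [Ioi_mem_nhds h] with y hy
    rw [ninthRoot, Real.sign_of_pos hy, abs_of_pos hy]; ring

section Smoothness

variable {E : Type*} [NormedAddCommGroup E] [NormedSpace ℝ E] {φ : E → Tensor3} {x : E}

theorem contDiffAt_sMatrix (h : ∀ a b c, ContDiffAt ℝ ∞ (fun y => φ y a b c) x) (a b : Fin 7) :
    ContDiffAt ℝ ∞ (fun y => sMatrix (φ y) a b) x := by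
  unfold sMatrix
  exact contDiffAt_const.mul (ContDiffAt.sum fun σ _ => contDiffAt_const.mul
    (((h _ _ _).mul (h _ _ _)).mul (h _ _ _)))

theorem contDiffAt_det {n : ℕ} {G : E → Matrix (Fin n) (Fin n) ℝ}
    (h : ∀ a b, ContDiffAt ℝ ∞ (fun y => G y a b) x) : ContDiffAt ℝ ∞ (fun y => (G y).det) x := by
  simp only [det_apply']
  exact ContDiffAt.sum fun σ _ => contDiffAt_const.mul (contDiffAt_prod fun i _ => h _ _)

/-- The determinant is `A.det ^ 9`, so positive forms stay away from the singularity of the ninth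
root at zero. -/
theorem IsPositive.det_sMatrix_ne_zero {φ : Tensor3} (h : IsPositive φ) :
    (sMatrix φ).det ≠ 0 := by
  obtain ⟨A, hA, rfl⟩ := (isPositive_iff φ).1 h
  rw [sMatrix_pull3, sMatrix_stdForm, det_smul, det_mul, det_mul, det_one, det_transpose]
  simp [hA]

theorem contDiffAt_ninthRoot_det_inv (h : ∀ a b c, ContDiffAt ℝ ∞ (fun y => φ y a b c) x)
    (hp : IsPositive (φ x)) : ContDiffAt ℝ ∞ (fun y => (ninthRoot (sMatrix (φ y)).det)⁻¹) x :=
  ContDiffAt.inv (ContDiffAt.comp (g := ninthRoot) (f := fun y => (sMatrix (φ y)).det) x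
    (contDiffAt_ninthRoot hp.det_sMatrix_ne_zero) (contDiffAt_det (contDiffAt_sMatrix h)))
    (ninthRoot_ne_zero hp.det_sMatrix_ne_zero)

theorem contDiffAt_metric (h : ∀ a b c, ContDiffAt ℝ ∞ (fun y => φ y a b c) x)
    (hp : IsPositive (φ x)) (a b : Fin 7) :
    ContDiffAt ℝ ∞ (fun y => metric (φ y) a b) x :=
  (contDiffAt_ninthRoot_det_inv h hp).mul (contDiffAt_sMatrix h a b)

theorem contDiffAt_psi (h : ∀ a b c, ContDiffAt ℝ ∞ (fun y => φ y a b c) x)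
    (hp : IsPositive (φ x)) (a b c d : Fin 7) :
    ContDiffAt ℝ ∞ (fun y => psi (φ y) a b c d) x := by
  have hm := contDiffAt_metric h hp
  unfold psi
  exact (contDiffAt_const.mul (contDiffAt_ninthRoot_det_inv h hp)).mul
    (ContDiffAt.sum fun σ _ => contDiffAt_const.mul
      (((((hm _ _).mul (hm _ _)).mul (hm _ _)).mul (hm _ _)).mul (h _ _ _)))

theorem contDiffAt_deform {v : E → Tensor1} (h : ∀ a b c, ContDiffAt ℝ ∞ (fun y => φ y a b c) x)
    (hv : ∀ a, ContDiffAt ℝ ∞ (fun y => v y a) x) (hp : IsPositive (φ x)) (a b c : Fin 7) :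
    ContDiffAt ℝ ∞ (fun y => deform (φ y) (v y) a b c) x := by
  unfold deform
  exact (h a b c).add (ContDiffAt.sum fun e _ => (hv e).mul (contDiffAt_psi h hp a b c e))

theorem contDiffAt_flat {v : E → Tensor1} (h : ∀ a b c, ContDiffAt ℝ ∞ (fun y => φ y a b c) x)
    (hv : ∀ a, ContDiffAt ℝ ∞ (fun y => v y a) x) (hp : IsPositive (φ x)) (a : Fin 7) :
    ContDiffAt ℝ ∞ (fun y => flat (φ y) (v y) a) x := by
  unfold flat
  exact ContDiffAt.sum fun e _ => (contDiffAt_metric h hp a e).mul (hv e)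

end Smoothness

/-! ### Symmetries of a positive form and of its metric. -/

theorem IsPositive.metric_isSymm {φ : Tensor3} (h : IsPositive φ) (a b : Fin 7) :
    metric φ a b = metric φ b a := by
  obtain ⟨A, hA, rfl⟩ := (isPositive_iff φ).1 h
  rw [metric_pull3_stdForm hA]
  simp only [Matrix.mul_apply, transpose_apply]
  exact sum_congr rfl fun _ _ => mul_comm _ _

theorem IsPositive.det_metric_ne_zero {φ : Tensor3} (h : IsPositive φ) : (metric φ).det ≠ 0 := by
  obtain ⟨A, hA, rfl⟩ := (isPositive_iff φ).1 h
  rw [metric_pull3_stdForm hA, det_mul, det_transpose]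
  exact mul_ne_zero hA hA

theorem IsPositive.metric_mul_metricInv {φ : Tensor3} (h : IsPositive φ) :
    metric φ * metricInv φ = 1 := Matrix.mul_nonsing_inv _ h.det_metric_ne_zero.isUnit

theorem IsPositive.metricInv_mul_metric {φ : Tensor3} (h : IsPositive φ) :
    metricInv φ * metric φ = 1 := Matrix.nonsing_inv_mul _ h.det_metric_ne_zero.isUnit

theorem pull3_swap_left {P : Matrix (Fin 7) (Fin 7) ℝ} {φ : Tensor3}
    (h : ∀ a b c, φ a b c = - φ b a c) (a b c : Fin 7) : pull3 P φ a b c = - pull3 P φ b a c := by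
  simp only [pull3, pull2, mul_sum]
  rw [sum_comm, ← sum_neg_distrib]
  refine sum_congr rfl fun i _ => ?_
  rw [← sum_neg_distrib]
  refine sum_congr rfl fun j _ => ?_
  have : pull1 P (φ j i) c = - pull1 P (φ i j) c := by
    simp only [pull1, h j i, mul_neg, sum_neg_distrib]
  rw [this]
  ring

theorem pull3_swap_right {P : Matrix (Fin 7) (Fin 7) ℝ} {φ : Tensor3}
    (h : ∀ a b c, φ a b c = - φ a c b) (a b c : Fin 7) : pull3 P φ a b c = - pull3 P φ a c b := by
  simp only [pull3, pull2, pull1, ← sum_neg_distrib]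
  refine sum_congr rfl fun i _ => ?_
  simp only [mul_sum, ← sum_neg_distrib]
  rw [sum_comm]
  exact sum_congr rfl fun _ _ => sum_congr rfl fun _ _ => by rw [h]; ring

theorem stdZ_swap_left : ∀ a b c, stdZ a b c = - stdZ b a c := by decide +kernel

theorem stdZ_swap_right : ∀ a b c, stdZ a b c = - stdZ a c b := by decide +kernel

theorem IsPositive.swap_left {φ : Tensor3} (h : IsPositive φ) (a b c : Fin 7) :
    φ a b c = - φ b a c := by
  obtain ⟨A, hA, rfl⟩ := (isPositive_iff φ).1 h
  refine pull3_swap_left (fun a b c => ?_) a b c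
  rw [stdForm, stdForm, stdZ_swap_left]; push_cast; ring

theorem IsPositive.swap_right {φ : Tensor3} (h : IsPositive φ) (a b c : Fin 7) :
    φ a b c = - φ a c b := by
  obtain ⟨A, hA, rfl⟩ := (isPositive_iff φ).1 h
  refine pull3_swap_right (fun a b c => ?_) a b c
  rw [stdForm, stdForm, stdZ_swap_right]; push_cast; ring

/-! ### Derivatives of 3-forms with constant metric -/

/-- If the entries of a curve of matrices have derivative zero at a point where the matrix is the
identity, then so do the entries of the inverse. -/
theorem hasDerivAt_inv_entry {n : ℕ} {G : ℝ → Matrix (Fin n) (Fin n) ℝ}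
    (h : ∀ a b, HasDerivAt (fun u => G u a b) 0 0) (h0 : G 0 = 1) (a b : Fin n) :
    HasDerivAt (fun u => (G u)⁻¹ a b) 0 0 := by
  have hdet : ∀ {m : ℕ} (K : ℝ → Matrix (Fin m) (Fin m) ℝ),
      (∀ a b, DifferentiableAt ℝ (fun u => K u a b) 0) →
      DifferentiableAt ℝ (fun u => (K u).det) 0 := by
    intro m K hK
    simp only [det_apply']
    exact DifferentiableAt.fun_sum fun σ _ => (DifferentiableAt.fun_finsetProd
      fun i _ => hK _ _).const_mul _
  -- By Cramer's rule the entries of the inverse are quotients of determinants.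
  have hd : ∀ a b, DifferentiableAt ℝ (fun u => (G u)⁻¹ a b) 0 := by
    intro a b
    have e : ∀ u, (G u)⁻¹ a b = (G u).det⁻¹ * ((G u).updateRow b (Pi.single a 1)).det := by
      intro u
      rw [Matrix.inv_def, Matrix.smul_apply, smul_eq_mul, Ring.inverse_eq_inv', adjugate_apply]
    simp only [e]
    refine DifferentiableAt.mul (DifferentiableAt.inv (hdet G fun a b => (h a b).differentiableAt)
      (by rw [h0]; simp)) (hdet _ fun i j => ?_)
    simp only [updateRow_apply]
    split_ifs
    · exact differentiableAt_const _
    · exact (h i j).differentiableAt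
  have hne : ∀ᶠ u in 𝓝 (0 : ℝ), (G u).det ≠ 0 :=
    (hdet G fun a b => (h a b).differentiableAt).continuousAt.eventually_ne (by rw [h0]; simp)
  -- The product rule for `G G⁻¹ = 1`, in which the terms containing the derivative of `G` vanish.
  have h1 : HasDerivAt (fun u => ∑ c, G u a c * (G u)⁻¹ c b)
      (∑ c, (0 * (G 0)⁻¹ c b + G 0 a c * deriv (fun u => (G u)⁻¹ c b) 0)) 0 :=
    HasDerivAt.fun_sum fun c _ => (h a c).mul (hd c b).hasDerivAt
  have h2 : HasDerivAt (fun u => ∑ c, G u a c * (G u)⁻¹ c b) 0 0 := by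
    refine (hasDerivAt_const (0 : ℝ) ((1 : Matrix (Fin n) (Fin n) ℝ) a b)).congr_of_eventuallyEq ?_
    filter_upwards [hne] with u hu
    rw [← Matrix.mul_apply, Matrix.mul_nonsing_inv _ hu.isUnit]
  have h3 := h1.unique h2
  simp only [h0, zero_mul, zero_add, Matrix.one_apply, ite_mul, one_mul, Finset.sum_ite_eq,
    mem_univ, if_true] at h3
  have h4 := (hd a b).hasDerivAt
  rwa [h3] at h4

/-- Reduces the comparison of two alternating forms to the 35 increasing triples. -/
theorem alternating_ext {χ η : Tensor3} (h1 : ∀ a b c, χ a b c = - χ b a c)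
    (h2 : ∀ a b c, χ a b c = - χ a c b) (h3 : ∀ a b c, η a b c = - η b a c)
    (h4 : ∀ a b c, η a b c = - η a c b)
    (h : ∀ a b c, a < b → b < c → χ a b c = η a b c) : χ = η := by
  have hs1 : ∀ a b c, χ b a c = η b a c → χ a b c = η a b c := fun a b c e => by
    rw [h1, h3, e]
  have hs2 : ∀ a b c, χ a c b = η a c b → χ a b c = η a b c := fun a b c e => by
    rw [h2, h4, e]
  have hz1 : ∀ a c, χ a a c = η a a c := fun a c => by
    linarith [h1 a a c, h3 a a c]
  have hz2 : ∀ a c, χ a c c = η a c c := fun a c => by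
    linarith [h2 a c c, h4 a c c]
  funext a b c
  rcases lt_trichotomy a b with hab | hab | hab
  · rcases lt_trichotomy b c with hbc | hbc | hbc
    · exact h a b c hab hbc
    · rw [hbc]; exact hz2 a c
    · rcases lt_trichotomy a c with hac | hac | hac
      · exact hs2 _ _ _ (h _ _ _ hac hbc)
      · rw [← hac]; exact hs2 _ _ _ (hz1 _ _)
      · exact hs2 _ _ _ (hs1 _ _ _ (h _ _ _ hac hab))
  · rw [hab]; exact hz1 b c
  · refine hs1 _ _ _ ?_
    rcases lt_trichotomy a c with hbc | hbc | hbc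
    · exact h b a c hab hbc
    · rw [hbc]; exact hz2 b c
    · rcases lt_trichotomy b c with hac | hac | hac
      · exact hs2 _ _ _ (h _ _ _ hac hbc)
      · rw [← hac]; exact hs2 _ _ _ (hz1 _ _)
      · exact hs2 _ _ _ (hs1 _ _ _ (h _ _ _ hac hab))

theorem stdDualZ_swap_left : ∀ e a b c, stdDualZ e a b c = - stdDualZ e b a c := by decide +kernel

theorem stdDualZ_swap_right : ∀ e a b c, stdDualZ e a b c = - stdDualZ e a c b := by decide +kernel

/-- Makes the stationarity equations explicit: each row of the standard form pairs with a skew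
tensor in three terms. -/
theorem sum_stdForm_row {F : Fin 7 → Fin 7 → ℝ} (h : ∀ m n, F m n = - F n m) :
    ∑ m, ∑ n, F m n * stdForm 0 m n = 2 * (F 1 2 + F 3 4 + F 5 6) ∧
    ∑ m, ∑ n, F m n * stdForm 1 m n = 2 * (F 2 0 + F 3 5 - F 4 6) ∧
    ∑ m, ∑ n, F m n * stdForm 2 m n = 2 * (F 0 1 - F 3 6 - F 4 5) ∧
    ∑ m, ∑ n, F m n * stdForm 3 m n = 2 * (F 4 0 + F 5 1 + F 2 6) ∧
    ∑ m, ∑ n, F m n * stdForm 4 m n = 2 * (F 0 3 + F 1 6 + F 2 5) ∧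
    ∑ m, ∑ n, F m n * stdForm 5 m n = 2 * (F 6 0 + F 1 3 - F 2 4) ∧
    ∑ m, ∑ n, F m n * stdForm 6 m n = 2 * (F 0 5 - F 1 4 - F 2 3) := by
  have key : ∀ b, ∑ m, ∑ n, F m n * stdForm b m n
      = (stdTerms.map fun t => (t.2.2.2 : ℝ) * if t.1 = b then F t.2.1 t.2.2.1 else 0).sum := by
    intro b
    rw [← sum_stdForm fun a m n => if a = b then F m n else 0]
    simp [mul_comm]
  refine ⟨?_, ?_, ?_, ?_, ?_, ?_, ?_⟩ <;> rw [key] <;> simp [stdTerms]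
  · linarith [h 1 2, h 3 4, h 5 6]
  · linarith [h 2 0, h 3 5, h 4 6]
  · linarith [h 0 1, h 3 6, h 4 5]
  · linarith [h 4 0, h 5 1, h 2 6]
  · linarith [h 0 3, h 1 6, h 2 5]
  · linarith [h 6 0, h 1 3, h 2 4]
  · linarith [h 0 5, h 1 4, h 2 3]

theorem sum_mul_stdDual {b c d i : Fin 7} {s : ℤ} (h : ∀ e, stdDualZ e b c d = if e = i then s else 0)
    (x : Fin 7 → ℝ) : ∑ e, x e * stdDual e b c d = s * x i := by
  simp [stdDual, h, mul_comm]

/-- The values of the contraction of the dual form with a vector. -/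
theorem sum_mul_stdDual_triples (x : Fin 7 → ℝ) :
    ∑ e, x e * stdDual e 0 1 2 = 0 ∧ ∑ e, x e * stdDual e 0 1 3 = x 6 ∧
    ∑ e, x e * stdDual e 0 1 4 = x 5 ∧ ∑ e, x e * stdDual e 0 1 5 = -x 4 ∧
    ∑ e, x e * stdDual e 0 1 6 = -x 3 ∧ ∑ e, x e * stdDual e 0 2 3 = x 5 ∧
    ∑ e, x e * stdDual e 0 2 4 = -x 6 ∧ ∑ e, x e * stdDual e 0 2 5 = -x 3 ∧
    ∑ e, x e * stdDual e 0 2 6 = x 4 ∧ ∑ e, x e * stdDual e 0 3 4 = 0 ∧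
    ∑ e, x e * stdDual e 0 3 5 = x 2 ∧ ∑ e, x e * stdDual e 0 3 6 = x 1 ∧
    ∑ e, x e * stdDual e 0 4 5 = x 1 ∧ ∑ e, x e * stdDual e 0 4 6 = -x 2 ∧
    ∑ e, x e * stdDual e 0 5 6 = 0 ∧ ∑ e, x e * stdDual e 1 2 3 = -x 4 ∧
    ∑ e, x e * stdDual e 1 2 4 = x 3 ∧ ∑ e, x e * stdDual e 1 2 5 = -x 6 ∧
    ∑ e, x e * stdDual e 1 2 6 = x 5 ∧ ∑ e, x e * stdDual e 1 3 4 = -x 2 ∧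
    ∑ e, x e * stdDual e 1 3 5 = 0 ∧ ∑ e, x e * stdDual e 1 3 6 = -x 0 ∧
    ∑ e, x e * stdDual e 1 4 5 = -x 0 ∧ ∑ e, x e * stdDual e 1 4 6 = 0 ∧
    ∑ e, x e * stdDual e 1 5 6 = -x 2 ∧ ∑ e, x e * stdDual e 2 3 4 = x 1 ∧
    ∑ e, x e * stdDual e 2 3 5 = -x 0 ∧ ∑ e, x e * stdDual e 2 3 6 = 0 ∧
    ∑ e, x e * stdDual e 2 4 5 = 0 ∧ ∑ e, x e * stdDual e 2 4 6 = x 0 ∧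
    ∑ e, x e * stdDual e 2 5 6 = x 1 ∧ ∑ e, x e * stdDual e 3 4 5 = -x 6 ∧
    ∑ e, x e * stdDual e 3 4 6 = x 5 ∧ ∑ e, x e * stdDual e 3 5 6 = -x 4 ∧
    ∑ e, x e * stdDual e 4 5 6 = x 3 := by
  refine ⟨?_, ?_, ?_, ?_, ?_, ?_, ?_, ?_, ?_, ?_, ?_, ?_, ?_, ?_, ?_, ?_, ?_, ?_, ?_, ?_, ?_, ?_, ?_, ?_,
    ?_, ?_, ?_, ?_, ?_, ?_, ?_, ?_, ?_, ?_, ?_⟩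
  all_goals first
    | exact (sum_mul_stdDual (i := 0) (s := 0) (by decide +kernel) x).trans (by simp)
    | exact (sum_mul_stdDual (i := 0) (s := 1) (by decide +kernel) x).trans (by simp)
    | exact (sum_mul_stdDual (i := 0) (s := -1) (by decide +kernel) x).trans (by simp)
    | exact (sum_mul_stdDual (i := 1) (s := 1) (by decide +kernel) x).trans (by simp)
    | exact (sum_mul_stdDual (i := 1) (s := -1) (by decide +kernel) x).trans (by simp)
    | exact (sum_mul_stdDual (i := 2) (s := 1) (by decide +kernel) x).trans (by simp)
    | exact (sum_mul_stdDual (i := 2) (s := -1) (by decide +kernel) x).trans (by simp)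
    | exact (sum_mul_stdDual (i := 3) (s := 1) (by decide +kernel) x).trans (by simp)
    | exact (sum_mul_stdDual (i := 3) (s := -1) (by decide +kernel) x).trans (by simp)
    | exact (sum_mul_stdDual (i := 4) (s := 1) (by decide +kernel) x).trans (by simp)
    | exact (sum_mul_stdDual (i := 4) (s := -1) (by decide +kernel) x).trans (by simp)
    | exact (sum_mul_stdDual (i := 5) (s := 1) (by decide +kernel) x).trans (by simp)
    | exact (sum_mul_stdDual (i := 5) (s := -1) (by decide +kernel) x).trans (by simp)
    | exact (sum_mul_stdDual (i := 6) (s := 1) (by decide +kernel) x).trans (by simp)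
    | exact (sum_mul_stdDual (i := 6) (s := -1) (by decide +kernel) x).trans (by simp)

set_option maxHeartbeats 2000000 in
/-- A 3-form along which the metric of the standard form is stationary is a multiple of the
dual form. -/
theorem exists_eq_sum_stdDual {χ : Tensor3} (h1 : ∀ a b c, χ a b c = - χ b a c)
    (h2 : ∀ a b c, χ a b c = - χ a c b)
    (h : ∀ a b, ∑ m, ∑ n, χ a m n * stdForm b m n + ∑ m, ∑ n, χ b m n * stdForm a m n = 0) :
    ∃ τ : Tensor1, ∀ b c d, χ b c d = ∑ e, τ e * stdDual e b c d := by
  have r := fun a => sum_stdForm_row (h2 a)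
  have l1 : ∀ a b c, b < a → χ a b c = - χ b a c := fun a b c _ => h1 a b c
  have l2 : ∀ a b c, c < b → χ a b c = - χ a c b := fun a b c _ => h2 a b c
  have z1 : ∀ a b, χ a a b = 0 := fun a b => by linarith [h1 a a b]
  have z2 : ∀ a b, χ a b b = 0 := fun a b => by linarith [h2 a b b]
  -- Each entry is read off at a triple where exactly one contraction of the dual form is nonzero,
  -- with the sign found in `sum_mul_stdDual_triples`.
  refine ⟨![-χ 1 3 6, χ 2 3 4, -χ 1 3 4, χ 1 2 4, -χ 1 2 3, χ 1 2 6, -χ 1 2 5], ?_⟩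
  have key : χ = fun b c d => ∑ e, ![-χ 1 3 6, χ 2 3 4, -χ 1 3 4, χ 1 2 4, -χ 1 2 3, χ 1 2 6,
      -χ 1 2 5] e * stdDual e b c d := by
    refine alternating_ext h1 h2 ?_ ?_ ?_
    · intro a b c
      rw [← sum_neg_distrib]
      refine sum_congr rfl fun e _ => ?_
      rw [stdDual, stdDual, stdDualZ_swap_left]; push_cast; ring
    · intro a b c
      rw [← sum_neg_distrib]
      refine sum_congr rfl fun e _ => ?_
      rw [stdDual, stdDual, stdDualZ_swap_right]; push_cast; ring
    -- These 28 symmetric equations restrict the 35 independent entries of `χ` to a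
    -- seven-dimensional space: of `Λ³ = 1 + 7 + 27` only the summand of dimension 7 survives.
    have e00 := h 0 0
    have e01 := h 0 1
    have e02 := h 0 2
    have e03 := h 0 3
    have e04 := h 0 4
    have e05 := h 0 5
    have e06 := h 0 6
    have e11 := h 1 1
    have e12 := h 1 2
    have e13 := h 1 3
    have e14 := h 1 4
    have e15 := h 1 5
    have e16 := h 1 6
    have e22 := h 2 2
    have e23 := h 2 3
    have e24 := h 2 4
    have e25 := h 2 5
    have e26 := h 2 6
    have e33 := h 3 3
    have e34 := h 3 4
    have e35 := h 3 5
    have e36 := h 3 6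
    have e44 := h 4 4
    have e45 := h 4 5
    have e46 := h 4 6
    have e55 := h 5 5
    have e56 := h 5 6
    have e66 := h 6 6
    simp only [(r _).1, (r _).2.1, (r _).2.2.1, (r _).2.2.2.1, (r _).2.2.2.2.1, (r _).2.2.2.2.2.1,
      (r _).2.2.2.2.2.2] at e00 e01 e02 e03 e04 e05 e06 e11 e12 e13 e14 e15 e16 e22
    simp [l1, l2, z1, z2] at e00 e01 e02 e03 e04 e05 e06 e11 e12 e13 e14 e15 e16 e22
    simp only [(r _).1, (r _).2.1, (r _).2.2.1, (r _).2.2.2.1, (r _).2.2.2.2.1, (r _).2.2.2.2.2.1,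
      (r _).2.2.2.2.2.2] at e23 e24 e25 e26 e33 e34 e35 e36 e44 e45 e46 e55 e56 e66
    simp [l1, l2, z1, z2] at e23 e24 e25 e26 e33 e34 e35 e36 e44 e45 e46 e55 e56 e66
    clear l1 l2 z1 z2 h1 h2 h r
    have d := sum_mul_stdDual_triples ![-χ 1 3 6, χ 2 3 4, -χ 1 3 4, χ 1 2 4, -χ 1 2 3, χ 1 2 6,
      -χ 1 2 5]
    simp only [Matrix.cons_val] at d
    casesm* _ ∧ _
    intro a b c hab hbc
    fin_cases a <;> fin_cases b <;> first | exact absurd hab (by decide) | skip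
    all_goals fin_cases c <;> first | exact absurd hbc (by decide) | skip
    all_goals
      simp only [Fin.reduceFinMk, Fin.zero_eta, Fin.mk_one]
      linarith
  intro b c d
  exact congrFun (congrFun (congrFun key b) c) d

theorem stdDualZ_mul_stdDualZ :
    ∀ e f, ∑ b, ∑ c, ∑ d, stdDualZ e b c d * stdDualZ f b c d = if e = f then 24 else 0 := by
  decide +kernel

theorem sum_stdDual_mul_stdDual (e f : Fin 7) :
    ∑ b, ∑ c, ∑ d, stdDual e b c d * stdDual f b c d = if e = f then 24 else 0 := by
  have h := congrArg (Int.cast : ℤ → ℝ) (stdDualZ_mul_stdDualZ e f)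
  push_cast at h
  exact h

/-- The contractions of the dual form with the basis vectors are orthogonal with square norm 24.
This recovers the coefficients, and explains the `1 / 24` in the torsion. -/
theorem eq_sum_stdDual {χ : Tensor3} (h1 : ∀ a b c, χ a b c = - χ b a c)
    (h2 : ∀ a b c, χ a b c = - χ a c b)
    (h : ∀ a b, ∑ m, ∑ n, χ a m n * stdForm b m n + ∑ m, ∑ n, χ b m n * stdForm a m n = 0)
    (b c d : Fin 7) :
    χ b c d = ∑ e, (1 / 24 * ∑ p, ∑ q, ∑ r, χ p q r * stdDual e p q r) * stdDual e b c d := by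
  obtain ⟨τ, hτ⟩ := exists_eq_sum_stdDual h1 h2 h
  rw [hτ]
  refine sum_congr rfl fun e _ => congrArg (· * stdDual e b c d) ?_
  have : ∑ p, ∑ q, ∑ r, χ p q r * stdDual e p q r
      = ∑ f, τ f * ∑ p, ∑ q, ∑ r, stdDual f p q r * stdDual e p q r := by
    simp only [hτ, sum_mul, mul_sum]
    have hc : ∀ p q, ∑ r, ∑ f, τ f * stdDual f p q r * stdDual e p q r
        = ∑ f, ∑ r, τ f * stdDual f p q r * stdDual e p q r := fun p q => sum_comm
    simp only [hc]
    have hc2 : ∀ p, ∑ q, ∑ f, ∑ r, τ f * stdDual f p q r * stdDual e p q r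
        = ∑ f, ∑ q, ∑ r, τ f * stdDual f p q r * stdDual e p q r := fun p => sum_comm
    simp only [hc2]
    rw [sum_comm]
    simp only [mul_assoc]
  rw [this]
  simp [sum_stdDual_mul_stdDual]
  ring

/-- A derivative of a curve of positive forms with stationary metric is a multiple of the dual form
(at the standard form). -/
theorem deriv_eq_sum_stdDual {φ : ℝ → Tensor3} {χ : Tensor3} (h0 : φ 0 = stdForm)
    (hpos : ∀ᶠ u in 𝓝 (0 : ℝ), IsPositive (φ u))
    (hd : ∀ a b c, HasDerivAt (fun u => φ u a b c) (χ a b c) 0)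
    (hg : ∀ a b, HasDerivAt (fun u => metric (φ u) a b) 0 0) (b c d : Fin 7) :
    χ b c d = ∑ e, (1 / 24 * ∑ p, ∑ q, ∑ r, χ p q r * stdDual e p q r) * stdDual e b c d := by
  have hH : ∀ a b, HasDerivAt (fun u => metricInv (φ u) a b) 0 0 :=
    hasDerivAt_inv_entry hg (by rw [h0, metric_stdForm])
  refine eq_sum_stdDual (fun a b c => ?_) (fun a b c => ?_) (fun a b => ?_) b c d
  · refine (hd a b c).unique ((hd b a c).neg.congr_of_eventuallyEq ?_)
    filter_upwards [hpos] with u hu using hu.swap_left a b c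
  · refine (hd a b c).unique ((hd a c b).neg.congr_of_eventuallyEq ?_)
    filter_upwards [hpos] with u hu using hu.swap_right a b c
  -- The derivative of the norm identity `φ_amn φ_b^mn = 6 g_ab`: its right side is stationary, and
  -- on its left side only the two factors `φ` vary.
  · have e1 : HasDerivAt (fun u => formNorm (φ u) (metricInv (φ u)) a b) 0 0 := by
      have := (hg a b).const_mul 6
      rw [mul_zero] at this
      refine this.congr_of_eventuallyEq ?_
      filter_upwards [hpos] with u hu
      rw [hu.formNorm_eq]
    have e2 : HasDerivAt (fun u => formNorm (φ u) (metricInv (φ u)) a b) _ 0 :=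
      HasDerivAt.fun_sum fun m _ => HasDerivAt.fun_sum fun n _ => (hd a m n).mul
        (HasDerivAt.fun_sum fun p _ => HasDerivAt.fun_sum fun q _ =>
          ((hH m p).mul (hH n q)).mul (hd b p q))
    have e3 := e2.unique e1
    rw [← e3]
    simp only [h0, metricInv_stdForm, Matrix.one_apply, mul_ite, ite_mul, zero_mul, mul_zero,
      one_mul, mul_one, add_zero, zero_add, sum_add_distrib, Finset.sum_ite_eq, mem_univ, if_true,
      Pi.mul_apply]
    congr 1
    exact sum_congr rfl fun _ _ => sum_congr rfl fun _ _ => by simp [mul_comm]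

theorem sum_pull3_mul_pull4 {P : Matrix (Fin 7) (Fin 7) ℝ} (hP : P.det ≠ 0) (χ : Tensor3)
    (ψ : Tensor4) (m : Fin 7) :
    ∑ b, ∑ c, ∑ d, pull3 P χ b c d * pull4 P⁻¹ᵀ ψ m b c d
      = pull1 P⁻¹ᵀ (fun i => ∑ b, ∑ c, ∑ d, χ b c d * ψ i b c d) m := by
  have hu : IsUnit P.det := hP.isUnit
  have p1 : ∀ x y : Tensor1, ∑ b, pull1 P x b * pull1 P⁻¹ᵀ y b = ∑ i, x i * y i := by
    intro x y
    have h : P *ᵥ pull1 P⁻¹ᵀ y = y := by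
      rw [pull1_eq, transpose_transpose, mulVec_mulVec, Matrix.mul_nonsing_inv _ hu, one_mulVec]
    have := sum_mul_pull1 P (pull1 P⁻¹ᵀ y) x
    rw [h] at this
    simpa only [mul_comm] using this
  have p2 : ∀ x y : Tensor2, ∑ b, ∑ c, pull2 P x b c * pull2 P⁻¹ᵀ y b c
      = ∑ i, ∑ j, x i j * y i j := by
    intro x y
    rw [sum_comm]
    have h : ∀ c, ∑ b, pull2 P x b c * pull2 P⁻¹ᵀ y b c
        = ∑ i, pull1 P (x i) c * pull1 P⁻¹ᵀ (y i) c := fun c =>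
      p1 (fun i => pull1 P (x i) c) (fun i => pull1 P⁻¹ᵀ (y i) c)
    simp only [h]
    rw [sum_comm]
    exact sum_congr rfl fun i _ => p1 (x i) (y i)
  have p3 : ∀ x y : Tensor3, ∑ b, ∑ c, ∑ d, pull3 P x b c d * pull3 P⁻¹ᵀ y b c d
      = ∑ i, ∑ j, ∑ k, x i j k * y i j k := by
    intro x y
    have h : ∀ c d, ∑ b, pull3 P x b c d * pull3 P⁻¹ᵀ y b c d
        = ∑ i, pull2 P (x i) c d * pull2 P⁻¹ᵀ (y i) c d := fun c d =>
      p1 (fun i => pull2 P (x i) c d) (fun i => pull2 P⁻¹ᵀ (y i) c d)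
    rw [sum_comm]
    have h' : ∀ c, ∑ b, ∑ d, pull3 P x b c d * pull3 P⁻¹ᵀ y b c d
        = ∑ i, ∑ d, pull2 P (x i) c d * pull2 P⁻¹ᵀ (y i) c d := fun c => by
      rw [sum_comm]
      simp only [h]
      rw [sum_comm]
    simp only [h']
    rw [sum_comm]
    exact sum_congr rfl fun i _ => p2 (x i) (y i)
  have e : ∀ b c d, pull3 P χ b c d * pull4 P⁻¹ᵀ ψ m b c d
      = ∑ i, P⁻¹ᵀ i m * (pull3 P χ b c d * pull3 P⁻¹ᵀ (ψ i) b c d) := by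
    intro b c d
    rw [pull4, mul_sum]
    exact sum_congr rfl fun _ _ => by ring
  have e2 : (fun i => ∑ b, ∑ c, ∑ d, χ b c d * ψ i b c d) = fun i => ∑ b, ∑ c, ∑ d,
      pull3 P χ b c d * pull3 P⁻¹ᵀ (ψ i) b c d := funext fun i => (p3 χ (ψ i)).symm
  rw [e2, pull1]
  simp only [e, mul_sum]
  have hc : ∀ p q, ∑ r, ∑ i, P⁻¹ᵀ i m * (pull3 P χ p q r * pull3 P⁻¹ᵀ (ψ i) p q r)
      = ∑ i, ∑ r, P⁻¹ᵀ i m * (pull3 P χ p q r * pull3 P⁻¹ᵀ (ψ i) p q r) := fun p q => sum_comm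
  simp only [hc]
  have hc2 : ∀ p, ∑ q, ∑ i, ∑ r, P⁻¹ᵀ i m * (pull3 P χ p q r * pull3 P⁻¹ᵀ (ψ i) p q r)
      = ∑ i, ∑ q, ∑ r, P⁻¹ᵀ i m * (pull3 P χ p q r * pull3 P⁻¹ᵀ (ψ i) p q r) :=
    fun p => sum_comm
  simp only [hc2]
  rw [sum_comm]

/-- A constant frame `A⁻¹` carries the base point of the curve to the standard form and keeps the
metric stationary. -/
theorem deriv_eq_sum_psi {φ : ℝ → Tensor3} {χ : Tensor3}
    (hpos : ∀ᶠ u in 𝓝 (0 : ℝ), IsPositive (φ u))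
    (hd : ∀ a b c, HasDerivAt (fun u => φ u a b c) (χ a b c) 0)
    (hg : ∀ a b, HasDerivAt (fun u => metric (φ u) a b) 0 0) (b c d : Fin 7) :
    χ b c d = ∑ e, (1 / 24 * ∑ p, ∑ q, ∑ r, χ p q r * psiUp (φ 0) e p q r)
      * psi (φ 0) e b c d := by
  obtain ⟨A, hA, h0⟩ := (isPositive_iff _).1 hpos.self_of_nhds
  have hAu : IsUnit A.det := hA.isUnit
  have hB : (A⁻¹).det ≠ 0 := by rw [det_nonsing_inv]; simpa using hA
  have hχ : χ = pull3 A (pull3 A⁻¹ χ) := by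
    rw [pull3_pull3, Matrix.nonsing_inv_mul _ hAu, pull3_one]
  have key := deriv_eq_sum_stdDual (φ := fun u => pull3 A⁻¹ (φ u)) (χ := pull3 A⁻¹ χ)
    (by rw [h0, pull3_pull3, Matrix.mul_nonsing_inv _ hAu, pull3_one])
    (hpos.mono fun u hu => hu.pull3 hB)
    (fun a b c => HasDerivAt.fun_sum fun i _ => (HasDerivAt.fun_sum fun j _ =>
      (HasDerivAt.fun_sum fun k _ => (hd i j k).const_mul _).const_mul _).const_mul _)
    (fun a b => by
      simp only [metric_pull3_apply hB]
      have : HasDerivAt (fun u => pull2 A⁻¹ (fun i j => metric (φ u) i j) a b)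
        (∑ i, A⁻¹ i a * ∑ j, A⁻¹ j b * 0) 0 := HasDerivAt.fun_sum fun i _ =>
          (HasDerivAt.fun_sum fun j _ => (hg i j).const_mul _).const_mul _
      simpa using this)
  have hΨ : psi (φ 0) = pull4 A stdDual := by rw [h0, psi_pull3 hA, psi_stdForm]
  have hΨ' : psiUp (φ 0) = pull4 A⁻¹ᵀ stdDual := by
    rw [h0, psiUp_pull3 hA, psiUp_eq_pull4, metricInv_stdForm, transpose_one, pull4_one,
      psi_stdForm]
  generalize pull3 A⁻¹ χ = χ' at *
  subst hχ
  rw [hΨ, hΨ']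
  simp only [sum_pull3_mul_pull4 hA]
  rw [sum_mul_pull4]
  have hτ : A *ᵥ (fun e => 1 / 24 * pull1 A⁻¹ᵀ (fun i => ∑ p, ∑ q, ∑ r,
      χ' p q r * stdDual i p q r) e)
      = fun i => 1 / 24 * ∑ p, ∑ q, ∑ r, χ' p q r * stdDual i p q r := by
    have : (fun e => 1 / 24 * pull1 A⁻¹ᵀ (fun i => ∑ p, ∑ q, ∑ r, χ' p q r * stdDual i p q r) e)
        = (1 / 24 : ℝ) • A⁻¹ *ᵥ (fun i => ∑ p, ∑ q, ∑ r, χ' p q r * stdDual i p q r) := by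
      funext e
      rw [pull1_eq, transpose_transpose]
      rfl
    rw [this, mulVec_smul, mulVec_mulVec, Matrix.mul_nonsing_inv _ hAu, one_mulVec]
    rfl
  rw [hτ]
  have : χ' = fun j k l => ∑ i, (1 / 24 * ∑ p, ∑ q, ∑ r, χ' p q r * stdDual i p q r)
      * stdDual i j k l := by
    funext j k l; exact key j k l
  conv_lhs => rw [this]

/-! ### The Levi-Civita connection in coordinates -/

theorem hasDerivAt_line {f : Coords → ℝ} {x : Coords} (hf : DifferentiableAt ℝ f x) (a : Fin 7) :
    HasDerivAt (fun u : ℝ => f (x + u • EuclideanSpace.single a 1)) (partialDeriv a f x) 0 := by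
  have h1 : HasDerivAt (fun u : ℝ => x + u • (EuclideanSpace.single a 1 : Coords))
      (EuclideanSpace.single a 1) 0 := by
    simpa using ((hasDerivAt_id (0 : ℝ)).smul_const (EuclideanSpace.single a 1 : Coords)).const_add x
  have h2 : HasFDerivAt f (fderiv ℝ f x) (x + (0 : ℝ) • (EuclideanSpace.single a 1 : Coords)) := by
    simpa using hf.hasFDerivAt
  exact h2.comp_hasDerivAt 0 h1

theorem partialDeriv_congr {f g : Coords → ℝ} {x : Coords} (h : f =ᶠ[𝓝 x] g) (a : Fin 7) :
    partialDeriv a f x = partialDeriv a g x := by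
  rw [partialDeriv, partialDeriv, h.fderiv_eq]

/-- The matrix `Γ^e_ab` for fixed `a`. -/
def christoffelMatrix (φ : Coords → Tensor3) (x : Coords) (a : Fin 7) :
    Matrix (Fin 7) (Fin 7) ℝ := fun e b => christoffel φ x e a b

/-- The curve of linear maps which turns a derivative along `∂_a` into a covariant derivative. -/
def transport (Γ : Matrix (Fin 7) (Fin 7) ℝ) (u : ℝ) : Matrix (Fin 7) (Fin 7) ℝ := 1 - u • Γ

theorem transport_zero (Γ : Matrix (Fin 7) (Fin 7) ℝ) : transport Γ 0 = 1 := by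
  simp [transport]

theorem hasDerivAt_transport (Γ : Matrix (Fin 7) (Fin 7) ℝ) (i b : Fin 7) :
    HasDerivAt (fun u => transport Γ u i b) (-Γ i b) 0 := by
  have : HasDerivAt (fun u : ℝ => (1 : Matrix (Fin 7) (Fin 7) ℝ) i b - u * Γ i b)
      (0 - 1 * Γ i b) 0 := (hasDerivAt_const _ _).sub ((hasDerivAt_id (0 : ℝ)).mul_const _)
  simpa [transport] using this

theorem det_transport_ne_zero (Γ : Matrix (Fin 7) (Fin 7) ℝ) :
    ∀ᶠ u in 𝓝 (0 : ℝ), (transport Γ u).det ≠ 0 := by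
  have hc : Continuous fun u : ℝ => (transport Γ u).det := by
    unfold transport
    exact (continuous_const.sub (continuous_id.smul continuous_const)).matrix_det
  exact hc.continuousAt.eventually_ne (by rw [transport_zero]; simp)

/-- Pull-back by a curve with velocity `-Γ` at the identity adds exactly the connection terms to the
derivative, here and in higher rank. Natural constructions commute with pull-back, so their
covariant derivatives are ordinary derivatives along such curves. -/
theorem hasDerivAt_pull1 {Q : ℝ → Matrix (Fin 7) (Fin 7) ℝ} {Γ : Matrix (Fin 7) (Fin 7) ℝ}
    (hQ : ∀ i b, HasDerivAt (fun u => Q u i b) (-Γ i b) 0) (hQ0 : Q 0 = 1)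
    {α : ℝ → Tensor1} {α' : Tensor1} (h : ∀ i, HasDerivAt (fun u => α u i) (α' i) 0) (b : Fin 7) :
    HasDerivAt (fun u => pull1 (Q u) (α u) b) (α' b - ∑ e, Γ e b * α 0 e) 0 := by
  have h1 : HasDerivAt (fun u => pull1 (Q u) (α u) b)
      (∑ i, (-Γ i b * α 0 i + Q 0 i b * α' i)) 0 :=
    HasDerivAt.fun_sum fun i _ => (hQ i b).mul (h i)
  convert! h1 using 1
  simp [hQ0, Matrix.one_apply, sum_add_distrib]
  ring

theorem hasDerivAt_pull2 {Q : ℝ → Matrix (Fin 7) (Fin 7) ℝ} {Γ : Matrix (Fin 7) (Fin 7) ℝ}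
    (hQ : ∀ i b, HasDerivAt (fun u => Q u i b) (-Γ i b) 0) (hQ0 : Q 0 = 1)
    {α : ℝ → Tensor2} {α' : Tensor2} (h : ∀ i j, HasDerivAt (fun u => α u i j) (α' i j) 0)
    (b c : Fin 7) :
    HasDerivAt (fun u => pull2 (Q u) (α u) b c)
      (α' b c - ∑ e, (Γ e b * α 0 e c + Γ e c * α 0 b e)) 0 := by
  have h1 := hasDerivAt_pull1 hQ hQ0 (fun i => hasDerivAt_pull1 hQ hQ0 (h i) c) b
  refine h1.congr_deriv ?_
  simp only [hQ0, pull1_one, sum_add_distrib]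
  ring

theorem hasDerivAt_pull3 {Q : ℝ → Matrix (Fin 7) (Fin 7) ℝ} {Γ : Matrix (Fin 7) (Fin 7) ℝ}
    (hQ : ∀ i b, HasDerivAt (fun u => Q u i b) (-Γ i b) 0) (hQ0 : Q 0 = 1)
    {α : ℝ → Tensor3} {α' : Tensor3} (h : ∀ i j k, HasDerivAt (fun u => α u i j k) (α' i j k) 0)
    (b c d : Fin 7) :
    HasDerivAt (fun u => pull3 (Q u) (α u) b c d)
      (α' b c d - ∑ e, (Γ e b * α 0 e c d + Γ e c * α 0 b e d + Γ e d * α 0 b c e)) 0 := by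
  have h1 := hasDerivAt_pull1 hQ hQ0 (fun i => hasDerivAt_pull2 hQ hQ0 (h i) c d) b
  refine h1.congr_deriv ?_
  simp only [hQ0, pull2_one, sum_add_distrib]
  ring

/-- Hypotheses on a field of positive 3-forms near a point. -/
structure IsG2StructureAt (φ : Coords → Tensor3) (x : Coords) : Prop where
  smooth : ∀ a b c, ContDiffAt ℝ ∞ (fun y => φ y a b c) x
  pos : ∀ᶠ y in 𝓝 x, IsPositive (φ y)

namespace IsG2StructureAt

variable {φ : Coords → Tensor3} {x : Coords}

theorem metric_differentiableAt (h : IsG2StructureAt φ x) (a b : Fin 7) :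
    DifferentiableAt ℝ (fun y => metric (φ y) a b) x :=
  (contDiffAt_metric h.smooth h.pos.self_of_nhds a b).differentiableAt (by simp)

theorem partialDeriv_metric_comm (h : IsG2StructureAt φ x) (a b c : Fin 7) :
    partialDeriv a (fun y => metric (φ y) b c) x = partialDeriv a (fun y => metric (φ y) c b) x :=
  partialDeriv_congr (h.pos.mono fun _ hy => hy.metric_isSymm b c) a

theorem sum_metric_mul_christoffel (h : IsG2StructureAt φ x) (d a c : Fin 7) :
    ∑ e, metric (φ x) d e * christoffel φ x e a c
      = (1 / 2) * (partialDeriv c (fun y => metric (φ y) d a) x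
        + partialDeriv a (fun y => metric (φ y) d c) x
        - partialDeriv d (fun y => metric (φ y) a c) x) := by
  have h1 := h.pos.self_of_nhds.metric_mul_metricInv
  have h2 : ∀ w : Tensor1, ∑ e, metric (φ x) d e * ∑ f, metricInv (φ x) e f * w f = w d := by
    intro w
    have := congrFun (congrArg (fun N => N *ᵥ w) h1) d
    simp only [one_mulVec, ← mulVec_mulVec] at this
    exact this
  simp only [christoffel]
  rw [← h2 fun d => (1 / 2) * (partialDeriv c (fun y => metric (φ y) d a) x
        + partialDeriv a (fun y => metric (φ y) d c) x
        - partialDeriv d (fun y => metric (φ y) a c) x)]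
  simp only [mul_sum]
  exact sum_congr rfl fun _ _ => sum_congr rfl fun _ _ => by ring

theorem christoffel_comm (h : IsG2StructureAt φ x) (e a c : Fin 7) :
    christoffel φ x e a c = christoffel φ x e c a := by
  simp only [christoffel]
  congr 1
  refine sum_congr rfl fun d _ => ?_
  rw [h.partialDeriv_metric_comm d a c]
  ring

/-- The metric is parallel. -/
theorem partialDeriv_metric (h : IsG2StructureAt φ x) (a b c : Fin 7) :
    partialDeriv a (fun y => metric (φ y) b c) x
      = ∑ e, (christoffel φ x e a b * metric (φ x) e c + christoffel φ x e a c * metric (φ x) b e) := by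
  have h1 := h.sum_metric_mul_christoffel c a b
  have h2 := h.sum_metric_mul_christoffel b a c
  have h3 : ∑ e, christoffel φ x e a b * metric (φ x) e c
      = ∑ e, metric (φ x) c e * christoffel φ x e a b := sum_congr rfl fun e _ => by
    rw [h.pos.self_of_nhds.metric_isSymm e c, mul_comm]
  have h4 : ∑ e, christoffel φ x e a c * metric (φ x) b e
      = ∑ e, metric (φ x) b e * christoffel φ x e a c := sum_congr rfl fun e _ => mul_comm _ _
  rw [sum_add_distrib, h3, h4, h1, h2, h.partialDeriv_metric_comm b c a,
    h.partialDeriv_metric_comm a c b, h.partialDeriv_metric_comm c a b]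
  ring

theorem deform (h : IsG2StructureAt φ x) {v : Coords → Tensor1}
    (hv : ∀ a, ContDiffAt ℝ ∞ (fun y => v y a) x) :
    IsG2StructureAt (fun y => deform (φ y) (v y)) x :=
  ⟨contDiffAt_deform h.smooth hv h.pos.self_of_nhds, h.pos.mono fun _ hy => hy.deform _⟩

theorem eventually_line (h : IsG2StructureAt φ x) (a : Fin 7) :
    ∀ᶠ u in 𝓝 (0 : ℝ), IsPositive (φ (x + u • EuclideanSpace.single a 1)) := by
  have hc : Tendsto (fun u : ℝ => x + u • (EuclideanSpace.single a 1 : Coords)) (𝓝 0) (𝓝 x) := by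
    have : Continuous fun u : ℝ => x + u • (EuclideanSpace.single a 1 : Coords) := by fun_prop
    simpa using this.tendsto 0
  exact hc.eventually h.pos

/-- The covariant derivative of a 3-form field as a derivative of a curve of 3-forms. -/
theorem hasDerivAt_curve (Γ : Matrix (Fin 7) (Fin 7) ℝ) {η : Coords → Tensor3}
    (hη : ∀ a b c, DifferentiableAt ℝ (fun y => η y a b c) x) (a b c d : Fin 7) :
    HasDerivAt (fun u : ℝ => pull3 (transport Γ u) (η (x + u • EuclideanSpace.single a 1)) b c d)
      (partialDeriv a (fun y => η y b c d) x
        - ∑ e, (Γ e b * η x e c d + Γ e c * η x b e d + Γ e d * η x b c e)) 0 := by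
  have := hasDerivAt_pull3 (hasDerivAt_transport Γ) (transport_zero Γ)
    (fun i j k => hasDerivAt_line (hη i j k) a) b c d
  simpa using this

theorem hasDerivAt_metric_curve (h : IsG2StructureAt φ x) (Γ : Matrix (Fin 7) (Fin 7) ℝ)
    (a b c : Fin 7) :
    HasDerivAt (fun u : ℝ => metric (pull3 (transport Γ u)
        (φ (x + u • EuclideanSpace.single a 1))) b c)
      (partialDeriv a (fun y => metric (φ y) b c) x
        - ∑ e, (Γ e b * metric (φ x) e c + Γ e c * metric (φ x) b e)) 0 := by
  have := hasDerivAt_pull2 (hasDerivAt_transport Γ) (transport_zero Γ)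
    (fun i j => hasDerivAt_line (h.metric_differentiableAt i j) a) b c
  simp only [zero_smul, add_zero] at this
  refine this.congr_of_eventuallyEq ?_
  filter_upwards [det_transport_ne_zero Γ] with u hu
  rw [metric_pull3_apply hu]

theorem differentiableAt (h : IsG2StructureAt φ x) (a b c : Fin 7) :
    DifferentiableAt ℝ (fun y => φ y a b c) x := (h.smooth a b c).differentiableAt (by simp)

/-- `∇φ` is determined by the torsion. -/
theorem covDerivPhi_eq (h : IsG2StructureAt φ x) (a b c d : Fin 7) :
    covDerivPhi φ x a b c d = ∑ e, (1 / 24 * ∑ p, ∑ q, ∑ r, covDerivPhi φ x a p q r *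
      psiUp (φ x) e p q r) * psi (φ x) e b c d := by
  -- The transported curve has stationary metric because the Levi-Civita connection is metric, and
  -- its derivative is `∇φ`.
  have key := deriv_eq_sum_psi (φ := fun u : ℝ => pull3 (transport (christoffelMatrix φ x a) u)
      (φ (x + u • EuclideanSpace.single a 1))) (χ := covDerivPhi φ x a) ?_
    (fun b c d => hasDerivAt_curve _ h.differentiableAt a b c d) (fun b c => ?_) b c d
  · simpa [transport_zero, pull3_one] using key
  · filter_upwards [det_transport_ne_zero (christoffelMatrix φ x a), h.eventually_line a]
      with u hu hp using hp.pull3 hu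
  · have := h.hasDerivAt_metric_curve (christoffelMatrix φ x a) a b c
    rw [h.partialDeriv_metric] at this
    simpa [christoffelMatrix] using this

end IsG2StructureAt

/-! ### The first variation of the deformed form at the standard form -/

/-- With `ψ` replaced by a polynomial in `φ`, `g`, `g⁻¹`, a variation with stationary metric acts on
the factors `φ` only. -/
theorem deform_eq_formSquare {φ : Tensor3} (h : IsPositive φ) (x : Tensor1) (b c d : Fin 7) :
    deform φ x b c d = φ b c d + ∑ e, x e * formSquare φ (metric φ) (metricInv φ) b c d e := by
  rw [deform, h.psi_eq]

theorem IsPositive.flat_sharp {φ : Tensor3} (h : IsPositive φ) (α : Tensor1) :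
    flat φ (sharp φ α) = α := by
  rw [flat_eq, sharp_eq, mulVec_mulVec, h.metric_mul_metricInv, one_mulVec]

theorem IsPositive.sharp_flat {φ : Tensor3} (h : IsPositive φ) (x : Tensor1) :
    sharp φ (flat φ x) = x := by
  rw [flat_eq, sharp_eq, mulVec_mulVec, h.metricInv_mul_metric, one_mulVec]

theorem IsPositive.normSq_sharp {φ : Tensor3} (h : IsPositive φ) (α : Tensor1) :
    normSq φ (sharp φ α) = ∑ a, α a * ∑ b, metricInv φ a b * α b := by
  have h1 : normSq φ (sharp φ α) = ∑ a, sharp φ α a * flat φ (sharp φ α) a := by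
    simp only [normSq, flat, mul_sum]
    exact sum_congr rfl fun _ _ => sum_congr rfl fun _ _ => by ring
  rw [h1, h.flat_sharp]
  exact sum_congr rfl fun a _ => by rw [mul_comm]; rfl

/-- The variation of `deform φ (sharp φ β)` at the standard form with `β = t e⁰`, for a variation
`χ` of `φ` with constant metric and a variation `w` of `β`. -/
def deformVariation (t : ℝ) (χ : Tensor3) (w : Tensor1) : Tensor3 := fun b c d =>
  χ b c d + ∑ e, w e * stdDual b c d e
    + t * ∑ e, (χ b c e * stdForm e d 0 + stdForm b c e * χ e d 0)

/-- The variation of the metric of `deform φ (sharp φ β)`. -/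
def metricVariation (t k : ℝ) (w : Tensor1) : Tensor2 := fun b c =>
  -(2 / 3) * (2 * t * w 0) * (k ^ 5)⁻¹ * ((1 + t ^ 2) * (1 : Matrix (Fin 7) (Fin 7) ℝ) b c
      - t ^ 2 * ((Pi.single 0 1 : Tensor1) b * (Pi.single 0 1 : Tensor1) c))
    + (k ^ 2)⁻¹ * (2 * t * w 0 * (1 : Matrix (Fin 7) (Fin 7) ℝ) b c
      - t * (w b * (Pi.single 0 1 : Tensor1) c + (Pi.single 0 1 : Tensor1) b * w c))

section Variation

variable {φ : ℝ → Tensor3} {χ : Tensor3} {β : ℝ → Tensor1} {w : Tensor1} {t : ℝ}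

/-- The product rule, in which `g` and `g⁻¹` count as constants. The deformation is parametrized by
a covector because `∇v` is used with both indices lowered. -/
theorem hasDerivAt_deform (h0 : φ 0 = stdForm) (hpos : ∀ᶠ u in 𝓝 (0 : ℝ), IsPositive (φ u))
    (hd : ∀ a b c, HasDerivAt (fun u => φ u a b c) (χ a b c) 0)
    (hg : ∀ a b, HasDerivAt (fun u => metric (φ u) a b) 0 0)
    (hβ0 : β 0 = t • Pi.single 0 1) (hβ : ∀ a, HasDerivAt (fun u => β u a) (w a) 0)
    (b c d : Fin 7) :
    HasDerivAt (fun u => deform (φ u) (sharp (φ u) (β u)) b c d)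
      (deformVariation t χ w b c d) 0 := by
  have hG0 : metric (φ 0) = 1 := by rw [h0, metric_stdForm]
  have hH0 : metricInv (φ 0) = 1 := by rw [h0, metricInv_stdForm]
  have hH : ∀ a b, HasDerivAt (fun u => metricInv (φ u) a b) 0 0 :=
    hasDerivAt_inv_entry hg hG0
  have hs : ∀ e, HasDerivAt (fun u => sharp (φ u) (β u) e) (w e) 0 := fun e => by
    have : HasDerivAt (fun u => sharp (φ u) (β u) e)
      (∑ f, (0 * β 0 f + metricInv (φ 0) e f * w f)) 0 :=
        HasDerivAt.fun_sum fun f _ => (hH e f).mul (hβ f)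
    simpa [hH0, Matrix.one_apply] using this
  have hq : ∀ e, HasDerivAt (fun u => formSquare (φ u) (metric (φ u)) (metricInv (φ u)) b c d e)
      (∑ f, (χ b c f * stdForm f d e + stdForm b c f * χ f d e)) 0 := fun e => by
    have h1 : ∀ f, HasDerivAt (fun u => ∑ i, metricInv (φ u) f i * φ u i d e)
        (∑ i, (0 * φ 0 i d e + metricInv (φ 0) f i * χ i d e)) 0 := fun f =>
      HasDerivAt.fun_sum fun i _ => (hH f i).mul (hd i d e)
    have h2 := (HasDerivAt.fun_sum fun f (_ : f ∈ (univ : Finset (Fin 7))) =>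
      (hd b c f).mul (h1 f)).sub ((hg b d).mul (hg c e)) |>.add ((hg b e).mul (hg c d))
    refine h2.congr_deriv ?_
    simp [metricInv_stdForm, h0, Matrix.one_apply]
  have h3 := (hd b c d).add (HasDerivAt.fun_sum fun e (_ : e ∈ (univ : Finset (Fin 7))) =>
    (hs e).mul (hq e))
  have h4 : HasDerivAt (fun u => deform (φ u) (sharp (φ u) (β u)) b c d) _ 0 :=
    h3.congr_of_eventuallyEq (hpos.mono fun u hu => deform_eq_formSquare hu _ b c d)
  refine h4.congr_deriv ?_
  have hs0 : sharp (φ 0) (β 0) = t • Pi.single 0 1 := by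
    rw [sharp_eq, hH0, one_mulVec, hβ0]
  rw [hs0, hG0, hH0, h0, formSquare_stdForm, sum_add_distrib, deformVariation]
  simp [Pi.single_apply]
  ring

/-- The derivative of `k⁻² ((1 + M) g - β ⊗ β)`, where `M = |β|²`. At the base point `M` has
derivative `2 t w₀`, and `k` has derivative `1 / 3` of that times `k⁻²`. -/
theorem hasDerivAt_metric_deform (h0 : φ 0 = stdForm)
    (hpos : ∀ᶠ u in 𝓝 (0 : ℝ), IsPositive (φ u))
    (hg : ∀ a b, HasDerivAt (fun u => metric (φ u) a b) 0 0)
    (hβ0 : β 0 = t • Pi.single 0 1) (hβ : ∀ a, HasDerivAt (fun u => β u a) (w a) 0)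
    (b c : Fin 7) :
    HasDerivAt (fun u => metric (deform (φ u) (sharp (φ u) (β u))) b c)
      (metricVariation t ((1 + t ^ 2) ^ (1 / 3 : ℝ)) w b c) 0 := by
  have hG0 : metric (φ 0) = 1 := by rw [h0, metric_stdForm]
  have hH0 : metricInv (φ 0) = 1 := by rw [h0, metricInv_stdForm]
  have hH : ∀ a b, HasDerivAt (fun u => metricInv (φ u) a b) 0 0 :=
    hasDerivAt_inv_entry hg hG0
  set N : ℝ → ℝ := fun u => ∑ a, β u a * ∑ b, metricInv (φ u) a b * β u b with hN
  have hN0 : N 0 = t ^ 2 := by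
    simp [hN, hβ0, hH0, Matrix.one_apply, Pi.single_apply, sq]
  have hN' : HasDerivAt N (2 * t * w 0) 0 := by
    have : HasDerivAt N (∑ a, (w a * ∑ b, metricInv (φ 0) a b * β 0 b
        + β 0 a * ∑ b, (0 * β 0 b + metricInv (φ 0) a b * w b))) 0 :=
      HasDerivAt.fun_sum fun a _ => (hβ a).mul
        (HasDerivAt.fun_sum fun b _ => (hH a b).mul (hβ b))
    refine this.congr_deriv ?_
    simp [hβ0, hH0, Matrix.one_apply, Pi.single_apply, sum_add_distrib]
    ring
  set k := (1 + t ^ 2) ^ (1 / 3 : ℝ) with hk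
  have hkpos : 0 < k := by positivity
  have hk3 : k ^ 3 = 1 + t ^ 2 := cube_rpow_third (by positivity)
  have hK : HasDerivAt (fun u => (1 + N u) ^ (1 / 3 : ℝ)) (1 / 3 * (2 * t * w 0) * (k ^ 2)⁻¹) 0 := by
    have h1 := (hN'.const_add 1).rpow_const (p := 1 / 3) (Or.inl (by rw [hN0]; positivity))
    refine h1.congr_deriv ?_
    rw [hN0]
    have : (1 + t ^ 2) ^ (1 / 3 - 1 : ℝ) = (k ^ 2)⁻¹ := by
      have h1 : 0 ≤ 1 + t ^ 2 := by positivity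
      rw [hk]
      generalize 1 + t ^ 2 = s at h1
      rw [← Real.rpow_natCast, ← Real.rpow_mul h1, ← Real.rpow_neg h1]
      norm_num
    rw [this]; ring
  have hK0 : (1 + N 0) ^ (1 / 3 : ℝ) = k := by rw [hN0]
  have hK2 := (hK.pow 2).inv (by simp only [Pi.pow_apply, hK0]; positivity)
  have h5 := hK2.mul ((((hN'.const_add 1).mul (hg b c))).sub ((hβ b).mul (hβ c)))
  refine (h5.congr_of_eventuallyEq (hpos.mono fun u hu => ?_)).congr_deriv ?_
  · rw [hu.metric_deform, kappa, hu.normSq_sharp, hu.flat_sharp]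
    rfl
  simp only [Pi.pow_apply, hN0, ← hk, hG0, hβ0, metricVariation, Pi.smul_apply, smul_eq_mul,
    Pi.inv_apply, Pi.mul_apply, Pi.sub_apply]
  field_simp
  ring

end Variation

/-! ### The torsion of the deformed form at the standard form -/

/-- The covariant derivative of the deformed form in one direction at the standard form, where `T`
is the torsion in that direction, `w` the derivative of the deformation covector and `S` the
difference of the connections. -/
def deformCov (t : ℝ) (T w : Tensor1) (S : Matrix (Fin 7) (Fin 7) ℝ) : Tensor3 := fun b c d =>
  deformVariation t (fun i j k => ∑ e, T e * stdDual e i j k) w b c d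
    - ∑ e, (S e b * (stdForm e c d + t * stdDual e c d 0)
      + S e c * (stdForm b e d + t * stdDual b e d 0) + S e d * (stdForm b c e + t * stdDual b c e 0))

/-- The derivative of the new form is a combination of contractions of the new dual form, so seven
components determine it. The triples here and in the next six lemmas are those at which
`psi_deform_stdForm_values` isolates a single coefficient. -/
theorem deformCov_136 (t : ℝ) (T w : Tensor1) (S : Matrix (Fin 7) (Fin 7) ℝ) :
    deformCov t T w S 1 3 6
      = -T 0 + w 0 + S 2 1 - t * S 1 1 + S 4 3 - t * S 3 3 - S 5 6 - t * S 6 6 := by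
  have h0 : ∀ e, stdZ e 3 6 = if e = 2 then -1 else 0 := by decide +kernel
  have h1 : ∀ e, stdZ e 6 0 = if e = 5 then 1 else 0 := by decide +kernel
  have h2 : ∀ e, stdZ 1 e 6 = if e = 4 then -1 else 0 := by decide +kernel
  have h3 : ∀ e, stdZ 1 3 e = if e = 5 then 1 else 0 := by decide +kernel
  have h4 : ∀ e, stdDualZ e 1 3 5 = 0 := by decide +kernel
  have h5 : ∀ e, stdDualZ e 1 3 6 = if e = 0 then -1 else 0 := by decide +kernel
  have h6 : ∀ e, stdDualZ e 3 6 0 = if e = 1 then 1 else 0 := by decide +kernel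
  have h7 : ∀ e, stdDualZ e 5 6 0 = 0 := by decide +kernel
  have h8 : ∀ e, stdDualZ 1 e 6 0 = if e = 3 then 1 else 0 := by decide +kernel
  have h9 : ∀ e, stdDualZ 1 3 e 0 = if e = 6 then 1 else 0 := by decide +kernel
  have h10 : ∀ e, stdDualZ 1 3 6 e = if e = 0 then 1 else 0 := by decide +kernel
  simp [deformCov, deformVariation, stdForm, stdDual, sum_add_distrib, mul_add,
    h0, h1, h2, h3, h4, h5, h6, h7, h8, h9, h10]
  ring

theorem deformCov_234 (t : ℝ) (T w : Tensor1) (S : Matrix (Fin 7) (Fin 7) ℝ) :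
    deformCov t T w S 2 3 4
      = T 1 - w 1 - t * T 2 - S 0 2 - S 5 3 - t * S 6 3 + S 6 4 - t * S 5 4 := by
  have h0 : ∀ e, stdZ e 3 4 = if e = 0 then 1 else 0 := by decide +kernel
  have h1 : ∀ e, stdZ e 4 0 = if e = 3 then 1 else 0 := by decide +kernel
  have h2 : ∀ e, stdZ 2 e 4 = if e = 5 then 1 else 0 := by decide +kernel
  have h3 : ∀ e, stdZ 2 3 e = if e = 6 then -1 else 0 := by decide +kernel
  have h4 : ∀ e, stdDualZ e 2 3 3 = 0 := by decide +kernel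
  have h5 : ∀ e, stdDualZ e 2 3 4 = if e = 1 then 1 else 0 := by decide +kernel
  have h6 : ∀ e, stdDualZ e 3 4 0 = 0 := by decide +kernel
  have h7 : ∀ e, stdDualZ e 6 4 0 = if e = 2 then 1 else 0 := by decide +kernel
  have h8 : ∀ e, stdDualZ 2 e 4 0 = if e = 6 then 1 else 0 := by decide +kernel
  have h9 : ∀ e, stdDualZ 2 3 e 0 = if e = 5 then 1 else 0 := by decide +kernel
  have h10 : ∀ e, stdDualZ 2 3 4 e = if e = 1 then -1 else 0 := by decide +kernel
  simp [deformCov, deformVariation, stdForm, stdDual, sum_add_distrib, mul_add,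
    h0, h1, h2, h3, h4, h5, h6, h7, h8, h9, h10]
  ring

theorem deformCov_134 (t : ℝ) (T w : Tensor1) (S : Matrix (Fin 7) (Fin 7) ℝ) :
    deformCov t T w S 1 3 4
      = -T 2 + w 2 - t * T 1 - S 0 1 - S 6 3 + t * S 5 3 - S 5 4 - t * S 6 4 := by
  have h0 : ∀ e, stdZ e 3 4 = if e = 0 then 1 else 0 := by decide +kernel
  have h1 : ∀ e, stdZ e 4 0 = if e = 3 then 1 else 0 := by decide +kernel
  have h2 : ∀ e, stdZ 1 e 4 = if e = 6 then 1 else 0 := by decide +kernel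
  have h3 : ∀ e, stdZ 1 3 e = if e = 5 then 1 else 0 := by decide +kernel
  have h4 : ∀ e, stdDualZ e 1 3 3 = 0 := by decide +kernel
  have h5 : ∀ e, stdDualZ e 1 3 4 = if e = 2 then -1 else 0 := by decide +kernel
  have h6 : ∀ e, stdDualZ e 3 4 0 = 0 := by decide +kernel
  have h7 : ∀ e, stdDualZ e 5 4 0 = if e = 1 then -1 else 0 := by decide +kernel
  have h8 : ∀ e, stdDualZ 1 e 4 0 = if e = 5 then -1 else 0 := by decide +kernel
  have h9 : ∀ e, stdDualZ 1 3 e 0 = if e = 6 then 1 else 0 := by decide +kernel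
  have h10 : ∀ e, stdDualZ 1 3 4 e = if e = 2 then 1 else 0 := by decide +kernel
  simp [deformCov, deformVariation, stdForm, stdDual, sum_add_distrib, mul_add,
    h0, h1, h2, h3, h4, h5, h6, h7, h8, h9, h10]
  ring

theorem deformCov_412 (t : ℝ) (T w : Tensor1) (S : Matrix (Fin 7) (Fin 7) ℝ) :
    deformCov t T w S 4 1 2
      = T 3 - w 3 - t * T 4 - S 0 4 + S 5 1 + t * S 6 1 - S 6 2 + t * S 5 2 := by
  have h0 : ∀ e, stdZ e 1 2 = if e = 0 then 1 else 0 := by decide +kernel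
  have h1 : ∀ e, stdZ e 2 0 = if e = 1 then 1 else 0 := by decide +kernel
  have h2 : ∀ e, stdZ 4 e 2 = if e = 5 then -1 else 0 := by decide +kernel
  have h3 : ∀ e, stdZ 4 1 e = if e = 6 then 1 else 0 := by decide +kernel
  have h4 : ∀ e, stdDualZ e 1 2 0 = 0 := by decide +kernel
  have h5 : ∀ e, stdDualZ e 4 1 1 = 0 := by decide +kernel
  have h6 : ∀ e, stdDualZ e 4 1 2 = if e = 3 then 1 else 0 := by decide +kernel
  have h7 : ∀ e, stdDualZ e 6 2 0 = if e = 4 then -1 else 0 := by decide +kernel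
  have h8 : ∀ e, stdDualZ 4 e 2 0 = if e = 6 then -1 else 0 := by decide +kernel
  have h9 : ∀ e, stdDualZ 4 1 e 0 = if e = 5 then -1 else 0 := by decide +kernel
  have h10 : ∀ e, stdDualZ 4 1 2 e = if e = 3 then -1 else 0 := by decide +kernel
  simp [deformCov, deformVariation, stdForm, stdDual, sum_add_distrib, mul_add,
    h0, h1, h2, h3, h4, h5, h6, h7, h8, h9, h10]
  ring

theorem deformCov_312 (t : ℝ) (T w : Tensor1) (S : Matrix (Fin 7) (Fin 7) ℝ) :
    deformCov t T w S 3 1 2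
      = -T 4 + w 4 - t * T 3 - S 0 3 + S 6 1 - t * S 5 1 + S 5 2 + t * S 6 2 := by
  have h0 : ∀ e, stdZ e 1 2 = if e = 0 then 1 else 0 := by decide +kernel
  have h1 : ∀ e, stdZ e 2 0 = if e = 1 then 1 else 0 := by decide +kernel
  have h2 : ∀ e, stdZ 3 e 2 = if e = 6 then -1 else 0 := by decide +kernel
  have h3 : ∀ e, stdZ 3 1 e = if e = 5 then -1 else 0 := by decide +kernel
  have h4 : ∀ e, stdDualZ e 1 2 0 = 0 := by decide +kernel
  have h5 : ∀ e, stdDualZ e 3 1 1 = 0 := by decide +kernel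
  have h6 : ∀ e, stdDualZ e 3 1 2 = if e = 4 then -1 else 0 := by decide +kernel
  have h7 : ∀ e, stdDualZ e 5 2 0 = if e = 3 then 1 else 0 := by decide +kernel
  have h8 : ∀ e, stdDualZ 3 e 2 0 = if e = 5 then 1 else 0 := by decide +kernel
  have h9 : ∀ e, stdDualZ 3 1 e 0 = if e = 6 then -1 else 0 := by decide +kernel
  have h10 : ∀ e, stdDualZ 3 1 2 e = if e = 4 then 1 else 0 := by decide +kernel
  simp [deformCov, deformVariation, stdForm, stdDual, sum_add_distrib, mul_add,
    h0, h1, h2, h3, h4, h5, h6, h7, h8, h9, h10]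
  ring

theorem deformCov_612 (t : ℝ) (T w : Tensor1) (S : Matrix (Fin 7) (Fin 7) ℝ) :
    deformCov t T w S 6 1 2
      = T 5 - w 5 - t * T 6 - S 0 6 - S 3 1 - t * S 4 1 + S 4 2 - t * S 3 2 := by
  have h0 : ∀ e, stdZ e 1 2 = if e = 0 then 1 else 0 := by decide +kernel
  have h1 : ∀ e, stdZ e 2 0 = if e = 1 then 1 else 0 := by decide +kernel
  have h2 : ∀ e, stdZ 6 e 2 = if e = 3 then 1 else 0 := by decide +kernel
  have h3 : ∀ e, stdZ 6 1 e = if e = 4 then -1 else 0 := by decide +kernel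
  have h4 : ∀ e, stdDualZ e 1 2 0 = 0 := by decide +kernel
  have h5 : ∀ e, stdDualZ e 4 2 0 = if e = 6 then 1 else 0 := by decide +kernel
  have h6 : ∀ e, stdDualZ e 6 1 1 = 0 := by decide +kernel
  have h7 : ∀ e, stdDualZ e 6 1 2 = if e = 5 then 1 else 0 := by decide +kernel
  have h8 : ∀ e, stdDualZ 6 e 2 0 = if e = 4 then 1 else 0 := by decide +kernel
  have h9 : ∀ e, stdDualZ 6 1 e 0 = if e = 3 then 1 else 0 := by decide +kernel
  have h10 : ∀ e, stdDualZ 6 1 2 e = if e = 5 then -1 else 0 := by decide +kernel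
  simp [deformCov, deformVariation, stdForm, stdDual, sum_add_distrib, mul_add,
    h0, h1, h2, h3, h4, h5, h6, h7, h8, h9, h10]
  ring

theorem deformCov_512 (t : ℝ) (T w : Tensor1) (S : Matrix (Fin 7) (Fin 7) ℝ) :
    deformCov t T w S 5 1 2
      = -T 6 + w 6 - t * T 5 - S 0 5 - S 4 1 + t * S 3 1 - S 3 2 - t * S 4 2 := by
  have h0 : ∀ e, stdZ e 1 2 = if e = 0 then 1 else 0 := by decide +kernel
  have h1 : ∀ e, stdZ e 2 0 = if e = 1 then 1 else 0 := by decide +kernel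
  have h2 : ∀ e, stdZ 5 e 2 = if e = 4 then 1 else 0 := by decide +kernel
  have h3 : ∀ e, stdZ 5 1 e = if e = 3 then 1 else 0 := by decide +kernel
  have h4 : ∀ e, stdDualZ e 1 2 0 = 0 := by decide +kernel
  have h5 : ∀ e, stdDualZ e 3 2 0 = if e = 5 then -1 else 0 := by decide +kernel
  have h6 : ∀ e, stdDualZ e 5 1 1 = 0 := by decide +kernel
  have h7 : ∀ e, stdDualZ e 5 1 2 = if e = 6 then -1 else 0 := by decide +kernel
  have h8 : ∀ e, stdDualZ 5 e 2 0 = if e = 3 then -1 else 0 := by decide +kernel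
  have h9 : ∀ e, stdDualZ 5 1 e 0 = if e = 4 then 1 else 0 := by decide +kernel
  have h10 : ∀ e, stdDualZ 5 1 2 e = if e = 6 then 1 else 0 := by decide +kernel
  simp [deformCov, deformVariation, stdForm, stdDual, sum_add_distrib, mul_add,
    h0, h1, h2, h3, h4, h5, h6, h7, h8, h9, h10]
  ring

/-- The variation of the metric of the deformed form, up to a factor. -/
def metricVariation' (t : ℝ) (w : Tensor1) : Tensor2 := fun b c =>
  2 / 3 * t * w 0 * (1 : Matrix (Fin 7) (Fin 7) ℝ) b c
    + 4 / 3 * (1 + t ^ 2)⁻¹ * t ^ 3 * w 0 *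
      ((Pi.single 0 1 : Tensor1) b * (Pi.single 0 1 : Tensor1) c)
    - t * (w b * (Pi.single 0 1 : Tensor1) c + (Pi.single 0 1 : Tensor1) b * w c)

/-- The relation `k³ = 1 + t²` leaves `k` only in an overall factor, so that the difference of the
connections is rational in `t`. -/
theorem metricVariation_eq {t k : ℝ} (hk : k ≠ 0) (hk3 : k ^ 3 = 1 + t ^ 2) (w : Tensor1)
    (b c : Fin 7) : metricVariation t k w b c = (k ^ 2)⁻¹ * metricVariation' t w b c := by
  rw [metricVariation, metricVariation', ← hk3]
  generalize (Pi.single 0 1 : Tensor1) b = p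
  generalize (Pi.single 0 1 : Tensor1) c = q
  field_simp
  ring

/-- The difference of the Levi-Civita connections of the deformed form and of the standard form. -/
def connDiff (t : ℝ) (W : Tensor2) (a : Fin 7) : Matrix (Fin 7) (Fin 7) ℝ := fun e b =>
  1 / 2 * (if e = 0 then 1 else (1 + t ^ 2)⁻¹) *
    (metricVariation' t (W a) b e + metricVariation' t (W b) a e - metricVariation' t (W e) a b)

/-- The torsion of the deformed form at the standard form, up to a factor, where `T` is the torsion
of the form and `W` the covariant derivative of the deformation vector. -/
def stdTorsion (t : ℝ) (T W : Tensor2) : Tensor2 :=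
  let r := (1 + t ^ 2)⁻¹
  ![![T 0 0 - r * W 0 0 + 1 / 2 * t * r * (W 1 2 - W 2 1 + W 3 4 - W 4 3 + W 5 6 - W 6 5),
      T 0 1 - W 0 1 - t * T 0 2 + 2 / 3 * t * r * W 2 0 + 1 / 2 * t * r * (W 3 5 - W 4 6
        - W 5 3 + W 6 4) + 1 / 2 * (1 - r) * (W 3 6 + W 4 5 - W 5 4 - W 6 3),
      t * T 0 1 + T 0 2 - W 0 2 - 2 / 3 * t * r * W 1 0 + 1 / 2 * (1 - r) * (W 3 5 - W 4 6
        - W 5 3 + W 6 4) - 1 / 2 * t * r * (W 3 6 + W 4 5 - W 5 4 - W 6 3),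
      T 0 3 - W 0 3 - t * T 0 4 - 1 / 2 * t * r * (W 1 5 - W 2 6 - W 5 1 + W 6 2) - 1 / 2 * (1
        - r) * (W 1 6 + W 2 5 - W 5 2 - W 6 1) + 2 / 3 * t * r * W 4 0,
      t * T 0 3 + T 0 4 - W 0 4 - 1 / 2 * (1 - r) * (W 1 5 - W 2 6 - W 5 1 + W 6 2)
        + 1 / 2 * t * r * (W 1 6 + W 2 5 - W 5 2 - W 6 1) - 2 / 3 * t * r * W 3 0,
      T 0 5 - W 0 5 - t * T 0 6 + 1 / 2 * t * r * (W 1 3 - W 2 4 - W 3 1 + W 4 2) + 1 / 2 * (1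
        - r) * (W 1 4 + W 2 3 - W 3 2 - W 4 1) + 2 / 3 * t * r * W 6 0,
      t * T 0 5 + T 0 6 - W 0 6 + 1 / 2 * (1 - r) * (W 1 3 - W 2 4 - W 3 1 + W 4 2)
        - 1 / 2 * t * r * (W 1 4 + W 2 3 - W 3 2 - W 4 1) - 2 / 3 * t * r * W 5 0],
    ![T 1 0 - r * W 1 0 + 1 / 3 * t * r * W 2 0,
      T 1 1 - W 1 1 - t * T 1 2 + 1 / 2 * t * (W 1 2 + W 2 1),
      t * (T 1 1 - W 1 1) + T 1 2 - W 1 2 - 1 / 3 * t * W 0 0,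
      T 1 3 - W 1 3 - t * T 1 4 + 1 / 2 * t * (W 1 4 + W 4 1) - 1 / 3 * t * r * W 5 0
        - 1 / 3 * (1 - r) * W 6 0,
      t * T 1 3 + T 1 4 - W 1 4 - 1 / 2 * t * (W 1 3 + W 3 1) - 1 / 3 * (1 - r) * W 5 0
        + 1 / 3 * t * r * W 6 0,
      T 1 5 - W 1 5 - t * T 1 6 + 1 / 2 * t * (W 1 6 + W 6 1) + 1 / 3 * t * r * W 3 0
        + 1 / 3 * (1 - r) * W 4 0,
      t * T 1 5 + T 1 6 - W 1 6 - 1 / 2 * t * (W 1 5 + W 5 1) + 1 / 3 * (1 - r) * W 3 0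
        - 1 / 3 * t * r * W 4 0],
    ![T 2 0 - 1 / 3 * t * r * W 1 0 - r * W 2 0,
      T 2 1 - W 2 1 - t * (T 2 2 - W 2 2) + 1 / 3 * t * W 0 0,
      t * T 2 1 + T 2 2 - W 2 2 - 1 / 2 * t * (W 1 2 + W 2 1),
      T 2 3 - W 2 3 - t * T 2 4 + 1 / 2 * t * (W 2 4 + W 4 2) - 1 / 3 * (1 - r) * W 5 0
        + 1 / 3 * t * r * W 6 0,
      t * T 2 3 + T 2 4 - W 2 4 - 1 / 2 * t * (W 2 3 + W 3 2) + 1 / 3 * t * r * W 5 0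
        + 1 / 3 * (1 - r) * W 6 0,
      T 2 5 - W 2 5 - t * T 2 6 + 1 / 2 * t * (W 2 6 + W 6 2) + 1 / 3 * (1 - r) * W 3 0
        - 1 / 3 * t * r * W 4 0,
      t * T 2 5 + T 2 6 - W 2 6 - 1 / 2 * t * (W 2 5 + W 5 2) - 1 / 3 * t * r * W 3 0
        - 1 / 3 * (1 - r) * W 4 0],
    ![T 3 0 - r * W 3 0 + 1 / 3 * t * r * W 4 0,
      T 3 1 - W 3 1 - t * T 3 2 + 1 / 2 * t * (W 2 3 + W 3 2) + 1 / 3 * t * r * W 5 0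
        + 1 / 3 * (1 - r) * W 6 0,
      t * T 3 1 + T 3 2 - W 3 2 - 1 / 2 * t * (W 1 3 + W 3 1) + 1 / 3 * (1 - r) * W 5 0
        - 1 / 3 * t * r * W 6 0,
      T 3 3 - W 3 3 - t * T 3 4 + 1 / 2 * t * (W 3 4 + W 4 3),
      t * (T 3 3 - W 3 3) + T 3 4 - W 3 4 - 1 / 3 * t * W 0 0,
      T 3 5 - W 3 5 - t * T 3 6 - 1 / 3 * t * r * W 1 0 - 1 / 3 * (1 - r) * W 2 0
        + 1 / 2 * t * (W 3 6 + W 6 3),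
      t * T 3 5 + T 3 6 - W 3 6 - 1 / 3 * (1 - r) * W 1 0 + 1 / 3 * t * r * W 2 0
        - 1 / 2 * t * (W 3 5 + W 5 3)],
    ![T 4 0 - 1 / 3 * t * r * W 3 0 - r * W 4 0,
      T 4 1 - W 4 1 - t * T 4 2 + 1 / 2 * t * (W 2 4 + W 4 2) + 1 / 3 * (1 - r) * W 5 0
        - 1 / 3 * t * r * W 6 0,
      t * T 4 1 + T 4 2 - W 4 2 - 1 / 2 * t * (W 1 4 + W 4 1) - 1 / 3 * t * r * W 5 0
        - 1 / 3 * (1 - r) * W 6 0,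
      T 4 3 - W 4 3 - t * (T 4 4 - W 4 4) + 1 / 3 * t * W 0 0,
      t * T 4 3 + T 4 4 - W 4 4 - 1 / 2 * t * (W 3 4 + W 4 3),
      T 4 5 - W 4 5 - t * T 4 6 - 1 / 3 * (1 - r) * W 1 0 + 1 / 3 * t * r * W 2 0
        + 1 / 2 * t * (W 4 6 + W 6 4),
      t * T 4 5 + T 4 6 - W 4 6 + 1 / 3 * t * r * W 1 0 + 1 / 3 * (1 - r) * W 2 0
        - 1 / 2 * t * (W 4 5 + W 5 4)],
    ![T 5 0 - r * W 5 0 + 1 / 3 * t * r * W 6 0,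
      T 5 1 - W 5 1 - t * T 5 2 + 1 / 2 * t * (W 2 5 + W 5 2) - 1 / 3 * t * r * W 3 0
        - 1 / 3 * (1 - r) * W 4 0,
      t * T 5 1 + T 5 2 - W 5 2 - 1 / 2 * t * (W 1 5 + W 5 1) - 1 / 3 * (1 - r) * W 3 0
        + 1 / 3 * t * r * W 4 0,
      T 5 3 - W 5 3 - t * T 5 4 + 1 / 3 * t * r * W 1 0 + 1 / 3 * (1 - r) * W 2 0
        + 1 / 2 * t * (W 4 5 + W 5 4),
      t * T 5 3 + T 5 4 - W 5 4 + 1 / 3 * (1 - r) * W 1 0 - 1 / 3 * t * r * W 2 0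
        - 1 / 2 * t * (W 3 5 + W 5 3),
      T 5 5 - W 5 5 - t * T 5 6 + 1 / 2 * t * (W 5 6 + W 6 5),
      t * (T 5 5 - W 5 5) + T 5 6 - W 5 6 - 1 / 3 * t * W 0 0],
    ![T 6 0 - 1 / 3 * t * r * W 5 0 - r * W 6 0,
      T 6 1 - W 6 1 - t * T 6 2 + 1 / 2 * t * (W 2 6 + W 6 2) - 1 / 3 * (1 - r) * W 3 0
        + 1 / 3 * t * r * W 4 0,
      t * T 6 1 + T 6 2 - W 6 2 - 1 / 2 * t * (W 1 6 + W 6 1) + 1 / 3 * t * r * W 3 0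
        + 1 / 3 * (1 - r) * W 4 0,
      T 6 3 - W 6 3 - t * T 6 4 + 1 / 3 * (1 - r) * W 1 0 - 1 / 3 * t * r * W 2 0
        + 1 / 2 * t * (W 4 6 + W 6 4),
      t * T 6 3 + T 6 4 - W 6 4 - 1 / 3 * t * r * W 1 0 - 1 / 3 * (1 - r) * W 2 0
        - 1 / 2 * t * (W 3 6 + W 6 3),
      T 6 5 - W 6 5 - t * (T 6 6 - W 6 6) + 1 / 3 * t * W 0 0,
      t * T 6 5 + T 6 6 - W 6 6 - 1 / 2 * t * (W 5 6 + W 6 5)]]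

set_option maxHeartbeats 2000000 in
-- Substitution of the difference of the connections into the seven chosen components. This is the
-- source of the entries of `stdTorsion`; the signs are those of the corresponding values of the new
-- dual form.
theorem deformCov_connDiff (t : ℝ) (T W : Tensor2) (a : Fin 7) :
    deformCov t (T a) (W a) (connDiff t W a) 1 3 6 = - stdTorsion t T W a 0 ∧
    deformCov t (T a) (W a) (connDiff t W a) 2 3 4 = stdTorsion t T W a 1 ∧
    deformCov t (T a) (W a) (connDiff t W a) 1 3 4 = - stdTorsion t T W a 2 ∧
    deformCov t (T a) (W a) (connDiff t W a) 4 1 2 = stdTorsion t T W a 3 ∧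
    deformCov t (T a) (W a) (connDiff t W a) 3 1 2 = - stdTorsion t T W a 4 ∧
    deformCov t (T a) (W a) (connDiff t W a) 6 1 2 = stdTorsion t T W a 5 ∧
    deformCov t (T a) (W a) (connDiff t W a) 5 1 2 = - stdTorsion t T W a 6 := by
  have hr : (1 + t ^ 2)⁻¹ * (1 + t ^ 2) = 1 := inv_mul_cancel₀ (by positivity)
  rw [deformCov_136, deformCov_234, deformCov_134, deformCov_412, deformCov_312, deformCov_612,
    deformCov_512]
  simp only [connDiff, metricVariation', stdTorsion]
  -- Only `r (1 + t²) = 1` is kept, which leaves polynomial identities modulo one relation.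
  generalize (1 + t ^ 2)⁻¹ = r at hr
  obtain rfl | rfl | rfl | rfl | rfl | rfl | rfl :
      a = 0 ∨ a = 1 ∨ a = 2 ∨ a = 3 ∨ a = 4 ∨ a = 5 ∨ a = 6 := by omega
  all_goals refine ⟨?_, ?_, ?_, ?_, ?_, ?_, ?_⟩ <;> simp <;> grind

theorem deform_pull3_sharp {φ : Tensor3} (h : IsPositive φ) {Q : Matrix (Fin 7) (Fin 7) ℝ}
    (hQ : Q.det ≠ 0) (v : Tensor1) :
    pull3 Q (deform φ v) = deform (pull3 Q φ) (sharp (pull3 Q φ) (pull1 Q (flat φ v))) := by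
  rw [deform_pull3 hQ, sharp_pull3 hQ, h.sharp_flat]

/-- The contraction identity for the new form. Its metric is diagonal, so the two purely metric
terms vanish when `b` differs from `c` and `d`; the inverse metric has entry `k²` in direction `0`
and `k⁻¹` elsewhere. -/
theorem psi_deform_stdForm {t k : ℝ} (hk : k = (1 + t ^ 2) ^ (1 / 3 : ℝ)) (m b c d : Fin 7)
    (hc : c ≠ b) (hd : d ≠ b) :
    psi (deform stdForm (t • Pi.single 0 1)) m b c d
      = k ^ 2 * (deform stdForm (t • Pi.single 0 1) m b 0 * deform stdForm (t • Pi.single 0 1) 0 c d)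
        + k⁻¹ * ∑ e : Fin 6, deform stdForm (t • Pi.single 0 1) m b e.succ
          * deform stdForm (t • Pi.single 0 1) e.succ c d := by
  obtain ⟨hp, hm⟩ := metric_deform_stdForm hk
  have hkpos : 0 < k := by rw [hk]; positivity
  have hinv : metricInv (deform stdForm (t • Pi.single 0 1))
      = Matrix.diagonal ![k ^ 2, k⁻¹, k⁻¹, k⁻¹, k⁻¹, k⁻¹, k⁻¹] := by
    rw [metricInv, hm]
    refine Matrix.inv_eq_right_inv ?_
    rw [Matrix.diagonal_mul_diagonal, ← Matrix.diagonal_one]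
    congr 1
    funext i
    fin_cases i <;> simp [hkpos.ne']
  rw [hp.psi_eq, formSquare, hm, hinv, Matrix.diagonal_apply_ne _ hd.symm,
    Matrix.diagonal_apply_ne _ hc.symm]
  simp only [Matrix.diagonal_apply, ite_mul, zero_mul, sum_ite_eq, mem_univ, if_true, mul_zero,
    sub_zero, add_zero]
  rw [Fin.sum_univ_succ, mul_sum]
  congr 1
  · simp; ring
  · refine sum_congr rfl fun e _ => ?_
    have : ![k ^ 2, k⁻¹, k⁻¹, k⁻¹, k⁻¹, k⁻¹, k⁻¹] e.succ = k⁻¹ := by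
      fin_cases e <;> simp
    rw [this]; ring

theorem psi_deform_stdForm_values {t k : ℝ} (hk : k = (1 + t ^ 2) ^ (1 / 3 : ℝ)) (x : Tensor1) :
    let ψ := psi (deform stdForm (t • Pi.single 0 1))
    ∑ m, x m * ψ m 1 3 6 = - k⁻¹ * x 0 ∧ ∑ m, x m * ψ m 2 3 4 = k ^ 2 * x 1 ∧
    ∑ m, x m * ψ m 1 3 4 = - k ^ 2 * x 2 ∧ ∑ m, x m * ψ m 4 1 2 = k ^ 2 * x 3 ∧
    ∑ m, x m * ψ m 3 1 2 = - k ^ 2 * x 4 ∧ ∑ m, x m * ψ m 6 1 2 = k ^ 2 * x 5 ∧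
    ∑ m, x m * ψ m 5 1 2 = - k ^ 2 * x 6 := by
  have e0 : ∀ b c d : Fin 7, deform stdForm (t • Pi.single 0 1) b c d
      = (stdZ b c d : ℝ) + t * (stdDualZ b c d 0 : ℝ) := deform_stdForm t
  have a1 : ∀ e, stdZ e 3 6 = if e = 2 then -1 else 0 := by decide +kernel
  have a2 : ∀ e, stdDualZ e 3 6 0 = if e = 1 then 1 else 0 := by decide +kernel
  have a3 : ∀ e, stdZ e 3 4 = if e = 0 then 1 else 0 := by decide +kernel
  have a4 : ∀ e, stdDualZ e 3 4 0 = 0 := by decide +kernel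
  have a5 : ∀ e, stdZ e 1 2 = if e = 0 then 1 else 0 := by decide +kernel
  have a6 : ∀ e, stdDualZ e 1 2 0 = 0 := by decide +kernel
  have b1 : ∀ e, stdZ e 1 0 = if e = 2 then -1 else 0 := by decide +kernel
  have b2 : ∀ e, stdZ e 2 0 = if e = 1 then 1 else 0 := by decide +kernel
  have b3 : ∀ e, stdZ e 3 0 = if e = 4 then -1 else 0 := by decide +kernel
  have b4 : ∀ e, stdZ e 4 0 = if e = 3 then 1 else 0 := by decide +kernel
  have b5 : ∀ e, stdZ e 5 0 = if e = 6 then -1 else 0 := by decide +kernel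
  have b6 : ∀ e, stdZ e 6 0 = if e = 5 then 1 else 0 := by decide +kernel
  have c1 : ∀ e b, stdDualZ e b 0 0 = 0 := by decide +kernel
  have c2 : ∀ e, stdZ e 1 1 = 0 := by decide +kernel
  have c3 : ∀ e, stdDualZ e 1 1 0 = 0 := by decide +kernel
  have hs1 : ∀ e : Fin 6, (e.succ = (1 : Fin 7)) = (e = 0) := by decide
  have hs2 : ∀ e : Fin 6, (e.succ = (2 : Fin 7)) = (e = 1) := by decide
  refine ⟨?_, ?_, ?_, ?_, ?_, ?_, ?_⟩
  · simp [psi_deform_stdForm hk, e0, a1, a2, a5, a6, b1, c1, c2, c3, mul_add,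
      sum_add_distrib, hs1, hs2]
    ring
  all_goals
    simp [psi_deform_stdForm hk, e0, a3, a4, a5, a6, b1, b2, b3, b4, b5, b6, c1]
    ring

/-! ### From the old connection to the new one, at a point in normal form. -/

namespace IsG2StructureAt

variable {φ : Coords → Tensor3} {x : Coords} {v : Coords → Tensor1} {t : ℝ}

theorem flat_differentiableAt (h : IsG2StructureAt φ x)
    (hv : ∀ a, ContDiffAt ℝ ∞ (fun y => v y a) x) (a : Fin 7) :
    DifferentiableAt ℝ (fun y => flat (φ y) (v y) a) x :=
  (contDiffAt_flat h.smooth hv h.pos.self_of_nhds a).differentiableAt (by simp)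

theorem hasDerivAt_flat_curve (h : IsG2StructureAt φ x)
    (hv : ∀ a, ContDiffAt ℝ ∞ (fun y => v y a) x) (a b : Fin 7) :
    HasDerivAt (fun u : ℝ => pull1 (transport (christoffelMatrix φ x a) u)
        (flat (φ (x + u • EuclideanSpace.single a 1)) (v (x + u • EuclideanSpace.single a 1))) b)
      (covDerivVector φ v x a b) 0 := by
  have := hasDerivAt_pull1 (hasDerivAt_transport (christoffelMatrix φ x a))
    (transport_zero _) (fun i => hasDerivAt_line (h.flat_differentiableAt hv i) a) b
  simpa [covDerivVector, christoffelMatrix] using this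

theorem hasDerivAt_metric_transport (h : IsG2StructureAt φ x) (a b c : Fin 7) :
    HasDerivAt (fun u : ℝ => metric (pull3 (transport (christoffelMatrix φ x a) u)
        (φ (x + u • EuclideanSpace.single a 1))) b c) 0 0 := by
  have := h.hasDerivAt_metric_curve (christoffelMatrix φ x a) a b c
  rw [h.partialDeriv_metric] at this
  simpa [christoffelMatrix] using this

theorem eventually_pos_transport (h : IsG2StructureAt φ x) (Γ : Matrix (Fin 7) (Fin 7) ℝ)
    (a : Fin 7) : ∀ᶠ u in 𝓝 (0 : ℝ), IsPositive (pull3 (transport Γ u)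
      (φ (x + u • EuclideanSpace.single a 1))) := by
  filter_upwards [det_transport_ne_zero Γ, h.eventually_line a] with u hu hp using hp.pull3 hu

theorem eventually_deform_transport (h : IsG2StructureAt φ x) (Γ : Matrix (Fin 7) (Fin 7) ℝ)
    (a : Fin 7) : ∀ᶠ u in 𝓝 (0 : ℝ), pull3 (transport Γ u)
      (G2Deformation.deform (φ (x + u • EuclideanSpace.single a 1))
        (v (x + u • EuclideanSpace.single a 1)))
      = G2Deformation.deform (pull3 (transport Γ u) (φ (x + u • EuclideanSpace.single a 1)))
        (sharp (pull3 (transport Γ u) (φ (x + u • EuclideanSpace.single a 1)))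
          (pull1 (transport Γ u) (flat (φ (x + u • EuclideanSpace.single a 1))
            (v (x + u • EuclideanSpace.single a 1))))) := by
  filter_upwards [det_transport_ne_zero Γ, h.eventually_line a] with u hu hp
    using deform_pull3_sharp hp hu _

theorem covDerivPhi_stdForm (h : IsG2StructureAt φ x) (h0 : φ x = stdForm) (a b c d : Fin 7) :
    covDerivPhi φ x a b c d = ∑ e, torsion φ x a e * stdDual e b c d := by
  rw [h.covDerivPhi_eq, h0, psi_stdForm]
  refine sum_congr rfl fun e _ => ?_
  simp [torsion, h0, metric_stdForm, Matrix.one_apply]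

section

variable (h : IsG2StructureAt φ x) (hv : ∀ a, ContDiffAt ℝ ∞ (fun y => v y a) x)
  (h0 : φ x = stdForm) (hv0 : v x = t • Pi.single 0 1)
include h hv h0 hv0

/-- The derivative of the new form for the old connection, by computing the derivative of one
transported curve in two ways: directly, and as the deformation of the transported pair. -/
theorem partialDeriv_deform (a b c d : Fin 7) :
    partialDeriv a (fun y => G2Deformation.deform (φ y) (v y) b c d) x
      - ∑ e, (christoffel φ x e a b * G2Deformation.deform (φ x) (v x) e c d
        + christoffel φ x e a c * G2Deformation.deform (φ x) (v x) b e d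
        + christoffel φ x e a d * G2Deformation.deform (φ x) (v x) b c e)
      = deformVariation t (covDerivPhi φ x a) (covDerivVector φ v x a) b c d := by
  have h1 := hasDerivAt_curve (christoffelMatrix φ x a) (h.deform hv).differentiableAt a b c d
  have h2 := hasDerivAt_deform (t := t) (by simp [transport_zero, pull3_one, h0])
    (h.eventually_pos_transport (christoffelMatrix φ x a) a)
    (fun b c d => hasDerivAt_curve (christoffelMatrix φ x a) h.differentiableAt a b c d)
    (h.hasDerivAt_metric_transport a)
    (by simp [transport_zero, pull1_one, h0, hv0, flat_eq, metric_stdForm])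
    (h.hasDerivAt_flat_curve hv a) b c d
  refine h1.unique (h2.congr_of_eventuallyEq ?_)
  filter_upwards [h.eventually_deform_transport (v := v) (christoffelMatrix φ x a) a] with u hu
  rw [hu]

theorem partialDeriv_metric_deform (a b c : Fin 7) :
    partialDeriv a (fun y => metric (G2Deformation.deform (φ y) (v y)) b c) x
      - ∑ e, (christoffel φ x e a b * metric (G2Deformation.deform (φ x) (v x)) e c
        + christoffel φ x e a c * metric (G2Deformation.deform (φ x) (v x)) b e)
      = metricVariation t ((1 + t ^ 2) ^ (1 / 3 : ℝ)) (covDerivVector φ v x a) b c := by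
  have h1 := (h.deform hv).hasDerivAt_metric_curve (christoffelMatrix φ x a) a b c
  have h2 := hasDerivAt_metric_deform (t := t) (by simp [transport_zero, pull3_one, h0])
    (h.eventually_pos_transport (christoffelMatrix φ x a) a)
    (h.hasDerivAt_metric_transport a)
    (by simp [transport_zero, pull1_one, h0, hv0, flat_eq, metric_stdForm])
    (h.hasDerivAt_flat_curve hv a) b c
  refine h1.unique (h2.congr_of_eventuallyEq ?_)
  filter_upwards [h.eventually_deform_transport (v := v) (christoffelMatrix φ x a) a] with u hu
  rw [hu]

/-- The difference `S` of the connections is symmetric in its lower indices, and parallelism of the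
new metric expresses the old derivative of that metric through `S`. The Koszul combination of three
cyclic instances solves for `S`, and the diagonal entry of the new metric is then divided out. -/
theorem christoffel_deform (e a b : Fin 7) :
    christoffel (fun y => G2Deformation.deform (φ y) (v y)) x e a b
      = christoffel φ x e a b + connDiff t (covDerivVector φ v x) a e b := by
  set W := covDerivVector φ v x
  set Γ' := christoffel (fun y => G2Deformation.deform (φ y) (v y)) x with hΓ'
  set k : ℝ := (1 + t ^ 2) ^ (1 / 3 : ℝ) with hk
  have hkpos : 0 < k := by positivity
  have hk3 : k ^ 3 = 1 + t ^ 2 := cube_rpow_third (by positivity)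
  set d : Tensor1 := ![(k ^ 2)⁻¹, k, k, k, k, k, k] with hd
  have hm : metric (G2Deformation.deform (φ x) (v x)) = Matrix.diagonal d := by
    rw [h0, hv0, (metric_deform_stdForm hk).2]
  have key : ∀ a b c, (Γ' c a b - christoffel φ x c a b) * d c
      + (Γ' b a c - christoffel φ x b a c) * d b = (k ^ 2)⁻¹ * metricVariation' t (W a) b c := by
    intro a b c
    rw [← metricVariation_eq hkpos.ne' hk3, ← h.partialDeriv_metric_deform hv h0 hv0,
      (h.deform hv).partialDeriv_metric, hm]
    simp only [Matrix.diagonal_apply, mul_ite, mul_zero, sum_add_distrib, sum_ite_eq, sum_ite_eq',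
      mem_univ, if_true]
    rw [← hΓ']
    ring
  have s1 : ∀ e a b, Γ' e a b = Γ' e b a := (h.deform hv).christoffel_comm
  have s2 := h.christoffel_comm
  have k1 := key a b e
  have k2 := key b a e
  have k3 := key e a b
  rw [s1 e b a, s2 e b a] at k2
  rw [s1 b e a, s2 b e a, s1 a e b, s2 a e b] at k3
  have hde : d e * (k ^ 2 * (if e = 0 then 1 else (1 + t ^ 2)⁻¹)) = 1 := by
    by_cases he : e = 0
    · subst he; simp [hd, hkpos.ne']
    · have : d e = k := by
        rw [hd]
        revert he
        fin_cases e <;> simp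
      rw [this, if_neg he, ← hk3]
      field_simp
  have hk2 : k ^ 2 * (k ^ 2)⁻¹ = 1 := mul_inv_cancel₀ (by positivity)
  rw [connDiff]
  generalize (if e = 0 then 1 else (1 + t ^ 2)⁻¹) = ρ at *
  have : (Γ' e a b - christoffel φ x e a b) * d e = 1 / 2 * (k ^ 2)⁻¹ *
      (metricVariation' t (W a) b e + metricVariation' t (W b) a e
        - metricVariation' t (W e) a b) := by linear_combination (k1 + k2 - k3) / 2
  linear_combination k ^ 2 * ρ * this - (Γ' e a b - christoffel φ x e a b) * hde
    + ρ / 2 * (metricVariation' t (W a) b e + metricVariation' t (W b) a e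
        - metricVariation' t (W e) a b) * hk2

/-- Passing to the new connection subtracts one term in `S` for each index of the form. -/
theorem covDerivPhi_deform (a b c d : Fin 7) :
    covDerivPhi (fun y => G2Deformation.deform (φ y) (v y)) x a b c d
      = deformCov t (torsion φ x a) (covDerivVector φ v x a)
        (connDiff t (covDerivVector φ v x) a) b c d := by
  have h1 := h.partialDeriv_deform hv h0 hv0 a b c d
  have h2 : covDerivPhi φ x a = fun i j k => ∑ e, torsion φ x a e * stdDual e i j k := by
    funext i j k; exact h.covDerivPhi_stdForm h0 a i j k
  rw [h2] at h1
  rw [deformCov, ← h1, covDerivPhi, sub_sub, ← sum_add_distrib]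
  congr 1
  have h3 : ∀ i j k, stdForm i j k + t * stdDual i j k 0
      = G2Deformation.deform (φ x) (v x) i j k := fun i j k => by rw [h0, hv0, deform_stdForm]
  refine sum_congr rfl fun e _ => ?_
  simp only [h.christoffel_deform hv h0 hv0, h3]
  ring

/-- `X` holds the coefficients in terms of the contractions of the new dual form. They are `k` times
the table entry in direction `0` and `k⁻²` times it elsewhere; lowering with `diag (k⁻², k, …, k)`
leaves the uniform factor `k⁻¹`. -/
theorem torsion_deform (a n : Fin 7) :
    torsion (fun y => G2Deformation.deform (φ y) (v y)) x a n
      = ((1 + t ^ 2) ^ (1 / 3 : ℝ))⁻¹ * stdTorsion t (torsion φ x) (covDerivVector φ v x) a n := by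
  set k : ℝ := (1 + t ^ 2) ^ (1 / 3 : ℝ) with hk
  have hkpos : 0 < k := by positivity
  set X : Tensor1 := fun e => 1 / 24 * ∑ p, ∑ q, ∑ r,
    covDerivPhi (fun y => G2Deformation.deform (φ y) (v y)) x a p q r *
      psiUp (G2Deformation.deform (φ x) (v x)) e p q r with hX
  have h1 : ∀ b c d, deformCov t (torsion φ x a) (covDerivVector φ v x a)
        (connDiff t (covDerivVector φ v x) a) b c d
      = ∑ e, X e * psi (G2Deformation.deform stdForm (t • Pi.single 0 1)) e b c d := by
    intro b c d
    rw [← h.covDerivPhi_deform hv h0 hv0, (h.deform hv).covDerivPhi_eq, ← h0, ← hv0]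
  obtain ⟨p0, p1, p2, p3, p4, p5, p6⟩ := psi_deform_stdForm_values hk X
  obtain ⟨q0, q1, q2, q3, q4, q5, q6⟩ :=
    deformCov_connDiff t (torsion φ x) (covDerivVector φ v x) a
  rw [h1] at q0 q1 q2 q3 q4 q5 q6
  have hT : torsion (fun y => G2Deformation.deform (φ y) (v y)) x a n
      = X n * ![(k ^ 2)⁻¹, k, k, k, k, k, k] n := by
    rw [torsion, h0, hv0, (metric_deform_stdForm hk).2]
    simp only [Matrix.diagonal_apply, mul_ite, mul_zero, sum_ite_eq', mem_univ, if_true]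
    rw [hX, h0, hv0]
  rw [hT]
  obtain rfl | rfl | rfl | rfl | rfl | rfl | rfl :
      n = 0 ∨ n = 1 ∨ n = 2 ∨ n = 3 ∨ n = 4 ∨ n = 5 ∨ n = 6 := by omega
  · simp only [Matrix.cons_val]
    field_simp
    have := p0.symm.trans q0
    field_simp at this
    linarith
  · have := p1.symm.trans q1
    simp only [Matrix.cons_val]
    field_simp
    linarith
  · have := p2.symm.trans q2
    simp only [Matrix.cons_val]
    field_simp
    linarith
  · have := p3.symm.trans q3
    simp only [Matrix.cons_val]
    field_simp
    linarith
  · have := p4.symm.trans q4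
    simp only [Matrix.cons_val]
    field_simp
    linarith
  · have := p5.symm.trans q5
    simp only [Matrix.cons_val]
    field_simp
    linarith
  · have := p6.symm.trans q6
    simp only [Matrix.cons_val]
    field_simp
    linarith

end

end IsG2StructureAt

/-! ### The algebra of 2-tensors at the standard form -/

/-- The index `m` for which `stdForm m a b` is nonzero. -/
def third : Fin 7 → Fin 7 → Fin 7 :=
  ![![0, 2, 1, 4, 3, 6, 5],
    ![2, 0, 0, 5, 6, 3, 4],
    ![1, 0, 0, 6, 5, 4, 3],
    ![4, 5, 6, 0, 0, 1, 2],
    ![3, 6, 5, 0, 0, 2, 1],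
    ![6, 3, 4, 1, 2, 0, 0],
    ![5, 4, 3, 2, 1, 0, 0]]

/-- The value of `stdForm (third a b) a b`. -/
def thirdSign : Fin 7 → Fin 7 → ℤ :=
  ![![0, 1, -1, 1, -1, 1, -1],
    ![-1, 0, 1, 1, -1, -1, 1],
    ![1, -1, 0, -1, -1, 1, 1],
    ![-1, -1, 1, 0, 1, 1, -1],
    ![1, 1, 1, -1, 0, -1, -1],
    ![-1, 1, -1, -1, 1, 0, 1],
    ![1, -1, -1, 1, 1, -1, 0]]

/-- The index `m` for which `stdDual m a b 0` is nonzero. -/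
def fourth : Fin 7 → Fin 7 → Fin 7 :=
  ![![0, 0, 0, 0, 0, 0, 0],
    ![0, 0, 0, 6, 5, 4, 3],
    ![0, 0, 0, 5, 6, 3, 4],
    ![0, 6, 5, 0, 0, 2, 1],
    ![0, 5, 6, 0, 0, 1, 2],
    ![0, 4, 3, 2, 1, 0, 0],
    ![0, 3, 4, 1, 2, 0, 0]]

/-- The value of `stdDual (fourth a b) a b 0`. -/
def fourthSign : Fin 7 → Fin 7 → ℤ :=
  ![![0, 0, 0, 0, 0, 0, 0],
    ![0, 0, 0, 1, 1, -1, -1],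
    ![0, 0, 0, 1, -1, -1, 1],
    ![0, -1, -1, 0, 0, 1, 1],
    ![0, -1, 1, 0, 0, 1, -1],
    ![0, 1, 1, -1, -1, 0, 0],
    ![0, 1, -1, -1, 1, 0, 0]]

/-- Two distinct indices lie in exactly one triple of the standard form, so contraction with the
form has a single term. On the diagonal the tables hold a placeholder index with sign `0`. -/
theorem stdZ_eq_ite : ∀ m a b, stdZ m a b = if m = third a b then thirdSign a b else 0 := by
  decide +kernel

theorem stdZ_eq_ite' : ∀ a m b, stdZ a m b = if m = third b a then thirdSign b a else 0 := by
  decide +kernel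

theorem stdDualZ_eq_ite :
    ∀ m a b, stdDualZ m a b 0 = if m = fourth a b then fourthSign a b else 0 := by
  decide +kernel

theorem stdDualZ_eq_ite' :
    ∀ a m b, stdDualZ a m b 0 = if m = fourth b a then fourthSign b a else 0 := by
  decide +kernel

theorem stdDualZ_eq_ite'' :
    ∀ m a b, stdDualZ m 0 a b = if m = fourth a b then fourthSign a b else 0 := by
  decide +kernel

section StandardForm

variable (t : ℝ) (x : Tensor1) (X : Tensor2) (a b c : Fin 7)

theorem flat_stdForm : flat stdForm x = x := by rw [flat_eq, metric_stdForm, one_mulVec]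

theorem sharp_stdForm : sharp stdForm x = x := by rw [sharp_eq, metricInv_stdForm, one_mulVec]

theorem raise2_stdForm : raise2 stdForm X = X := by
  funext a b
  simp [raise2, metricInv_stdForm, Matrix.one_apply]

theorem pair_single : pair x (t • Pi.single 0 1) = t * x 0 := by
  simp [pair, Pi.single_apply, mul_comm]

theorem contract_single : contract (t • Pi.single 0 1) X = fun b => t * X 0 b := by
  funext b
  simp [contract, Pi.single_apply]

theorem phiContr_stdForm : phiContr stdForm x a b = thirdSign a b * x (third a b) := by
  simp [phiContr, stdForm, stdZ_eq_ite, mul_comm]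

theorem phiCross_stdForm :
    phiCross stdForm x (t • Pi.single 0 1) c = t * (thirdSign 0 c * x (third 0 c)) := by
  simp [phiCross, stdForm, stdZ_eq_ite', Pi.single_apply]
  ring

theorem psiContr_stdForm :
    psiContr stdForm x (t • Pi.single 0 1) a b = t * (fourthSign a b * x (fourth a b)) := by
  simp [psiContr, psi_stdForm, stdDual, stdDualZ_eq_ite'', Pi.single_apply]
  ring

theorem phiMul_stdForm :
    phiMul stdForm (t • Pi.single 0 1) X a b = t * (thirdSign a 0 * X (third a 0) b) := by
  simp [phiMul, stdForm, stdZ_eq_ite', Pi.single_apply, metricInv_stdForm, Matrix.one_apply]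
  ring

theorem sum_mul_stdForm_zero (f : Fin 7 → ℝ) :
    ∑ n, stdForm a 0 n * f n = thirdSign a 0 * f (third a 0) := by
  have h : ∀ n, stdZ a 0 n = if n = third a 0 then thirdSign a 0 else 0 := by
    revert a; decide +kernel
  simp [stdForm, h]

theorem phiPhi_stdForm : phiPhi stdForm (t • Pi.single 0 1) X a b
    = t ^ 2 * (thirdSign a 0 * (thirdSign b 0 * X (third a 0) (third b 0))) := by
  have h : phiPhi stdForm (t • Pi.single 0 1) X a b
      = t ^ 2 * ∑ n, stdForm a 0 n * ∑ q, stdForm b 0 q * X n q := by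
    simp [phiPhi, raise2_stdForm, Pi.single_apply, mul_sum]
    exact sum_congr rfl fun _ _ => sum_congr rfl fun _ _ => by ring
  rw [h, sum_mul_stdForm_zero, sum_mul_stdForm_zero]

theorem components_stdForm : components stdForm X =
    let c1 : ℝ := 1 / 7 * ∑ a, X a a
    let c7 : Tensor1 := fun c => 1 / 6 * ∑ a, thirdSign c a * X a (third c a)
    { c1 := c1
      c7 := c7
      c14 := fun a b => (X a b - X b a) / 2 - thirdSign a b * c7 (third a b)
      c27 := fun a b => (X a b + X b a) / 2 - c1 * if a = b then 1 else 0 } := by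
  have h1 : (1 / 7 * ∑ a, ∑ b, metricInv stdForm a b * X a b) = 1 / 7 * ∑ a, X a a := by
    simp [metricInv_stdForm, Matrix.one_apply]
  have h7 : (fun c => 1 / 6 * ∑ a, ∑ b, raise2 stdForm X a b * stdForm a b c)
      = fun c => 1 / 6 * ∑ a, thirdSign c a * X a (third c a) := by
    funext c
    simp [raise2_stdForm, stdForm, stdZ_eq_ite', mul_comm]
  simp only [components, h1, h7, sharp_stdForm, phiContr_stdForm, altPart, symPart, metric_stdForm,
    Matrix.one_apply]

end StandardForm

/-- The components of a 2-tensor with respect to the deformation of the standard form, up to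
factors. -/
def deformComponents (t : ℝ) (Y : Tensor2) : Components :=
  let r := (1 + t ^ 2)⁻¹
  let c1 : ℝ := 1 / 7 * (Y 0 0 + r * ∑ i : Fin 6, Y i.succ i.succ)
  let c7 : Tensor1 := fun c => 1 / 6 * ∑ a, (thirdSign c a *
      ((if a = 0 ∨ third c a = 0 then 1 else r) * Y a (third c a))
    + t * (fourthSign c a * (r * Y a (fourth c a))))
  { c1 := c1
    c7 := c7
    c14 := fun a b => (Y a b - Y b a) / 2
      - thirdSign a b * ((if third a b = 0 then 1 + t ^ 2 else 1) * c7 (third a b))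
      - t * (fourthSign a b * c7 (fourth a b))
    c27 := fun a b => (Y a b + Y b a) / 2
      - c1 * (if a = b then if a = 0 then 1 else 1 + t ^ 2 else 0) }

/-- Where both weights would be exceptional, the index is only a placeholder and its coefficient
vanishes. -/
theorem thirdSign_of_eq_zero : ∀ a b, a = 0 → third b a = 0 → thirdSign b a = 0 := by
  decide

theorem fourthSign_of_eq_zero : ∀ a b, (a = 0 ∨ b = 0 ∨ fourth b a = 0) → fourthSign b a = 0 := by
  decide

/-- Counting powers of `k`: tracing a tensor with factor `k⁻¹` leaves `k`, the vector part has no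
factor, and the parts with two lower indices keep `k⁻¹`. All else depends on `k³ = 1 + t²`, hence
rationally on `t`. -/
theorem components_deform_stdForm {t k : ℝ} (hk : k = (1 + t ^ 2) ^ (1 / 3 : ℝ)) (Y : Tensor2) :
    components (deform stdForm (t • Pi.single 0 1)) (fun a b => k⁻¹ * Y a b) =
      { c1 := k * (deformComponents t Y).c1
        c7 := (deformComponents t Y).c7
        c14 := fun a b => k⁻¹ * (deformComponents t Y).c14 a b
        c27 := fun a b => k⁻¹ * (deformComponents t Y).c27 a b } := by
  obtain ⟨hp, hm⟩ := metric_deform_stdForm hk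
  have hkpos : 0 < k := by rw [hk]; positivity
  have hk3 : k ^ 3 = 1 + t ^ 2 := by rw [hk]; exact cube_rpow_third (by positivity)
  have hinv : metricInv (deform stdForm (t • Pi.single 0 1))
      = Matrix.diagonal fun i => if i = 0 then k ^ 2 else k⁻¹ := by
    rw [metricInv, hm]
    refine Matrix.inv_eq_right_inv ?_
    rw [Matrix.diagonal_mul_diagonal, ← Matrix.diagonal_one]
    congr 1
    funext i
    fin_cases i <;> simp [hkpos.ne']
  have hm' : metric (deform stdForm (t • Pi.single 0 1))
      = Matrix.diagonal fun i => if i = 0 then (k ^ 2)⁻¹ else k := by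
    rw [hm]
    congr 1
    funext i
    fin_cases i <;> simp
  have h1 : (1 / 7 * ∑ a, ∑ b, metricInv (deform stdForm (t • Pi.single 0 1)) a b * (k⁻¹ * Y a b))
      = k * (deformComponents t Y).c1 := by
    rw [hinv]
    simp only [Matrix.diagonal_apply, ite_mul, zero_mul, sum_ite_eq, mem_univ, if_true]
    rw [Fin.sum_univ_succ]
    simp only [if_true, Fin.succ_ne_zero, if_false, deformComponents, ← mul_assoc, ← mul_sum,
      ← hk3]
    field_simp
  have hr : raise2 (deform stdForm (t • Pi.single 0 1)) (fun a b => k⁻¹ * Y a b)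
      = fun a b => (if a = 0 then k ^ 2 else k⁻¹) * (if b = 0 then k ^ 2 else k⁻¹)
        * (k⁻¹ * Y a b) := by
    funext a b
    simp only [raise2, hinv]
    simp [Matrix.diagonal_apply]
  have h7 : (fun c => 1 / 6 * ∑ a, ∑ b, raise2 (deform stdForm (t • Pi.single 0 1))
      (fun a b => k⁻¹ * Y a b) a b * deform stdForm (t • Pi.single 0 1) a b c)
      = (deformComponents t Y).c7 := by
    funext c
    simp only [hr, deform_stdForm, stdForm, stdDual, stdZ_eq_ite', stdDualZ_eq_ite', mul_add,
      sum_add_distrib, deformComponents]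
    simp only [Int.cast_ite, Int.cast_zero, mul_ite, mul_zero, sum_ite_eq', mem_univ, if_true]
    congr 2
    · refine sum_congr rfl fun a _ => ?_
      rw [← hk3]
      by_cases ha : a = 0
      · by_cases hb : third c a = 0
        · rw [thirdSign_of_eq_zero a c ha hb]; simp
        · simp only [if_pos ha, if_neg hb, if_pos (Or.inl ha : a = 0 ∨ third c a = 0)]
          field_simp
      · by_cases hb : third c a = 0
        · simp only [if_neg ha, if_pos hb, if_pos (Or.inr hb : a = 0 ∨ third c a = 0)]
          field_simp
        · simp only [if_neg ha, if_neg hb, if_neg (not_or.2 ⟨ha, hb⟩ : ¬ (a = 0 ∨ third c a = 0))]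
          field_simp
    · refine sum_congr rfl fun a _ => ?_
      rw [← hk3]
      by_cases ha : a = 0 ∨ c = 0 ∨ fourth c a = 0
      · rw [fourthSign_of_eq_zero a c ha]; simp
      · push Not at ha
        simp only [if_neg ha.1, if_neg ha.2.2]
        field_simp
  have hs : ∀ x : Tensor1, sharp (deform stdForm (t • Pi.single 0 1)) x
      = fun i => (if i = 0 then k ^ 2 else k⁻¹) * x i := by
    intro x
    funext i
    simp [sharp, hinv, Matrix.diagonal_apply]
  have hφ : ∀ (x : Tensor1) a b, phiContr (deform stdForm (t • Pi.single 0 1)) x a b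
      = thirdSign a b * x (third a b) + t * (fourthSign a b * x (fourth a b)) := by
    intro x a b
    simp [phiContr, deform_stdForm, stdForm, stdDual, stdZ_eq_ite, stdDualZ_eq_ite, mul_add,
      sum_add_distrib]
    ring
  simp only [components, h1, h7, hs, hφ, hm']
  refine Components.ext rfl rfl ?_ ?_
  · funext a b
    have h4 : (fourthSign a b : ℝ) * (if fourth a b = 0 then k ^ 2 else k⁻¹)
        = fourthSign a b * k⁻¹ := by
      by_cases h : fourth a b = 0
      · rw [fourthSign_of_eq_zero b a (Or.inr (Or.inr h))]; simp
      · rw [if_neg h]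
    have h3 : (if third a b = 0 then k ^ 2 else k⁻¹)
        = k⁻¹ * if third a b = 0 then 1 + t ^ 2 else 1 := by
      rw [← hk3]
      split_ifs
      · field_simp
      · simp
    have e : (deformComponents t Y).c14 a b = (Y a b - Y b a) / 2
      - thirdSign a b * ((if third a b = 0 then 1 + t ^ 2 else 1)
        * (deformComponents t Y).c7 (third a b))
      - t * (fourthSign a b * (deformComponents t Y).c7 (fourth a b)) := rfl
    simp only [altPart]
    rw [h3, e]
    linear_combination -t * (deformComponents t Y).c7 (fourth a b) * h4
  · funext a b
    have e : (deformComponents t Y).c27 a b = (Y a b + Y b a) / 2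
      - (deformComponents t Y).c1 * (if a = b then if a = 0 then 1 else 1 + t ^ 2 else 0) := rfl
    simp only [symPart, Matrix.diagonal_apply]
    rw [e, ← hk3]
    split_ifs
    · field_simp
    · field_simp
    · ring

/-! ### The formulas at the standard form -/

section StandardFormulas

variable {t k : ℝ} (hk : k = (1 + t ^ 2) ^ (1 / 3 : ℝ)) (τ σ : Components) (a b c : Fin 7)

/-- Components with the scaling of `components_deform_stdForm`. -/
def scaleComponents (k : ℝ) (σ : Components) : Components :=
  { c1 := k * σ.c1
    c7 := σ.c7
    c14 := fun a b => k⁻¹ * σ.c14 a b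
    c27 := fun a b => k⁻¹ * σ.c27 a b }

include hk

/-- The explicit powers of `k` in the formula cancel against `scaleComponents`, so the verification
takes place among rational functions of `t`. The same happens in the other three formulas. -/
theorem formula1_stdForm :
    formula1 stdForm (t • Pi.single 0 1) τ (scaleComponents k σ)
      = τ.c1 - 3 / 7 * t * τ.c7 0 - 1 / 7 * (7 + 3 * t ^ 2) * σ.c1 - 3 / 7 * t * σ.c7 0
        + 1 / 14 * t ^ 2 * σ.c27 0 0 := by
  have hkpos : 0 < k := by rw [hk]; positivity
  simp only [formula1, normSq_stdForm, kappa_stdForm, ← hk, pair_single, contract_single,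
    scaleComponents]
  field_simp

theorem formula7_stdForm :
    formula7 stdForm (t • Pi.single 0 1) τ (scaleComponents k σ) c
      = τ.c7 c - σ.c7 c + t * (thirdSign 0 c * (1 / 3 * τ.c7 (third 0 c) - 1 / 2 * σ.c7 (third 0 c))
        - 1 / 6 * τ.c14 0 c - 1 / 3 * τ.c27 0 c + 1 / 6 * σ.c27 0 c)
        + t * (4 / 3 * σ.c1 - 1 / 3 * τ.c1) * if c = 0 then 1 else 0 := by
  have hkpos : 0 < k := by rw [hk]; positivity
  simp only [formula7, kappa_stdForm, ← hk, contract_single, flat_stdForm, sharp_stdForm,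
    phiCross_stdForm, scaleComponents, Pi.smul_apply, Pi.single_apply, smul_eq_mul]
  field_simp
  ring

/-- The coefficient of `v♭` in the formula for the component in `Λ²₁₄`. -/
def formula14Flat (t : ℝ) (τ σ : Components) : Tensor1 := fun c =>
  4 / 3 * (t ^ 2 - 27) * τ.c7 c - 2 * (t ^ 2 - 15) * σ.c7 c
    + t * ((t ^ 2 - 7) * τ.c14 0 c + 16 * τ.c27 0 c + 16 * σ.c14 0 c - 16 * σ.c27 0 c)
    + 8 * t * thirdSign 0 c * (3 * σ.c7 (third 0 c) - 3 * τ.c7 (third 0 c)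
      + t * (τ.c27 0 (third 0 c) - τ.c14 0 (third 0 c) + σ.c14 0 (third 0 c)
        - σ.c27 0 (third 0 c)))

/-- The vector contracted with the 3-form in the formula for the component in `Λ²₁₄`. -/
def formula14Phi (t : ℝ) (τ σ : Components) : Tensor1 := fun c =>
  4 * t ^ 2 * (σ.c7 c - τ.c7 c) + t * (4 / 3 * t ^ 2 * (τ.c27 0 c - τ.c14 0 c)
      + (t ^ 2 - 3) * σ.c14 0 c - 1 / 6 * (7 * t ^ 2 - 9) * σ.c27 0 c)
    + t ^ 2 * (4 * τ.c7 0 - 4 * σ.c7 0 - 4 / 3 * t * τ.c27 0 0 + 1 / 6 * (t ^ 2 + 17) * t * σ.c27 0 0)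
      * if c = 0 then 1 else 0

/-- The vector contracted with the 4-form in the formula for the component in `Λ²₁₄`. -/
def formula14Psi (t : ℝ) (τ σ : Components) : Tensor1 := fun c =>
  1 / 2 * (t ^ 2 - 15) * σ.c7 c - 1 / 3 * (t ^ 2 - 27) * τ.c7 c
    + 4 * t * (τ.c14 0 c - τ.c27 0 c - σ.c14 0 c + σ.c27 0 c)

theorem formula14_stdForm :
    formula14 stdForm (t • Pi.single 0 1) τ (scaleComponents k σ) a b
      = (t ^ 2 + 9)⁻¹ * (t / 2 * (formula14Flat t τ σ a * (if b = 0 then 1 else 0)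
            - formula14Flat t τ σ b * if a = 0 then 1 else 0)
          + thirdSign a b * formula14Phi t τ σ (third a b)
          + t * (fourthSign a b * formula14Psi t τ σ (fourth a b)))
        + (1 / 2 * (t ^ 2 + 2) * τ.c14 a b
          + 1 / 2 * t ^ 2 * (thirdSign a 0 * (thirdSign b 0 * τ.c14 (third a 0) (third b 0)))
          - σ.c14 a b - t / 2 * (thirdSign a 0 * σ.c27 (third a 0) b
            - thirdSign b 0 * σ.c27 (third b 0) a)) := by
  have hkpos : 0 < k := by rw [hk]; positivity
  have hM : t ^ 2 + 9 ≠ 0 := by positivity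
  simp only [formula14, normSq_stdForm, kappa_stdForm, ← hk, pair_single, contract_single,
    flat_stdForm, sharp_stdForm, phiCross_stdForm, phiContr_stdForm, psiContr_stdForm,
    phiMul_stdForm, phiPhi_stdForm, altPart, outer, scaleComponents, formula14Flat, formula14Phi,
    formula14Psi, Pi.smul_apply, Pi.single_apply, smul_eq_mul]
  generalize (if a = 0 then (1 : ℝ) else 0) = pa
  generalize (if b = 0 then (1 : ℝ) else 0) = pb
  generalize (if third a b = 0 then (1 : ℝ) else 0) = pc
  field_simp
  ring

theorem formula27_stdForm :
    formula27 stdForm (t • Pi.single 0 1) τ (scaleComponents k σ) a b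
      = τ.c27 a b
        + (4 * σ.c1 - 1 / 2 * (1 + t ^ 2)⁻¹ * t ^ 2 * σ.c27 0 0) * t ^ 2
          * ((if a = 0 then 1 else 0) * if b = 0 then 1 else 0)
        - 1 / 7 * (4 * t * τ.c7 0 - 3 * t * σ.c7 0 + 4 * t ^ 2 * σ.c1 + 1 / 2 * t ^ 2 * σ.c27 0 0)
          * (if a = b then 1 else 0)
        + t / 2 * ((4 * τ.c7 a - 3 * σ.c7 a) * (if b = 0 then 1 else 0)
          + (4 * τ.c7 b - 3 * σ.c7 b) * if a = 0 then 1 else 0)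
        - t / 2 * (thirdSign a 0 * τ.c14 (third a 0) b + thirdSign b 0 * τ.c14 (third b 0) a)
        - (1 + t ^ 2)⁻¹ * (1 / 2 * t ^ 2 *
            (thirdSign a 0 * (thirdSign b 0 * σ.c27 (third a 0) (third b 0)))
          + 1 / 2 * (2 + t ^ 2) * σ.c27 a b
          + t ^ 2 / 2 * ((σ.c27 0 a + t * (thirdSign 0 a * σ.c27 0 (third 0 a)))
              * (if b = 0 then 1 else 0)
            + (σ.c27 0 b + t * (thirdSign 0 b * σ.c27 0 (third 0 b))) * if a = 0 then 1 else 0)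
          - t / 2 * (thirdSign a 0 * σ.c27 (third a 0) b + thirdSign b 0 * σ.c27 (third b 0) a)) := by
  have hkpos : 0 < k := by rw [hk]; positivity
  have hk3 : k ^ 3 = 1 + t ^ 2 := by rw [hk]; exact cube_rpow_third (by positivity)
  simp only [formula27, normSq_stdForm, kappa_stdForm, ← hk, pair_single, contract_single,
    flat_stdForm, sharp_stdForm, phiCross_stdForm, metric_stdForm, Matrix.one_apply,
    phiMul_stdForm, phiPhi_stdForm, symPart, outer, scaleComponents, Pi.smul_apply,
    Pi.single_apply, smul_eq_mul]
  rw [← hk3]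
  generalize (if a = 0 then (1 : ℝ) else 0) = pa
  generalize (if b = 0 then (1 : ℝ) else 0) = pb
  generalize (if a = b then (1 : ℝ) else 0) = pc
  field_simp
  ring

end StandardFormulas

/-! ### The formulas for the torsion of the deformed form at the standard form -/

/-- The vector parts enter all later checks, so they are tabulated once, here for the standard form
and next for the deformed one. -/
theorem components_stdForm_c7 (T : Tensor2) : (components stdForm T).c7 =
    ![1 / 6 * (T 1 2 - T 2 1 + T 3 4 - T 4 3 + T 5 6 - T 6 5),
      -1 / 6 * (T 0 2 - T 2 0 - T 3 5 + T 4 6 + T 5 3 - T 6 4),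
      1 / 6 * (T 0 1 - T 1 0 - T 3 6 - T 4 5 + T 5 4 + T 6 3),
      -1 / 6 * (T 0 4 + T 1 5 - T 2 6 - T 4 0 - T 5 1 + T 6 2),
      1 / 6 * (T 0 3 + T 1 6 + T 2 5 - T 3 0 - T 5 2 - T 6 1),
      -1 / 6 * (T 0 6 - T 1 3 + T 2 4 + T 3 1 - T 4 2 - T 6 0),
      1 / 6 * (T 0 5 - T 1 4 - T 2 3 + T 3 2 + T 4 1 - T 5 0)] := by
  funext c
  rw [components_stdForm]
  obtain rfl | rfl | rfl | rfl | rfl | rfl | rfl :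
      c = 0 ∨ c = 1 ∨ c = 2 ∨ c = 3 ∨ c = 4 ∨ c = 5 ∨ c = 6 := by omega
  all_goals
    simp [Fin.sum_univ_seven, third, thirdSign]
    ring

set_option maxHeartbeats 1000000 in
theorem deformComponents_c7 (t : ℝ) (T W : Tensor2) :
    (deformComponents t (stdTorsion t T W)).c7 =
    let r := (1 + t ^ 2)⁻¹
    ![1 / 6 * t * r * (T 1 1 + T 2 2 + T 3 3 + T 4 4 + T 5 5 + T 6 6 - W 1 1 - W 2 2 - W 3 3 - W 4 4
        - W 5 5 - W 6 6) + 1 / 6 * r * (T 1 2 - T 2 1 + T 3 4 - T 4 3 + T 5 6 - T 6 5 - W 1 2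
        + W 2 1 - W 3 4 + W 4 3 - W 5 6 + W 6 5) - 1 / 3 * t * r * W 0 0,
      -1 / 6 * t * T 0 1 - 1 / 6 * (T 0 2 - T 2 0 - T 3 5 + T 4 6 + T 5 3 - T 6 4 - W 0 2)
        - 1 / 6 * t * r * W 1 0 - 1 / 6 * r * W 2 0 - (1 / 12 * r + 1 / 12) * (W 3 5 - W 4 6
        - W 5 3 + W 6 4) - 1 / 12 * t * r * (W 3 6 + W 4 5 - W 5 4 - W 6 3),
      1 / 6 * (T 0 1 - T 1 0 - T 3 6 - T 4 5 + T 5 4 + T 6 3 - W 0 1) - 1 / 6 * t * T 0 2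
        + 1 / 6 * r * W 1 0 - 1 / 6 * t * r * W 2 0 - 1 / 12 * t * r * (W 3 5 - W 4 6 - W 5 3
        + W 6 4) + (1 / 12 * r + 1 / 12) * (W 3 6 + W 4 5 - W 5 4 - W 6 3),
      -1 / 6 * t * T 0 3 - 1 / 6 * (T 0 4 + T 1 5 - T 2 6 - T 4 0 - T 5 1 + T 6 2 - W 0 4)
        + (1 / 12 * r + 1 / 12) * (W 1 5 - W 2 6 - W 5 1 + W 6 2) + 1 / 12 * t * r * (W 1 6
        + W 2 5 - W 5 2 - W 6 1) - 1 / 6 * t * r * W 3 0 - 1 / 6 * r * W 4 0,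
      1 / 6 * (T 0 3 + T 1 6 + T 2 5 - T 3 0 - T 5 2 - T 6 1 - W 0 3) - 1 / 6 * t * T 0 4
        + 1 / 12 * t * r * (W 1 5 - W 2 6 - W 5 1 + W 6 2) - (1 / 12 * r + 1 / 12) * (W 1 6
        + W 2 5 - W 5 2 - W 6 1) + 1 / 6 * r * W 3 0 - 1 / 6 * t * r * W 4 0,
      -1 / 6 * t * T 0 5 - 1 / 6 * (T 0 6 - T 1 3 + T 2 4 + T 3 1 - T 4 2 - T 6 0 - W 0 6)
        - (1 / 12 * r + 1 / 12) * (W 1 3 - W 2 4 - W 3 1 + W 4 2) - 1 / 12 * t * r * (W 1 4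
        + W 2 3 - W 3 2 - W 4 1) - 1 / 6 * t * r * W 5 0 - 1 / 6 * r * W 6 0,
      1 / 6 * (T 0 5 - T 1 4 - T 2 3 + T 3 2 + T 4 1 - T 5 0 - W 0 5) - 1 / 6 * t * T 0 6
        - 1 / 12 * t * r * (W 1 3 - W 2 4 - W 3 1 + W 4 2) + (1 / 12 * r + 1 / 12) * (W 1 4
        + W 2 3 - W 3 2 - W 4 1) + 1 / 6 * r * W 5 0 - 1 / 6 * t * r * W 6 0] := by
  funext c
  obtain rfl | rfl | rfl | rfl | rfl | rfl | rfl :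
      c = 0 ∨ c = 1 ∨ c = 2 ∨ c = 3 ∨ c = 4 ∨ c = 5 ∨ c = 6 := by omega
  all_goals
    simp [deformComponents, stdTorsion, Fin.sum_univ_seven, third, thirdSign, fourth, fourthSign]
    field_simp
    ring

theorem deformComponents_c1 (t : ℝ) (T W : Tensor2) :
    (deformComponents t (stdTorsion t T W)).c1 =
    let r := (1 + t ^ 2)⁻¹
    1 / 7 * T 0 0 + 1 / 7 * r * (T 1 1 + T 2 2 + T 3 3 + T 4 4 + T 5 5 + T 6 6 - W 0 0 - W 1 1
      - W 2 2 - W 3 3 - W 4 4 - W 5 5 - W 6 6) - 1 / 7 * t * r * (T 1 2 - T 2 1 + T 3 4 - T 4 3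
      + T 5 6 - T 6 5) + 1 / 14 * t * r * (W 1 2 - W 2 1 + W 3 4 - W 4 3 + W 5 6 - W 6 5) := by
  simp [deformComponents, stdTorsion, Fin.sum_univ_six]
  field_simp
  ring

theorem deformComponents_c14 (t : ℝ) (Y : Tensor2) (a b : Fin 7) :
    (deformComponents t Y).c14 a b = (Y a b - Y b a) / 2
      - thirdSign a b * ((if third a b = 0 then 1 + t ^ 2 else 1)
        * (deformComponents t Y).c7 (third a b))
      - t * (fourthSign a b * (deformComponents t Y).c7 (fourth a b)) := rfl

theorem deformComponents_c27 (t : ℝ) (Y : Tensor2) (a b : Fin 7) :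
    (deformComponents t Y).c27 a b = (Y a b + Y b a) / 2
      - (deformComponents t Y).c1 * (if a = b then if a = 0 then 1 else 1 + t ^ 2 else 0) := rfl

theorem components_stdForm_c1 (T : Tensor2) : (components stdForm T).c1 = 1 / 7 * ∑ a, T a a := by
  rw [components_stdForm]

theorem components_stdForm_c14 (T : Tensor2) (a b : Fin 7) : (components stdForm T).c14 a b
    = (T a b - T b a) / 2 - thirdSign a b * (components stdForm T).c7 (third a b) := by
  simp only [components_stdForm]

theorem components_stdForm_c27 (T : Tensor2) (a b : Fin 7) : (components stdForm T).c27 a b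
    = (T a b + T b a) / 2 - (components stdForm T).c1 * if a = b then 1 else 0 := by
  simp only [components_stdForm]

/-- Rewrites entries only: the unapplied `stdTorsion t T W` inside `deformComponents` stays folded
and still matches the tables of its parts. -/
theorem stdTorsion_apply (t : ℝ) (T W : Tensor2) (a b : Fin 7) : stdTorsion t T W a b = (
  let r := (1 + t ^ 2)⁻¹
  ![![T 0 0 - r * W 0 0 + 1 / 2 * t * r * (W 1 2 - W 2 1 + W 3 4 - W 4 3 + W 5 6 - W 6 5),
      T 0 1 - W 0 1 - t * T 0 2 + 2 / 3 * t * r * W 2 0 + 1 / 2 * t * r * (W 3 5 - W 4 6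
        - W 5 3 + W 6 4) + 1 / 2 * (1 - r) * (W 3 6 + W 4 5 - W 5 4 - W 6 3),
      t * T 0 1 + T 0 2 - W 0 2 - 2 / 3 * t * r * W 1 0 + 1 / 2 * (1 - r) * (W 3 5 - W 4 6
        - W 5 3 + W 6 4) - 1 / 2 * t * r * (W 3 6 + W 4 5 - W 5 4 - W 6 3),
      T 0 3 - W 0 3 - t * T 0 4 - 1 / 2 * t * r * (W 1 5 - W 2 6 - W 5 1 + W 6 2) - 1 / 2 * (1
        - r) * (W 1 6 + W 2 5 - W 5 2 - W 6 1) + 2 / 3 * t * r * W 4 0,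
      t * T 0 3 + T 0 4 - W 0 4 - 1 / 2 * (1 - r) * (W 1 5 - W 2 6 - W 5 1 + W 6 2)
        + 1 / 2 * t * r * (W 1 6 + W 2 5 - W 5 2 - W 6 1) - 2 / 3 * t * r * W 3 0,
      T 0 5 - W 0 5 - t * T 0 6 + 1 / 2 * t * r * (W 1 3 - W 2 4 - W 3 1 + W 4 2) + 1 / 2 * (1
        - r) * (W 1 4 + W 2 3 - W 3 2 - W 4 1) + 2 / 3 * t * r * W 6 0,
      t * T 0 5 + T 0 6 - W 0 6 + 1 / 2 * (1 - r) * (W 1 3 - W 2 4 - W 3 1 + W 4 2)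
        - 1 / 2 * t * r * (W 1 4 + W 2 3 - W 3 2 - W 4 1) - 2 / 3 * t * r * W 5 0],
    ![T 1 0 - r * W 1 0 + 1 / 3 * t * r * W 2 0,
      T 1 1 - W 1 1 - t * T 1 2 + 1 / 2 * t * (W 1 2 + W 2 1),
      t * (T 1 1 - W 1 1) + T 1 2 - W 1 2 - 1 / 3 * t * W 0 0,
      T 1 3 - W 1 3 - t * T 1 4 + 1 / 2 * t * (W 1 4 + W 4 1) - 1 / 3 * t * r * W 5 0
        - 1 / 3 * (1 - r) * W 6 0,
      t * T 1 3 + T 1 4 - W 1 4 - 1 / 2 * t * (W 1 3 + W 3 1) - 1 / 3 * (1 - r) * W 5 0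
        + 1 / 3 * t * r * W 6 0,
      T 1 5 - W 1 5 - t * T 1 6 + 1 / 2 * t * (W 1 6 + W 6 1) + 1 / 3 * t * r * W 3 0
        + 1 / 3 * (1 - r) * W 4 0,
      t * T 1 5 + T 1 6 - W 1 6 - 1 / 2 * t * (W 1 5 + W 5 1) + 1 / 3 * (1 - r) * W 3 0
        - 1 / 3 * t * r * W 4 0],
    ![T 2 0 - 1 / 3 * t * r * W 1 0 - r * W 2 0,
      T 2 1 - W 2 1 - t * (T 2 2 - W 2 2) + 1 / 3 * t * W 0 0,
      t * T 2 1 + T 2 2 - W 2 2 - 1 / 2 * t * (W 1 2 + W 2 1),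
      T 2 3 - W 2 3 - t * T 2 4 + 1 / 2 * t * (W 2 4 + W 4 2) - 1 / 3 * (1 - r) * W 5 0
        + 1 / 3 * t * r * W 6 0,
      t * T 2 3 + T 2 4 - W 2 4 - 1 / 2 * t * (W 2 3 + W 3 2) + 1 / 3 * t * r * W 5 0
        + 1 / 3 * (1 - r) * W 6 0,
      T 2 5 - W 2 5 - t * T 2 6 + 1 / 2 * t * (W 2 6 + W 6 2) + 1 / 3 * (1 - r) * W 3 0
        - 1 / 3 * t * r * W 4 0,
      t * T 2 5 + T 2 6 - W 2 6 - 1 / 2 * t * (W 2 5 + W 5 2) - 1 / 3 * t * r * W 3 0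
        - 1 / 3 * (1 - r) * W 4 0],
    ![T 3 0 - r * W 3 0 + 1 / 3 * t * r * W 4 0,
      T 3 1 - W 3 1 - t * T 3 2 + 1 / 2 * t * (W 2 3 + W 3 2) + 1 / 3 * t * r * W 5 0
        + 1 / 3 * (1 - r) * W 6 0,
      t * T 3 1 + T 3 2 - W 3 2 - 1 / 2 * t * (W 1 3 + W 3 1) + 1 / 3 * (1 - r) * W 5 0
        - 1 / 3 * t * r * W 6 0,
      T 3 3 - W 3 3 - t * T 3 4 + 1 / 2 * t * (W 3 4 + W 4 3),
      t * (T 3 3 - W 3 3) + T 3 4 - W 3 4 - 1 / 3 * t * W 0 0,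
      T 3 5 - W 3 5 - t * T 3 6 - 1 / 3 * t * r * W 1 0 - 1 / 3 * (1 - r) * W 2 0
        + 1 / 2 * t * (W 3 6 + W 6 3),
      t * T 3 5 + T 3 6 - W 3 6 - 1 / 3 * (1 - r) * W 1 0 + 1 / 3 * t * r * W 2 0
        - 1 / 2 * t * (W 3 5 + W 5 3)],
    ![T 4 0 - 1 / 3 * t * r * W 3 0 - r * W 4 0,
      T 4 1 - W 4 1 - t * T 4 2 + 1 / 2 * t * (W 2 4 + W 4 2) + 1 / 3 * (1 - r) * W 5 0
        - 1 / 3 * t * r * W 6 0,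
      t * T 4 1 + T 4 2 - W 4 2 - 1 / 2 * t * (W 1 4 + W 4 1) - 1 / 3 * t * r * W 5 0
        - 1 / 3 * (1 - r) * W 6 0,
      T 4 3 - W 4 3 - t * (T 4 4 - W 4 4) + 1 / 3 * t * W 0 0,
      t * T 4 3 + T 4 4 - W 4 4 - 1 / 2 * t * (W 3 4 + W 4 3),
      T 4 5 - W 4 5 - t * T 4 6 - 1 / 3 * (1 - r) * W 1 0 + 1 / 3 * t * r * W 2 0
        + 1 / 2 * t * (W 4 6 + W 6 4),
      t * T 4 5 + T 4 6 - W 4 6 + 1 / 3 * t * r * W 1 0 + 1 / 3 * (1 - r) * W 2 0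
        - 1 / 2 * t * (W 4 5 + W 5 4)],
    ![T 5 0 - r * W 5 0 + 1 / 3 * t * r * W 6 0,
      T 5 1 - W 5 1 - t * T 5 2 + 1 / 2 * t * (W 2 5 + W 5 2) - 1 / 3 * t * r * W 3 0
        - 1 / 3 * (1 - r) * W 4 0,
      t * T 5 1 + T 5 2 - W 5 2 - 1 / 2 * t * (W 1 5 + W 5 1) - 1 / 3 * (1 - r) * W 3 0
        + 1 / 3 * t * r * W 4 0,
      T 5 3 - W 5 3 - t * T 5 4 + 1 / 3 * t * r * W 1 0 + 1 / 3 * (1 - r) * W 2 0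
        + 1 / 2 * t * (W 4 5 + W 5 4),
      t * T 5 3 + T 5 4 - W 5 4 + 1 / 3 * (1 - r) * W 1 0 - 1 / 3 * t * r * W 2 0
        - 1 / 2 * t * (W 3 5 + W 5 3),
      T 5 5 - W 5 5 - t * T 5 6 + 1 / 2 * t * (W 5 6 + W 6 5),
      t * (T 5 5 - W 5 5) + T 5 6 - W 5 6 - 1 / 3 * t * W 0 0],
    ![T 6 0 - 1 / 3 * t * r * W 5 0 - r * W 6 0,
      T 6 1 - W 6 1 - t * T 6 2 + 1 / 2 * t * (W 2 6 + W 6 2) - 1 / 3 * (1 - r) * W 3 0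
        + 1 / 3 * t * r * W 4 0,
      t * T 6 1 + T 6 2 - W 6 2 - 1 / 2 * t * (W 1 6 + W 6 1) + 1 / 3 * t * r * W 3 0
        + 1 / 3 * (1 - r) * W 4 0,
      T 6 3 - W 6 3 - t * T 6 4 + 1 / 3 * (1 - r) * W 1 0 - 1 / 3 * t * r * W 2 0
        + 1 / 2 * t * (W 4 6 + W 6 4),
      t * T 6 3 + T 6 4 - W 6 4 - 1 / 3 * t * r * W 1 0 - 1 / 3 * (1 - r) * W 2 0
        - 1 / 2 * t * (W 3 6 + W 6 3),
      T 6 5 - W 6 5 - t * (T 6 6 - W 6 6) + 1 / 3 * t * W 0 0,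
      t * T 6 5 + T 6 6 - W 6 6 - 1 / 2 * t * (W 5 6 + W 6 5)]] : Tensor2) a b := rfl

/-! ### Equivariance of the decomposition and of the formulas -/

section Equivariance

variable {P : Matrix (Fin 7) (Fin 7) ℝ}

theorem pull2_apply (P : Matrix (Fin 7) (Fin 7) ℝ) (W : Tensor2) (a b : Fin 7) :
    pull2 P W a b = (Pᵀ * Matrix.of W * P) a b :=
  congrFun (congrFun (pull2_eq P W) a) b

theorem pull2_add (P : Matrix (Fin 7) (Fin 7) ℝ) (X Y : Tensor2) (a b : Fin 7) :
    pull2 P (fun i j => X i j + Y i j) a b = pull2 P X a b + pull2 P Y a b := by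
  simp only [pull2, pull1, mul_add, sum_add_distrib]

theorem pull2_sub (P : Matrix (Fin 7) (Fin 7) ℝ) (X Y : Tensor2) (a b : Fin 7) :
    pull2 P (fun i j => X i j - Y i j) a b = pull2 P X a b - pull2 P Y a b := by
  simp only [pull2, pull1, mul_sub, sum_sub_distrib]

theorem pull2_const_mul (P : Matrix (Fin 7) (Fin 7) ℝ) (r : ℝ) (X : Tensor2) (a b : Fin 7) :
    pull2 P (fun i j => r * X i j) a b = r * pull2 P X a b := by
  simp only [pull2, pull1, mul_sum]
  exact sum_congr rfl fun _ _ => sum_congr rfl fun _ _ => by ring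

theorem pull2_div_const (P : Matrix (Fin 7) (Fin 7) ℝ) (r : ℝ) (X : Tensor2) (a b : Fin 7) :
    pull2 P (fun i j => X i j / r) a b = pull2 P X a b / r := by
  simp only [div_eq_inv_mul, pull2_const_mul]

theorem pull2_swap (P : Matrix (Fin 7) (Fin 7) ℝ) (X : Tensor2) (a b : Fin 7) :
    pull2 P (fun i j => X j i) a b = pull2 P X b a := by
  simp only [pull2, pull1, mul_sum]
  rw [sum_comm]
  exact sum_congr rfl fun _ _ => sum_congr rfl fun _ _ => by ring

theorem pull2_mul_apply (P : Matrix (Fin 7) (Fin 7) ℝ) (α β : Tensor1) (a b : Fin 7) :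
    pull2 P (fun i j => α i * β j) a b = pull1 P α a * pull1 P β b := by
  simp only [pull2, pull1, sum_mul, mul_sum]
  rw [sum_comm]
  exact sum_congr rfl fun _ _ => sum_congr rfl fun _ _ => by ring

theorem pull1_add (P : Matrix (Fin 7) (Fin 7) ℝ) (X Y : Tensor1) (a : Fin 7) :
    pull1 P (fun i => X i + Y i) a = pull1 P X a + pull1 P Y a := by
  simp only [pull1, mul_add, sum_add_distrib]

theorem pull1_sub (P : Matrix (Fin 7) (Fin 7) ℝ) (X Y : Tensor1) (a : Fin 7) :
    pull1 P (fun i => X i - Y i) a = pull1 P X a - pull1 P Y a := by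
  simp only [pull1, mul_sub, sum_sub_distrib]

theorem pull1_const_mul (P : Matrix (Fin 7) (Fin 7) ℝ) (r : ℝ) (X : Tensor1) (a : Fin 7) :
    pull1 P (fun i => r * X i) a = r * pull1 P X a := by
  simp only [pull1, mul_sum]
  exact sum_congr rfl fun _ _ => by ring

theorem altPart_pull2 (P : Matrix (Fin 7) (Fin 7) ℝ) (W : Tensor2) :
    altPart (pull2 P W) = pull2 P (altPart W) := by
  funext a b
  rw [show altPart W = fun i j => (W i j - (fun i j => W j i) i j) / 2 from rfl]
  rw [pull2_div_const P 2 (fun i j => W i j - (fun i j => W j i) i j), pull2_sub, pull2_swap P W]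
  rfl

theorem symPart_pull2 (P : Matrix (Fin 7) (Fin 7) ℝ) (W : Tensor2) :
    symPart (pull2 P W) = pull2 P (symPart W) := by
  funext a b
  rw [show symPart W = fun i j => (W i j + (fun i j => W j i) i j) / 2 from rfl]
  rw [pull2_div_const P 2 (fun i j => W i j + (fun i j => W j i) i j), pull2_add, pull2_swap P W]
  rfl

theorem outer_pull1 (P : Matrix (Fin 7) (Fin 7) ℝ) (α β : Tensor1) :
    outer (pull1 P α) (pull1 P β) = pull2 P (outer α β) := by
  funext a b
  exact (pull2_mul_apply P α β a b).symm

theorem contract_pull2 (P : Matrix (Fin 7) (Fin 7) ℝ) (x : Tensor1) (W : Tensor2) :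
    contract x (pull2 P W) = pull1 P (contract (P *ᵥ x) W) :=
  funext fun b => sum_mul_pull2 P x W b

theorem phiContr_pull3 (P : Matrix (Fin 7) (Fin 7) ℝ) (φ : Tensor3) (x : Tensor1) :
    phiContr (pull3 P φ) x = pull2 P (phiContr φ (P *ᵥ x)) :=
  funext fun b => funext fun c => sum_mul_pull3 P x φ b c

theorem psiContr_pull3 (hP : P.det ≠ 0) (φ : Tensor3) (x y : Tensor1) :
    psiContr (pull3 P φ) x y = pull2 P (psiContr φ (P *ᵥ x) (P *ᵥ y)) := by
  have h : ∀ (χ : Tensor4) (x y : Tensor1) (a b : Fin 7),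
      ∑ m, ∑ n, χ m n a b * x m * y n = ∑ n, y n * ∑ m, x m * χ m n a b := fun χ x y a b => by
    rw [sum_comm]
    simp only [mul_sum]
    exact sum_congr rfl fun _ _ => sum_congr rfl fun _ _ => by ring
  funext a b
  have e : psiContr φ (P *ᵥ x) (P *ᵥ y)
      = fun a b => ∑ n, (P *ᵥ y) n * ∑ m, (P *ᵥ x) m * psi φ m n a b :=
    funext fun a => funext fun b => h _ _ _ _ _
  rw [psiContr, psi_pull3 hP, h, e]
  simp only [sum_mul_pull4]
  exact sum_mul_pull3 P y (fun j k l => ∑ i, (P *ᵥ x) i * psi φ i j k l) a b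

theorem phiCross_pull3 (P : Matrix (Fin 7) (Fin 7) ℝ) (φ : Tensor3) (x y : Tensor1) :
    phiCross (pull3 P φ) x y = pull1 P (phiCross φ (P *ᵥ x) (P *ᵥ y)) := by
  have h : ∀ (χ : Tensor3) (x y : Tensor1) (c : Fin 7),
      ∑ m, ∑ n, χ c m n * x m * y n = ∑ m, x m * ∑ n, y n * χ c m n := fun χ x y c => by
    simp only [mul_sum]
    exact sum_congr rfl fun _ _ => sum_congr rfl fun _ _ => by ring
  funext c
  have e : phiCross φ (P *ᵥ x) (P *ᵥ y) = fun c => ∑ m, (P *ᵥ x) m * ∑ n, (P *ᵥ y) n * φ c m n :=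
    funext fun c => h _ _ _ _
  rw [phiCross, h, e]
  simp only [sum_mul_pull3_last]
  exact sum_mul_pull2_last P x (fun i j => ∑ k, (P *ᵥ y) k * φ i j k) c

theorem raise2_eq (φ : Tensor3) (W : Tensor2) : raise2 φ W = pull2 (metricInv φ)ᵀ W := by
  funext a b
  simp only [raise2, pull2, pull1, transpose_apply, mul_sum, mul_assoc]

theorem raise2_pull3 (hP : P.det ≠ 0) (φ : Tensor3) (W : Tensor2) :
    raise2 (pull3 P φ) (pull2 P W) = pull2 P⁻¹ᵀ (raise2 φ W) := by
  have hu : IsUnit P.det := hP.isUnit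
  rw [raise2_eq, raise2_eq, pull2_pull2, pull2_pull2, metricInv_pull3 hP]
  congr 1
  simp only [transpose_mul, transpose_transpose]
  rw [← Matrix.mul_assoc, Matrix.mul_nonsing_inv _ hu, Matrix.one_mul]

theorem metricInv_pull3_apply (hP : P.det ≠ 0) (φ : Tensor3) (a b : Fin 7) :
    metricInv (pull3 P φ) a b = pull2 P⁻¹ᵀ (fun i j => metricInv φ i j) a b := by
  rw [metricInv_pull3 hP, pull2_matrix, transpose_transpose]

theorem sum_pull2_mul_pull2 (hP : P.det ≠ 0) (R W : Tensor2) :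
    ∑ a, ∑ b, pull2 P⁻¹ᵀ R a b * pull2 P W a b = ∑ a, ∑ b, R a b * W a b := by
  have hu : IsUnit P.det := hP.isUnit
  have h : ∀ X Y : Matrix (Fin 7) (Fin 7) ℝ, ∑ a, ∑ b, X a b * Y a b = (Xᵀ * Y).trace := by
    intro X Y
    rw [sum_comm]
    rfl
  have h1 : P * P⁻¹ = 1 := Matrix.mul_nonsing_inv _ hu
  have h2 : P⁻¹ᵀ * Pᵀ = 1 := by rw [← transpose_mul, h1, transpose_one]
  simp only [pull2_apply]
  rw [h]
  refine Eq.trans ?_ (h (Matrix.of R) (Matrix.of W)).symm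
  simp only [transpose_mul, transpose_transpose, Matrix.mul_assoc]
  rw [← Matrix.mul_assoc P⁻¹ᵀ, h2, Matrix.one_mul, Matrix.trace_mul_comm]
  simp only [Matrix.mul_assoc, h1, Matrix.mul_one]

/-- As a matrix product the contraction transforms by cancelling `P` with its inverse; `phiPhi_eq`
serves the same purpose. -/
theorem phiMul_eq (φ : Tensor3) (x : Tensor1) (W : Tensor2) (a b : Fin 7) :
    phiMul φ x W a b = ((Matrix.of (phiContr φ x))ᵀ * metricInv φ * Matrix.of W) a b := by
  simp only [phiMul, Matrix.mul_apply, transpose_apply, of_apply, phiContr, sum_mul]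
  rw [sum_comm]
  refine (sum_congr rfl fun n _ => sum_comm).trans ?_
  rw [sum_comm]

theorem phiMul_pull3 (hP : P.det ≠ 0) (φ : Tensor3) (x : Tensor1) (W : Tensor2) :
    phiMul (pull3 P φ) x (pull2 P W) = pull2 P (phiMul φ (P *ᵥ x) W) := by
  have hu : IsUnit P.det := hP.isUnit
  have h1 : P * P⁻¹ = 1 := Matrix.mul_nonsing_inv _ hu
  have h2 : P⁻¹ᵀ * Pᵀ = 1 := by rw [← transpose_mul, h1, transpose_one]
  have e : phiMul φ (P *ᵥ x) W = fun a b =>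
      ((Matrix.of (phiContr φ (P *ᵥ x)))ᵀ * metricInv φ * Matrix.of W) a b :=
    funext fun a => funext fun b => phiMul_eq _ _ _ _ _
  funext a b
  rw [phiMul_eq, e, pull2_matrix, phiContr_pull3, pull2_eq, pull2_eq, metricInv_pull3 hP]
  simp only [transpose_mul, transpose_transpose, Matrix.mul_assoc]
  rw [← Matrix.mul_assoc P P⁻¹, h1, Matrix.one_mul, ← Matrix.mul_assoc P⁻¹ᵀ, h2, Matrix.one_mul]

theorem phiPhi_eq (φ : Tensor3) (x : Tensor1) (W : Tensor2) (a b : Fin 7) :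
    phiPhi φ x W a b = ((Matrix.of fun i j => ∑ m, x m * φ i m j) * Matrix.of (raise2 φ W) *
      (Matrix.of fun i j => ∑ m, x m * φ i m j)ᵀ) a b := by
  simp only [phiPhi, Matrix.mul_apply, transpose_apply, of_apply, sum_mul, mul_sum]
  rw [sum_comm]
  refine (sum_congr rfl fun n _ => sum_comm.trans <| sum_congr rfl fun p _ => sum_comm).trans ?_
  rw [sum_comm]
  refine (sum_congr rfl fun p _ => sum_comm).trans ?_
  rw [sum_comm]
  exact sum_congr rfl fun _ _ => sum_congr rfl fun _ _ => sum_congr rfl fun _ _ =>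
    sum_congr rfl fun _ _ => by ring

theorem phiPhi_pull3 (hP : P.det ≠ 0) (φ : Tensor3) (x : Tensor1) (W : Tensor2) :
    phiPhi (pull3 P φ) x (pull2 P W) = pull2 P (phiPhi φ (P *ᵥ x) W) := by
  have hu : IsUnit P.det := hP.isUnit
  have h1 : P * P⁻¹ = 1 := Matrix.mul_nonsing_inv _ hu
  have h2 : P⁻¹ᵀ * Pᵀ = 1 := by rw [← transpose_mul, h1, transpose_one]
  have e : phiPhi φ (P *ᵥ x) W = fun a b => ((Matrix.of fun i j => ∑ m, (P *ᵥ x) m * φ i m j) *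
      Matrix.of (raise2 φ W) * (Matrix.of fun i j => ∑ m, (P *ᵥ x) m * φ i m j)ᵀ) a b :=
    funext fun a => funext fun b => phiPhi_eq _ _ _ _ _
  have h3 : (fun i j => ∑ m, x m * pull3 P φ i m j)
      = pull2 P (fun i j => ∑ m, (P *ᵥ x) m * φ i m j) := by
    funext i j
    simp only [pull3, mul_sum]
    rw [sum_comm, pull2]
    simp only [← sum_mul_pull2, mul_sum]
    exact sum_congr rfl fun _ _ => sum_congr rfl fun _ _ => by ring
  funext a b
  rw [phiPhi_eq, e, pull2_matrix, h3, raise2_pull3 hP, pull2_eq, pull2_eq]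
  simp only [transpose_mul, transpose_transpose, Matrix.mul_assoc]
  rw [← Matrix.mul_assoc P P⁻¹, h1, Matrix.one_mul, ← Matrix.mul_assoc P⁻¹ᵀ, h2, Matrix.one_mul]

/-- Pull-back of components. -/
def Components.pull (P : Matrix (Fin 7) (Fin 7) ℝ) (τ : Components) : Components where
  c1 := τ.c1
  c7 := pull1 P τ.c7
  c14 := pull2 P τ.c14
  c27 := pull2 P τ.c27

theorem components_pull3 (hP : P.det ≠ 0) (φ : Tensor3) (W : Tensor2) :
    components (pull3 P φ) (pull2 P W) = (components φ W).pull P := by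
  have h1 : (components (pull3 P φ) (pull2 P W)).c1 = (components φ W).c1 := by
    simp only [components, metricInv_pull3_apply hP, sum_pull2_mul_pull2 hP]
  have h7 : (components (pull3 P φ) (pull2 P W)).c7 = pull1 P (components φ W).c7 := by
    funext c
    have e : ∀ a b, pull3 P φ a b c = pull2 P (fun i j => pull1 P (φ i j) c) a b :=
      fun _ _ => rfl
    simp only [components, raise2_pull3 hP, e, sum_pull2_mul_pull2 hP, pull1_const_mul]
    congr 1
    rw [show (fun i => ∑ a, ∑ b, raise2 φ W a b * φ a b i)
      = fun i => ∑ a, (1 : ℝ) * (fun a i => ∑ b, raise2 φ W a b * φ a b i) a i by simp]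
    rw [pull1_sum_smul P (fun _ => 1)]
    simp only [pull1_sum_smul, one_mul]
  ext1
  · exact h1
  · exact h7
  · funext a b
    change altPart (pull2 P W) a b - phiContr (pull3 P φ)
      (sharp (pull3 P φ) (components (pull3 P φ) (pull2 P W)).c7) a b = _
    rw [h7, altPart_pull2, phiContr_pull3, sharp_pull3 hP, ← pull2_sub]
    rfl
  · funext a b
    change symPart (pull2 P W) a b - (components (pull3 P φ) (pull2 P W)).c1 *
      metric (pull3 P φ) a b = _
    rw [h1, symPart_pull2, metric_pull3_apply hP, ← pull2_const_mul P _ fun i j => metric φ i j,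
      ← pull2_sub]
    rfl

/-- Every term of the four formulas is a composite of natural constructions, so each formula is
natural term by term. -/
theorem formula1_pull3 (hP : P.det ≠ 0) (φ : Tensor3) (v : Tensor1) (τ ρ : Components) :
    formula1 (pull3 P φ) v (τ.pull P) (ρ.pull P) = formula1 φ (P *ᵥ v) τ ρ := by
  simp only [formula1, Components.pull, pair_pull1, normSq_pull3 hP, kappa_pull3 hP, contract_pull2]

theorem formula7_pull3 (hP : P.det ≠ 0) (φ : Tensor3) (v : Tensor1) (τ ρ : Components) :
    formula7 (pull3 P φ) v (τ.pull P) (ρ.pull P) = pull1 P (formula7 φ (P *ᵥ v) τ ρ) := by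
  funext c
  unfold formula7
  simp only [Components.pull, kappa_pull3 hP, contract_pull2, phiCross_pull3, sharp_pull3 hP,
    flat_pull3 hP, pull1_add, pull1_sub, pull1_const_mul]

theorem formula14_pull3 (hP : P.det ≠ 0) (φ : Tensor3) (v : Tensor1) (τ ρ : Components) :
    formula14 (pull3 P φ) v (τ.pull P) (ρ.pull P) = pull2 P (formula14 φ (P *ᵥ v) τ ρ) := by
  funext a b
  unfold formula14
  simp only [Components.pull, normSq_pull3 hP, kappa_pull3 hP, contract_pull2, phiCross_pull3,
    sharp_pull3 hP, flat_pull3 hP, pair_pull1, outer_pull1, altPart_pull2, phiContr_pull3,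
    psiContr_pull3 hP, phiMul_pull3 hP, phiPhi_pull3 hP, pull2_add, pull2_sub, pull2_const_mul]

theorem formula27_pull3 (hP : P.det ≠ 0) (φ : Tensor3) (v : Tensor1) (τ ρ : Components) :
    formula27 (pull3 P φ) v (τ.pull P) (ρ.pull P) = pull2 P (formula27 φ (P *ᵥ v) τ ρ) := by
  funext a b
  have hg : ∀ r, pull2 P (fun i j => r * metric φ i j) a b
      = r * pull2 P (fun i j => metric φ i j) a b := fun r =>
    pull2_const_mul P r (fun i j => metric φ i j) a b
  unfold formula27
  simp only [Components.pull, normSq_pull3 hP, kappa_pull3 hP, contract_pull2, phiCross_pull3,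
    sharp_pull3 hP, flat_pull3 hP, pair_pull1, outer_pull1, symPart_pull2, metric_pull3_apply hP,
    phiMul_pull3 hP, phiPhi_pull3 hP, pull2_add, pull2_sub, pull2_const_mul, pull2_mul_apply, hg]

end Equivariance

/-! ### A cyclic symmetry of the standard form -/

/-- A permutation of the indices that preserves the standard form. -/
def cyc : Fin 7 → Fin 7 := ![0, 3, 4, 5, 6, 1, 2]

/-- The matrix of the permutation `cyc`. -/
def cycMatrix : Matrix (Fin 7) (Fin 7) ℝ := fun i a => if i = cyc a then 1 else 0

theorem cyc_cyc_cyc : ∀ a, cyc (cyc (cyc a)) = a := by decide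

theorem pull1_cycMatrix (α : Tensor1) (a : Fin 7) : pull1 cycMatrix α a = α (cyc a) := by
  simp [pull1, cycMatrix]

theorem pull2_cycMatrix (W : Tensor2) (a b : Fin 7) :
    pull2 cycMatrix W a b = W (cyc a) (cyc b) := by
  simp only [pull2, pull1_cycMatrix]
  exact pull1_cycMatrix (fun i => W i (cyc b)) a

theorem pull3_cycMatrix (φ : Tensor3) (a b c : Fin 7) :
    pull3 cycMatrix φ a b c = φ (cyc a) (cyc b) (cyc c) := by
  simp only [pull3, pull2_cycMatrix]
  exact pull1_cycMatrix (fun i => φ i (cyc b) (cyc c)) a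

/-- The permutation cycles the three complex coordinates `e₁ + i e₂`, `e₃ + i e₄`, `e₅ + i e₆` and
fixes `e₀`; both `ω` and `Ω` are invariant. -/
theorem pull3_cycMatrix_stdForm : pull3 cycMatrix stdForm = stdForm := by
  have h : ∀ a b c, stdZ (cyc a) (cyc b) (cyc c) = stdZ a b c := by decide +kernel
  funext a b c
  rw [pull3_cycMatrix, stdForm, h, stdForm]

theorem det_cycMatrix_ne_zero : cycMatrix.det ≠ 0 := by
  have h : cycMatrix * (cycMatrix * cycMatrix) = 1 := by
    ext i a
    simp only [cycMatrix, Matrix.mul_apply, mul_ite, mul_one, mul_zero, sum_ite_eq', mem_univ,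
      if_true, Matrix.one_apply, cyc_cyc_cyc]
  intro h0
  have := congrArg Matrix.det h
  simp [h0] at this

theorem cycMatrix_mulVec (t : ℝ) :
    cycMatrix *ᵥ (t • Pi.single 0 1) = (t • Pi.single 0 1 : Tensor1) := by
  have h : ∀ i, i = cyc 0 ↔ i = 0 := by decide
  rw [mulVec_smul, mulVec_single_one]
  congr 1
  funext i
  simp [cycMatrix, Pi.single_apply, h]

set_option maxHeartbeats 1000000 in
-- The invariance of the explicit table, entry by entry. It lets each formula be verified for one
-- pair of indices per orbit.
theorem stdTorsion_cyc (t : ℝ) (T W : Tensor2) :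
    stdTorsion t (pull2 cycMatrix T) (pull2 cycMatrix W)
      = pull2 cycMatrix (stdTorsion t T W) := by
  funext a b
  rw [pull2_cycMatrix]
  obtain rfl | rfl | rfl | rfl | rfl | rfl | rfl :
      a = 0 ∨ a = 1 ∨ a = 2 ∨ a = 3 ∨ a = 4 ∨ a = 5 ∨ a = 6 := by omega
  all_goals
    obtain rfl | rfl | rfl | rfl | rfl | rfl | rfl :
      b = 0 ∨ b = 1 ∨ b = 2 ∨ b = 3 ∨ b = 4 ∨ b = 5 ∨ b = 6 := by omega
  all_goals
    simp only [stdTorsion_apply, pull2_cycMatrix, cyc, Matrix.cons_val]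
    try ring

/-- The components with respect to the deformed form of its torsion, at the standard form. -/
def stdDeformedComponents (k t : ℝ) (T W : Tensor2) : Components :=
  scaleComponents k (deformComponents t (stdTorsion t T W))

theorem components_deform_stdTorsion {t k : ℝ} (hk : k = (1 + t ^ 2) ^ (1 / 3 : ℝ))
    (T W : Tensor2) :
    components (deform stdForm (t • Pi.single 0 1)) (fun a b => k⁻¹ * stdTorsion t T W a b)
      = stdDeformedComponents k t T W :=
  components_deform_stdForm hk _

theorem stdDeformedComponents_cyc {t k : ℝ} (hk : k = (1 + t ^ 2) ^ (1 / 3 : ℝ)) (T W : Tensor2) :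
    stdDeformedComponents k t (pull2 cycMatrix T) (pull2 cycMatrix W)
      = (stdDeformedComponents k t T W).pull cycMatrix := by
  have h : deform stdForm (t • Pi.single 0 1)
      = pull3 cycMatrix (deform stdForm (t • Pi.single 0 1)) := by
    conv_lhs => rw [← pull3_cycMatrix_stdForm, deform_pull3 det_cycMatrix_ne_zero,
      cycMatrix_mulVec]
  rw [← components_deform_stdTorsion hk, ← components_deform_stdTorsion hk, stdTorsion_cyc,
    ← components_pull3 det_cycMatrix_ne_zero, ← h]
  exact congrArg _ (funext fun a => funext fun b =>
    (pull2_const_mul cycMatrix k⁻¹ (stdTorsion t T W) a b).symm)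

theorem components_stdForm_cyc (W : Tensor2) :
    components stdForm (pull2 cycMatrix W) = (components stdForm W).pull cycMatrix := by
  rw [← components_pull3 det_cycMatrix_ne_zero, pull3_cycMatrix_stdForm]

/-- The formula for the component in `Λ²₁₄` at the standard form, for the indices `a`, `b`. -/
def StdFormula14 (k t : ℝ) (a b : Fin 7) : Prop := ∀ T W : Tensor2,
  (components stdForm W).c14 a b = formula14 stdForm (t • Pi.single 0 1) (components stdForm T)
    (stdDeformedComponents k t T W) a b

/-- The formula for the symmetric traceless component at the standard form, for the indices `a`,
`b`. -/
def StdFormula27 (k t : ℝ) (a b : Fin 7) : Prop := ∀ T W : Tensor2,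
  (components stdForm W).c27 a b = formula27 stdForm (t • Pi.single 0 1) (components stdForm T)
    (stdDeformedComponents k t T W) a b

/-- The formula for the vector component at the standard form, for the index `c`. -/
def StdFormula7 (k t : ℝ) (c : Fin 7) : Prop := ∀ T W : Tensor2,
  (components stdForm W).c7 c = formula7 stdForm (t • Pi.single 0 1) (components stdForm T)
    (stdDeformedComponents k t T W) c

theorem thirdSign_third_swap :
    ∀ a b, thirdSign b a = -thirdSign a b ∧ third b a = third a b := by decide +kernel

theorem fourthSign_fourth_swap :
    ∀ a b, fourthSign b a = -fourthSign a b ∧ fourth b a = fourth a b := by decide +kernel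

theorem components_stdForm_c14_swap (W : Tensor2) (a b : Fin 7) :
    (components stdForm W).c14 b a = -(components stdForm W).c14 a b := by
  rw [components_stdForm_c14, components_stdForm_c14, (thirdSign_third_swap a b).1,
    (thirdSign_third_swap a b).2]
  push_cast
  ring

theorem components_stdForm_c27_swap (W : Tensor2) (a b : Fin 7) :
    (components stdForm W).c27 b a = (components stdForm W).c27 a b := by
  rw [components_stdForm_c27, components_stdForm_c27, add_comm]
  simp only [eq_comm (a := b) (b := a)]

theorem deformComponents_c14_swap (t : ℝ) (Y : Tensor2) (a b : Fin 7) :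
    (deformComponents t Y).c14 b a = -(deformComponents t Y).c14 a b := by
  rw [deformComponents_c14, deformComponents_c14, (thirdSign_third_swap a b).1,
    (thirdSign_third_swap a b).2, (fourthSign_fourth_swap a b).1, (fourthSign_fourth_swap a b).2]
  push_cast
  ring

theorem deformComponents_c27_swap (t : ℝ) (Y : Tensor2) (a b : Fin 7) :
    (deformComponents t Y).c27 b a = (deformComponents t Y).c27 a b := by
  rw [deformComponents_c27, deformComponents_c27, add_comm]
  obtain rfl | hab := eq_or_ne a b
  · rfl
  · rw [if_neg hab, if_neg hab.symm]

section Symmetry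

variable {t k : ℝ} (hk : k = (1 + t ^ 2) ^ (1 / 3 : ℝ)) {a b c : Fin 7}

include hk

/-- The hypothesis covers all tensors, so it may be applied to the permuted ones; naturality moves
the permutation onto the free index. The two lemmas for pairs of indices work alike. -/
theorem StdFormula7.cyc (h : StdFormula7 k t c) : StdFormula7 k t (cyc c) := fun T W => by
  have h' := h (pull2 cycMatrix T) (pull2 cycMatrix W)
  rw [components_stdForm_cyc, components_stdForm_cyc, stdDeformedComponents_cyc hk] at h'
  have e := congrFun (formula7_pull3 det_cycMatrix_ne_zero stdForm (t • Pi.single 0 1)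
    (components stdForm T) (stdDeformedComponents k t T W)) c
  rw [pull3_cycMatrix_stdForm, cycMatrix_mulVec, pull1_cycMatrix] at e
  rw [← e, ← h']
  exact (pull1_cycMatrix (components stdForm W).c7 c).symm

theorem StdFormula14.cyc (h : StdFormula14 k t a b) : StdFormula14 k t (cyc a) (cyc b) :=
  fun T W => by
  have h' := h (pull2 cycMatrix T) (pull2 cycMatrix W)
  rw [components_stdForm_cyc, components_stdForm_cyc, stdDeformedComponents_cyc hk] at h'
  have e := congrFun₂ (formula14_pull3 det_cycMatrix_ne_zero stdForm (t • Pi.single 0 1)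
    (components stdForm T) (stdDeformedComponents k t T W)) a b
  rw [pull3_cycMatrix_stdForm, cycMatrix_mulVec, pull2_cycMatrix] at e
  rw [← e, ← h']
  exact (pull2_cycMatrix (components stdForm W).c14 a b).symm

theorem StdFormula27.cyc (h : StdFormula27 k t a b) : StdFormula27 k t (cyc a) (cyc b) :=
  fun T W => by
  have h' := h (pull2 cycMatrix T) (pull2 cycMatrix W)
  rw [components_stdForm_cyc, components_stdForm_cyc, stdDeformedComponents_cyc hk] at h'
  have e := congrFun₂ (formula27_pull3 det_cycMatrix_ne_zero stdForm (t • Pi.single 0 1)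
    (components stdForm T) (stdDeformedComponents k t T W)) a b
  rw [pull3_cycMatrix_stdForm, cycMatrix_mulVec, pull2_cycMatrix] at e
  rw [← e, ← h']
  exact (pull2_cycMatrix (components stdForm W).c27 a b).symm

theorem formula14_stdForm_swap {τ σ : Components} (hτ : ∀ a b, τ.c14 b a = -τ.c14 a b)
    (hσ : ∀ a b, σ.c14 b a = -σ.c14 a b) (a b : Fin 7) :
    formula14 stdForm (t • Pi.single 0 1) τ (scaleComponents k σ) b a
      = -formula14 stdForm (t • Pi.single 0 1) τ (scaleComponents k σ) a b := by
  rw [formula14_stdForm hk, formula14_stdForm hk, (thirdSign_third_swap a b).1,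
    (thirdSign_third_swap a b).2, (fourthSign_fourth_swap a b).1, (fourthSign_fourth_swap a b).2, hτ a b, hσ a b,
    hτ (third a 0) (third b 0)]
  push_cast
  ring

theorem formula27_stdForm_swap {τ σ : Components} (hτ : ∀ a b, τ.c27 b a = τ.c27 a b)
    (hσ : ∀ a b, σ.c27 b a = σ.c27 a b) (a b : Fin 7) :
    formula27 stdForm (t • Pi.single 0 1) τ (scaleComponents k σ) b a
      = formula27 stdForm (t • Pi.single 0 1) τ (scaleComponents k σ) a b := by
  rw [formula27_stdForm hk, formula27_stdForm hk, hτ a b, hσ a b, hσ (third a 0) (third b 0)]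
  simp only [eq_comm (a := b) (b := a)]
  ring

theorem StdFormula14.swap (h : StdFormula14 k t a b) : StdFormula14 k t b a := fun T W => by
  rw [components_stdForm_c14_swap, h T W]
  exact (formula14_stdForm_swap hk (components_stdForm_c14_swap T)
    (deformComponents_c14_swap t _) a b).symm

theorem stdFormula14_self (a : Fin 7) : StdFormula14 k t a a := fun T W => by
  have h1 := components_stdForm_c14_swap W a a
  have h2 := formula14_stdForm_swap hk (components_stdForm_c14_swap T)
    (deformComponents_c14_swap t (stdTorsion t T W)) a a
  rw [stdDeformedComponents]
  linarith

theorem StdFormula27.swap (h : StdFormula27 k t a b) : StdFormula27 k t b a := fun T W => by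
  rw [components_stdForm_c27_swap, h T W]
  exact (formula27_stdForm_swap hk (components_stdForm_c27_swap T)
    (deformComponents_c27_swap t _) a b).symm

end Symmetry

/-! ### Verification of the formulas at the standard form -/

/-- The pairs of indices `p` and `(i, j)` agree up to the symmetry `cyc` and a swap. -/
def CycEquiv (p : Fin 7 × Fin 7) (i j : Fin 7) : Prop :=
  (i = p.1 ∧ j = p.2) ∨ (i = cyc p.1 ∧ j = cyc p.2) ∨
    (i = cyc (cyc p.1) ∧ j = cyc (cyc p.2)) ∨ (j = p.1 ∧ i = p.2) ∨
    (j = cyc p.1 ∧ i = cyc p.2) ∨ (j = cyc (cyc p.1) ∧ i = cyc (cyc p.2))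

section StandardTorsion

variable {t k : ℝ} (hk : k = (1 + t ^ 2) ^ (1 / 3 : ℝ))
include hk

/-- Direct expansion: both sides are linear in the entries of `T` and `W` with coefficients rational
in `t`. The only denominators are powers of `1 + t²`, joined by `t² + 9` in the component of type
14. -/
theorem stdFormula1 (T W : Tensor2) :
    (components stdForm W).c1 = formula1 stdForm (t • Pi.single 0 1) (components stdForm T)
      (stdDeformedComponents k t T W) := by
  have h1 : 1 + t ^ 2 ≠ 0 := by positivity
  rw [stdDeformedComponents, formula1_stdForm hk]
  simp [deformComponents_c27, components_stdForm_c7, deformComponents_c7, components_stdForm_c1,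
    deformComponents_c1, stdTorsion_apply, Fin.sum_univ_seven]
  field_simp
  ring

set_option maxHeartbeats 1000000 in
theorem stdFormula7_zero : StdFormula7 k t 0 := fun T W => by
  have h1 : 1 + t ^ 2 ≠ 0 := by positivity
  rw [stdDeformedComponents, formula7_stdForm hk]
  simp [deformComponents_c27, components_stdForm_c14, components_stdForm_c27, components_stdForm_c7,
    deformComponents_c7, components_stdForm_c1, deformComponents_c1, stdTorsion_apply, third,
    thirdSign, Fin.sum_univ_seven]
  field_simp
  ring

set_option maxHeartbeats 1000000 in
theorem stdFormula7_one : StdFormula7 k t 1 := fun T W => by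
  have h1 : 1 + t ^ 2 ≠ 0 := by positivity
  rw [stdDeformedComponents, formula7_stdForm hk]
  simp [deformComponents_c27, components_stdForm_c14, components_stdForm_c27, components_stdForm_c7,
    deformComponents_c7, components_stdForm_c1, deformComponents_c1, stdTorsion_apply, third,
    thirdSign, Fin.sum_univ_seven]
  field_simp
  ring

set_option maxHeartbeats 1000000 in
theorem stdFormula7_two : StdFormula7 k t 2 := fun T W => by
  have h1 : 1 + t ^ 2 ≠ 0 := by positivity
  rw [stdDeformedComponents, formula7_stdForm hk]
  simp [deformComponents_c27, components_stdForm_c14, components_stdForm_c27, components_stdForm_c7,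
    deformComponents_c7, components_stdForm_c1, deformComponents_c1, stdTorsion_apply, third,
    thirdSign, Fin.sum_univ_seven]
  field_simp
  ring

set_option maxHeartbeats 1000000 in
-- The 21 unordered pairs of distinct indices form seven orbits of length three under `cyc`; this
-- and the next six lemmas treat one pair from each.
theorem stdFormula14_zero_one : StdFormula14 k t 0 1 := fun T W => by
  have h1 : 1 + t ^ 2 ≠ 0 := by positivity
  have h9 : t ^ 2 + 9 ≠ 0 := by positivity
  rw [stdDeformedComponents, formula14_stdForm hk]
  simp [deformComponents_c14, deformComponents_c27, components_stdForm_c14, components_stdForm_c27,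
    formula14Flat, formula14Phi, formula14Psi, components_stdForm_c7, deformComponents_c7,
    components_stdForm_c1, deformComponents_c1, stdTorsion_apply, third, thirdSign, fourth,
    fourthSign, Fin.sum_univ_seven]
  field_simp
  ring

set_option maxHeartbeats 1000000 in
theorem stdFormula14_zero_two : StdFormula14 k t 0 2 := fun T W => by
  have h1 : 1 + t ^ 2 ≠ 0 := by positivity
  have h9 : t ^ 2 + 9 ≠ 0 := by positivity
  rw [stdDeformedComponents, formula14_stdForm hk]
  simp [deformComponents_c14, deformComponents_c27, components_stdForm_c14, components_stdForm_c27,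
    formula14Flat, formula14Phi, formula14Psi, components_stdForm_c7, deformComponents_c7,
    components_stdForm_c1, deformComponents_c1, stdTorsion_apply, third, thirdSign, fourth,
    fourthSign, Fin.sum_univ_seven]
  field_simp
  ring

set_option maxHeartbeats 1000000 in
theorem stdFormula14_one_two : StdFormula14 k t 1 2 := fun T W => by
  have h1 : 1 + t ^ 2 ≠ 0 := by positivity
  have h9 : t ^ 2 + 9 ≠ 0 := by positivity
  rw [stdDeformedComponents, formula14_stdForm hk]
  simp [deformComponents_c14, deformComponents_c27, components_stdForm_c14, components_stdForm_c27,
    formula14Flat, formula14Phi, formula14Psi, components_stdForm_c7, deformComponents_c7,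
    components_stdForm_c1, deformComponents_c1, stdTorsion_apply, third, thirdSign, fourth,
    fourthSign, Fin.sum_univ_seven]
  field_simp
  ring

set_option maxHeartbeats 1000000 in
theorem stdFormula14_one_three : StdFormula14 k t 1 3 := fun T W => by
  have h1 : 1 + t ^ 2 ≠ 0 := by positivity
  have h9 : t ^ 2 + 9 ≠ 0 := by positivity
  rw [stdDeformedComponents, formula14_stdForm hk]
  simp [deformComponents_c14, deformComponents_c27, components_stdForm_c14, components_stdForm_c27,
    formula14Flat, formula14Phi, formula14Psi, components_stdForm_c7, deformComponents_c7,
    components_stdForm_c1, deformComponents_c1, stdTorsion_apply, third, thirdSign, fourth,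
    fourthSign, Fin.sum_univ_seven]
  field_simp
  ring

set_option maxHeartbeats 1000000 in
theorem stdFormula14_one_four : StdFormula14 k t 1 4 := fun T W => by
  have h1 : 1 + t ^ 2 ≠ 0 := by positivity
  have h9 : t ^ 2 + 9 ≠ 0 := by positivity
  rw [stdDeformedComponents, formula14_stdForm hk]
  simp [deformComponents_c14, deformComponents_c27, components_stdForm_c14, components_stdForm_c27,
    formula14Flat, formula14Phi, formula14Psi, components_stdForm_c7, deformComponents_c7,
    components_stdForm_c1, deformComponents_c1, stdTorsion_apply, third, thirdSign, fourth,
    fourthSign, Fin.sum_univ_seven]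
  field_simp
  ring

set_option maxHeartbeats 1000000 in
theorem stdFormula14_two_three : StdFormula14 k t 2 3 := fun T W => by
  have h1 : 1 + t ^ 2 ≠ 0 := by positivity
  have h9 : t ^ 2 + 9 ≠ 0 := by positivity
  rw [stdDeformedComponents, formula14_stdForm hk]
  simp [deformComponents_c14, deformComponents_c27, components_stdForm_c14, components_stdForm_c27,
    formula14Flat, formula14Phi, formula14Psi, components_stdForm_c7, deformComponents_c7,
    components_stdForm_c1, deformComponents_c1, stdTorsion_apply, third, thirdSign, fourth,
    fourthSign, Fin.sum_univ_seven]
  field_simp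
  ring

set_option maxHeartbeats 1000000 in
theorem stdFormula14_two_four : StdFormula14 k t 2 4 := fun T W => by
  have h1 : 1 + t ^ 2 ≠ 0 := by positivity
  have h9 : t ^ 2 + 9 ≠ 0 := by positivity
  rw [stdDeformedComponents, formula14_stdForm hk]
  simp [deformComponents_c14, deformComponents_c27, components_stdForm_c14, components_stdForm_c27,
    formula14Flat, formula14Phi, formula14Psi, components_stdForm_c7, deformComponents_c7,
    components_stdForm_c1, deformComponents_c1, stdTorsion_apply, third, thirdSign, fourth,
    fourthSign, Fin.sum_univ_seven]
  field_simp
  ring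

set_option maxHeartbeats 1000000 in
-- For a symmetric tensor there are 28 unordered pairs: `(0, 0)` is fixed by `cyc` and the others
-- form nine orbits, so ten checks are needed.
theorem stdFormula27_zero_zero : StdFormula27 k t 0 0 := fun T W => by
  have h1 : 1 + t ^ 2 ≠ 0 := by positivity
  rw [stdDeformedComponents, formula27_stdForm hk]
  simp [deformComponents_c27, components_stdForm_c14, components_stdForm_c27, components_stdForm_c7,
    deformComponents_c7, components_stdForm_c1, deformComponents_c1, stdTorsion_apply, third,
    thirdSign, Fin.sum_univ_seven]
  field_simp
  ring

set_option maxHeartbeats 1000000 in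
theorem stdFormula27_zero_one : StdFormula27 k t 0 1 := fun T W => by
  have h1 : 1 + t ^ 2 ≠ 0 := by positivity
  rw [stdDeformedComponents, formula27_stdForm hk]
  simp [deformComponents_c27, components_stdForm_c14, components_stdForm_c27, components_stdForm_c7,
    deformComponents_c7, components_stdForm_c1, deformComponents_c1, stdTorsion_apply, third,
    thirdSign, Fin.sum_univ_seven]
  field_simp
  ring

set_option maxHeartbeats 1000000 in
theorem stdFormula27_zero_two : StdFormula27 k t 0 2 := fun T W => by
  have h1 : 1 + t ^ 2 ≠ 0 := by positivity
  rw [stdDeformedComponents, formula27_stdForm hk]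
  simp [deformComponents_c27, components_stdForm_c14, components_stdForm_c27, components_stdForm_c7,
    deformComponents_c7, components_stdForm_c1, deformComponents_c1, stdTorsion_apply, third,
    thirdSign, Fin.sum_univ_seven]
  field_simp
  ring

set_option maxHeartbeats 1000000 in
theorem stdFormula27_one_one : StdFormula27 k t 1 1 := fun T W => by
  have h1 : 1 + t ^ 2 ≠ 0 := by positivity
  rw [stdDeformedComponents, formula27_stdForm hk]
  simp [deformComponents_c27, components_stdForm_c14, components_stdForm_c27, components_stdForm_c7,
    deformComponents_c7, components_stdForm_c1, deformComponents_c1, stdTorsion_apply, third,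
    thirdSign, Fin.sum_univ_seven]
  field_simp
  ring

set_option maxHeartbeats 1000000 in
theorem stdFormula27_two_two : StdFormula27 k t 2 2 := fun T W => by
  have h1 : 1 + t ^ 2 ≠ 0 := by positivity
  rw [stdDeformedComponents, formula27_stdForm hk]
  simp [deformComponents_c27, components_stdForm_c14, components_stdForm_c27, components_stdForm_c7,
    deformComponents_c7, components_stdForm_c1, deformComponents_c1, stdTorsion_apply, third,
    thirdSign, Fin.sum_univ_seven]
  field_simp
  ring

set_option maxHeartbeats 1000000 in
theorem stdFormula27_one_two : StdFormula27 k t 1 2 := fun T W => by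
  have h1 : 1 + t ^ 2 ≠ 0 := by positivity
  rw [stdDeformedComponents, formula27_stdForm hk]
  simp [deformComponents_c27, components_stdForm_c14, components_stdForm_c27, components_stdForm_c7,
    deformComponents_c7, components_stdForm_c1, deformComponents_c1, stdTorsion_apply, third,
    thirdSign, Fin.sum_univ_seven]
  field_simp
  ring

set_option maxHeartbeats 1000000 in
theorem stdFormula27_one_three : StdFormula27 k t 1 3 := fun T W => by
  have h1 : 1 + t ^ 2 ≠ 0 := by positivity
  rw [stdDeformedComponents, formula27_stdForm hk]
  simp [deformComponents_c27, components_stdForm_c14, components_stdForm_c27, components_stdForm_c7,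
    deformComponents_c7, components_stdForm_c1, deformComponents_c1, stdTorsion_apply, third,
    thirdSign, Fin.sum_univ_seven]
  field_simp
  ring

set_option maxHeartbeats 1000000 in
theorem stdFormula27_one_four : StdFormula27 k t 1 4 := fun T W => by
  have h1 : 1 + t ^ 2 ≠ 0 := by positivity
  rw [stdDeformedComponents, formula27_stdForm hk]
  simp [deformComponents_c27, components_stdForm_c14, components_stdForm_c27, components_stdForm_c7,
    deformComponents_c7, components_stdForm_c1, deformComponents_c1, stdTorsion_apply, third,
    thirdSign, Fin.sum_univ_seven]
  field_simp
  ring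

set_option maxHeartbeats 1000000 in
theorem stdFormula27_two_three : StdFormula27 k t 2 3 := fun T W => by
  have h1 : 1 + t ^ 2 ≠ 0 := by positivity
  rw [stdDeformedComponents, formula27_stdForm hk]
  simp [deformComponents_c27, components_stdForm_c14, components_stdForm_c27, components_stdForm_c7,
    deformComponents_c7, components_stdForm_c1, deformComponents_c1, stdTorsion_apply, third,
    thirdSign, Fin.sum_univ_seven]
  field_simp
  ring

set_option maxHeartbeats 1000000 in
theorem stdFormula27_two_four : StdFormula27 k t 2 4 := fun T W => by
  have h1 : 1 + t ^ 2 ≠ 0 := by positivity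
  rw [stdDeformedComponents, formula27_stdForm hk]
  simp [deformComponents_c27, components_stdForm_c14, components_stdForm_c27, components_stdForm_c7,
    deformComponents_c7, components_stdForm_c1, deformComponents_c1, stdTorsion_apply, third,
    thirdSign, Fin.sum_univ_seven]
  field_simp
  ring

/-- The orbits of `cyc` on the indices are `{0}`, `{1, 3, 5}` and `{2, 4, 6}`. -/
theorem stdFormula7 (c : Fin 7) : StdFormula7 k t c := by
  have h1 := stdFormula7_one hk
  have h2 := stdFormula7_two hk
  have h3 := h1.cyc hk
  have h4 := h2.cyc hk
  obtain rfl | rfl | rfl | rfl | rfl | rfl | rfl :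
      c = 0 ∨ c = 1 ∨ c = 2 ∨ c = 3 ∨ c = 4 ∨ c = 5 ∨ c = 6 := by omega
  exacts [stdFormula7_zero hk, h1, h2, h3, h4, h3.cyc hk, h4.cyc hk]

theorem stdFormula14 (a b : Fin 7) : StdFormula14 k t a b := by
  have key : ∀ p : Fin 7 × Fin 7, StdFormula14 k t p.1 p.2 →
      ∀ i j, CycEquiv p i j → StdFormula14 k t i j := by
    intro p h i j hij
    have h' := h.cyc hk
    have h'' := h'.cyc hk
    rcases hij with ⟨rfl, rfl⟩ | ⟨rfl, rfl⟩ | ⟨rfl, rfl⟩ | ⟨rfl, rfl⟩ | ⟨rfl, rfl⟩ | ⟨rfl, rfl⟩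
    exacts [h, h', h'', h.swap hk, h'.swap hk, h''.swap hk]
  have cover : ∀ i j, i = j ∨ ∃ p ∈ [((0 : Fin 7), (1 : Fin 7)), (0, 2), (1, 2), (1, 3), (1, 4),
      (2, 3), (2, 4)], CycEquiv p i j := by
    unfold CycEquiv
    decide +kernel
  obtain rfl | ⟨p, hp, h⟩ := cover a b
  · exact stdFormula14_self hk a
  · refine key p ?_ a b h
    have reps : ∀ p ∈ [((0 : Fin 7), (1 : Fin 7)), (0, 2), (1, 2), (1, 3), (1, 4),
        (2, 3), (2, 4)], StdFormula14 k t p.1 p.2 := by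
      simp only [List.forall_mem_cons, List.not_mem_nil, false_imp_iff, implies_true, and_true]
      exact ⟨stdFormula14_zero_one hk, stdFormula14_zero_two hk, stdFormula14_one_two hk,
        stdFormula14_one_three hk, stdFormula14_one_four hk, stdFormula14_two_three hk,
        stdFormula14_two_four hk⟩
    exact reps p hp

theorem stdFormula27 (a b : Fin 7) : StdFormula27 k t a b := by
  have key : ∀ p : Fin 7 × Fin 7, StdFormula27 k t p.1 p.2 →
      ∀ i j, CycEquiv p i j → StdFormula27 k t i j := by
    intro p h i j hij
    have h' := h.cyc hk
    have h'' := h'.cyc hk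
    rcases hij with ⟨rfl, rfl⟩ | ⟨rfl, rfl⟩ | ⟨rfl, rfl⟩ | ⟨rfl, rfl⟩ | ⟨rfl, rfl⟩ | ⟨rfl, rfl⟩
    exacts [h, h', h'', h.swap hk, h'.swap hk, h''.swap hk]
  have cover : ∀ i j, ∃ p ∈ [((0 : Fin 7), (0 : Fin 7)), (0, 1), (0, 2), (1, 1), (2, 2), (1, 2),
      (1, 3), (1, 4), (2, 3), (2, 4)], CycEquiv p i j := by
    unfold CycEquiv
    decide +kernel
  obtain ⟨p, hp, h⟩ := cover a b
  refine key p ?_ a b h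
  have reps : ∀ p ∈ [((0 : Fin 7), (0 : Fin 7)), (0, 1), (0, 2), (1, 1), (2, 2), (1, 2),
      (1, 3), (1, 4), (2, 3), (2, 4)], StdFormula27 k t p.1 p.2 := by
    simp only [List.forall_mem_cons, List.not_mem_nil, false_imp_iff, implies_true, and_true]
    exact ⟨stdFormula27_zero_zero hk, stdFormula27_zero_one hk, stdFormula27_zero_two hk,
      stdFormula27_one_one hk, stdFormula27_two_two hk, stdFormula27_one_two hk,
      stdFormula27_one_three hk, stdFormula27_one_four hk, stdFormula27_two_three hk,
      stdFormula27_two_four hk⟩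
  exact reps p hp

end StandardTorsion

/-! ### Linear changes of coordinates -/

/-- The linear map of the coordinate space with matrix `B`. -/
def coordMap (B : Matrix (Fin 7) (Fin 7) ℝ) : Coords →L[ℝ] Coords := Matrix.toEuclideanCLM (𝕜 := ℝ) B

section LinearChange

variable {B : Matrix (Fin 7) (Fin 7) ℝ} {φ : Coords → Tensor3} {v : Coords → Tensor1} {z : Coords}

theorem coordMap_single (B : Matrix (Fin 7) (Fin 7) ℝ) (a : Fin 7) :
    coordMap B (EuclideanSpace.single a 1) = ∑ i, B i a • EuclideanSpace.single i (1 : ℝ) := by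
  ext j
  simp [coordMap, Matrix.ofLp_toEuclideanCLM, Pi.single_apply]

theorem coordMap_mul (A B : Matrix (Fin 7) (Fin 7) ℝ) (y : Coords) :
    coordMap A (coordMap B y) = coordMap (A * B) y := by
  simp [coordMap, map_mul]

theorem coordMap_one (y : Coords) : coordMap 1 y = y := by
  simp [coordMap]

theorem partialDeriv_coordMap {f : Coords → ℝ} (hf : DifferentiableAt ℝ f (coordMap B z))
    (a : Fin 7) :
    partialDeriv a (fun y => f (coordMap B y)) z
      = pull1 B (fun i => partialDeriv i f (coordMap B z)) a := by
  have h : HasFDerivAt (fun y => f (coordMap B y))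
      ((fderiv ℝ f (coordMap B z)).comp (coordMap B)) z :=
    hf.hasFDerivAt.comp z (coordMap B).hasFDerivAt
  rw [partialDeriv, h.fderiv, ContinuousLinearMap.comp_apply, coordMap_single, map_sum]
  simp only [map_smul, smul_eq_mul, pull1, partialDeriv]

theorem partialDeriv_pull1 {α : Coords → Tensor1} {x : Coords}
    (hα : ∀ i, DifferentiableAt ℝ (fun y => α y i) x) (P : Matrix (Fin 7) (Fin 7) ℝ) (a b : Fin 7) :
    partialDeriv a (fun y => pull1 P (α y) b) x
      = pull1 P (fun i => partialDeriv a (fun y => α y i) x) b := by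
  have h : HasFDerivAt (fun y => pull1 P (α y) b)
      (∑ i, P i b • fderiv ℝ (fun y => α y i) x) x :=
    HasFDerivAt.fun_sum fun i _ => (hα i).hasFDerivAt.const_mul _
  rw [partialDeriv, h.fderiv]
  simp [pull1, partialDeriv]

theorem differentiableAt_pull1 {α : Coords → Tensor1} {x : Coords}
    (hα : ∀ i, DifferentiableAt ℝ (fun y => α y i) x) (P : Matrix (Fin 7) (Fin 7) ℝ) (b : Fin 7) :
    DifferentiableAt ℝ (fun y => pull1 P (α y) b) x :=
  DifferentiableAt.fun_sum fun i _ => (hα i).const_mul _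

theorem partialDeriv_pull2 {α : Coords → Tensor2} {x : Coords}
    (hα : ∀ i j, DifferentiableAt ℝ (fun y => α y i j) x) (P : Matrix (Fin 7) (Fin 7) ℝ)
    (a b c : Fin 7) :
    partialDeriv a (fun y => pull2 P (α y) b c) x
      = pull2 P (fun i j => partialDeriv a (fun y => α y i j) x) b c := by
  refine (partialDeriv_pull1 (α := fun y i => pull1 P (α y i) c)
    (fun i => differentiableAt_pull1 (hα i) P c) P a b).trans ?_
  simp only [partialDeriv_pull1 (hα _)]
  rfl

theorem differentiableAt_pull2 {α : Coords → Tensor2} {x : Coords}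
    (hα : ∀ i j, DifferentiableAt ℝ (fun y => α y i j) x) (P : Matrix (Fin 7) (Fin 7) ℝ)
    (b c : Fin 7) : DifferentiableAt ℝ (fun y => pull2 P (α y) b c) x :=
  differentiableAt_pull1 (α := fun y i => pull1 P (α y i) c)
    (fun i => differentiableAt_pull1 (hα i) P c) P b

theorem partialDeriv_pull3 {α : Coords → Tensor3} {x : Coords}
    (hα : ∀ i j k, DifferentiableAt ℝ (fun y => α y i j k) x) (P : Matrix (Fin 7) (Fin 7) ℝ)
    (a b c d : Fin 7) :
    partialDeriv a (fun y => pull3 P (α y) b c d) x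
      = pull3 P (fun i j k => partialDeriv a (fun y => α y i j k) x) b c d := by
  refine (partialDeriv_pull1 (α := fun y i => pull2 P (α y i) c d)
    (fun i => differentiableAt_pull2 (hα i) P c d) P a b).trans ?_
  simp only [partialDeriv_pull2 (hα _)]
  rfl

theorem differentiableAt_comp_coordMap {f : Coords → ℝ} (hf : DifferentiableAt ℝ f (coordMap B z)) :
    DifferentiableAt ℝ (fun y => f (coordMap B y)) z :=
  hf.comp z (coordMap B).differentiableAt

/-- Contraction of the middle index with a vector. -/
theorem sum_mul_pull3_mid (P : Matrix (Fin 7) (Fin 7) ℝ) (x : Fin 7 → ℝ) (χ : Tensor3)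
    (a c : Fin 7) :
    ∑ m, x m * pull3 P χ a m c = pull2 P (fun i k => ∑ j, (P *ᵥ x) j * χ i j k) a c := by
  simp only [pull3, mul_sum]
  rw [sum_comm, pull2]
  simp only [← sum_mul_pull2, mul_sum]
  exact sum_congr rfl fun _ _ => sum_congr rfl fun _ _ => by ring

theorem pull4_mul_apply (P : Matrix (Fin 7) (Fin 7) ℝ) (X Y : Tensor2) (a b c d : Fin 7) :
    pull4 P (fun i j k l => X i j * Y k l) a b c d = pull2 P X a b * pull2 P Y c d := by
  change pull2 P (fun i j => pull2 P (fun k l => X i j * Y k l) c d) a b = _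
  simp only [pull2_const_mul, mul_comm _ (pull2 P Y c d)]

theorem pull4_mul_apply' (P : Matrix (Fin 7) (Fin 7) ℝ) (X Y : Tensor2) (a b c d : Fin 7) :
    pull4 P (fun i j k l => X i k * Y j l) a b c d = pull2 P X a c * pull2 P Y b d := by
  change pull2 P (fun i j => pull2 P (fun k l => X i k * Y j l) c d) a b = _
  simp only [pull2_mul_apply]
  rfl

theorem pull4_mul_apply'' (P : Matrix (Fin 7) (Fin 7) ℝ) (X Y : Tensor2) (a b c d : Fin 7) :
    pull4 P (fun i j k l => X i l * Y j k) a b c d = pull2 P X a d * pull2 P Y b c := by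
  change pull2 P (fun i j => pull2 P (fun k l => X i l * Y j k) c d) a b = _
  simp only [mul_comm (X _ _) (Y _ _), pull2_mul_apply]
  simp only [mul_comm (pull1 P (Y _) c), pull2_mul_apply]
  rfl

theorem pull4_sub (P : Matrix (Fin 7) (Fin 7) ℝ) (X Y : Tensor4) (a b c d : Fin 7) :
    pull4 P (fun i j k l => X i j k l - Y i j k l) a b c d
      = pull4 P X a b c d - pull4 P Y a b c d := by
  simp only [pull4, pull3, pull2, pull1, mul_sub, sum_sub_distrib]

theorem pull4_add (P : Matrix (Fin 7) (Fin 7) ℝ) (X Y : Tensor4) (a b c d : Fin 7) :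
    pull4 P (fun i j k l => X i j k l + Y i j k l) a b c d
      = pull4 P X a b c d + pull4 P Y a b c d := by
  simp only [pull4, pull3, pull2, pull1, mul_add, sum_add_distrib]

theorem pull4_sum (P : Matrix (Fin 7) (Fin 7) ℝ) (X : Fin 7 → Tensor4) (a b c d : Fin 7) :
    pull4 P (fun i j k l => ∑ e, X e i j k l) a b c d = ∑ e, pull4 P (X e) a b c d := by
  simp only [pull4]
  rw [sum_comm]
  have := fun i => pull3_sum_smul P (fun _ => 1) (fun e => X e i) b c d
  simp only [one_mul] at this
  simp only [this, mul_sum]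

variable (h : IsG2StructureAt φ (coordMap B z)) (hB : B.det ≠ 0)
include h hB

theorem IsG2StructureAt.coordMap : IsG2StructureAt (fun y => pull3 B (φ (coordMap B y))) z := by
  have hc := (G2Deformation.coordMap B).continuous.tendsto z
  refine ⟨fun a b c => ?_, (hc.eventually h.pos).mono fun y hy => hy.pull3 hB⟩
  simp only [pull3, pull2, pull1]
  refine ContDiffAt.sum fun i _ => contDiffAt_const.mul <| ContDiffAt.sum fun j _ =>
    contDiffAt_const.mul <| ContDiffAt.sum fun k _ => contDiffAt_const.mul ?_
  exact (h.smooth i j k).comp z (G2Deformation.coordMap B).contDiff.contDiffAt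

/-- A linear change of coordinates has no second derivatives, so the Christoffel symbols transform
as a tensor. Consequently `∇φ`, the torsion and `∇v` do so as well, which is all that is needed to
reach the normal form at one point. -/
theorem christoffel_coordMap (i a c : Fin 7) :
    (B *ᵥ fun e => christoffel (fun y => pull3 B (φ (coordMap B y))) z e a c) i
      = pull2 B (fun j k => christoffel φ (coordMap B z) i j k) a c := by
  set G : Tensor3 := fun i j m => partialDeriv m (fun y => metric (φ y) i j) (coordMap B z) with hG
  set x : Tensor1 := fun d => (B * metricInv (pull3 B (φ (coordMap B z)))) i d with hx
  have hu : IsUnit B.det := hB.isUnit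
  have hd : ∀ m i j, partialDeriv m (fun y => metric (pull3 B (φ (coordMap B y))) i j) z
      = pull3 B G i j m := by
    intro m i j
    simp only [metric_pull3_apply hB]
    rw [partialDeriv_pull2 (α := fun y i j => metric (φ (coordMap B y)) i j)
      fun i j => differentiableAt_comp_coordMap (h.metric_differentiableAt i j)]
    simp only [partialDeriv_coordMap (h.metric_differentiableAt _ _)]
    rfl
  have hBx : B *ᵥ x = fun k => metricInv (φ (coordMap B z)) i k := by
    have e : B * metricInv (pull3 B (φ (coordMap B z))) * Bᵀ = metricInv (φ (coordMap B z)) := by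
      have h1 : B * B⁻¹ = 1 := Matrix.mul_nonsing_inv _ hu
      have h2 : B⁻¹ᵀ * Bᵀ = 1 := by rw [← transpose_mul, h1, transpose_one]
      rw [metricInv_pull3 hB, Matrix.mul_assoc, Matrix.mul_assoc, h2, Matrix.mul_one,
        ← Matrix.mul_assoc, h1, Matrix.one_mul]
    rw [← e]
    funext k
    simp only [mulVec, dotProduct, hx, Matrix.mul_apply (N := Bᵀ), transpose_apply, mul_comm]
  have h1 : (B *ᵥ fun e => christoffel (fun y => pull3 B (φ (coordMap B y))) z e a c) i
      = 1 / 2 * (∑ d, x d * pull3 B G d a c + ∑ d, x d * pull3 B G d c a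
        - ∑ d, x d * pull3 B G a c d) := by
    rw [← sum_add_distrib, ← sum_sub_distrib]
    simp only [christoffel, hd, mulVec, dotProduct, hx, Matrix.mul_apply, mul_sum, sum_mul]
    rw [sum_comm]
    refine sum_congr rfl fun d _ => ?_
    rw [← sum_add_distrib, ← sum_sub_distrib, mul_sum]
    exact sum_congr rfl fun e _ => by ring
  rw [h1, sum_mul_pull3, sum_mul_pull3, sum_mul_pull3_last]
  simp only [hBx]
  rw [← pull2_swap B (fun j k => ∑ d, metricInv (φ (coordMap B z)) i d * G d j k) a c, ← pull2_add,
    ← pull2_sub, ← pull2_const_mul]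
  congr 1
  funext j k
  rw [christoffel, ← sum_add_distrib, ← sum_sub_distrib]
  congr 1
  exact sum_congr rfl fun d _ => by simp only [hG]; ring

theorem covDerivPhi_coordMap (a b c d : Fin 7) :
    covDerivPhi (fun y => pull3 B (φ (coordMap B y))) z a b c d
      = pull4 B (covDerivPhi φ (coordMap B z)) a b c d := by
  have hd : partialDeriv a (fun y => pull3 B (φ (coordMap B y)) b c d) z
      = pull4 B (fun a b c d => partialDeriv a (fun y => φ y b c d) (coordMap B z)) a b c d := by
    rw [partialDeriv_pull3 fun i j k => differentiableAt_comp_coordMap (h.differentiableAt i j k)]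
    simp only [partialDeriv_coordMap (h.differentiableAt _ _ _)]
    exact pull3_sum_smul B (fun m => B m a)
      (fun m i j k => partialDeriv m (fun y => φ y i j k) (coordMap B z)) b c d
  unfold covDerivPhi
  simp only [sum_add_distrib, sum_mul_pull3, sum_mul_pull3_mid, sum_mul_pull3_last,
    christoffel_coordMap h hB, pull2_sum_smul, pull4_sub, pull4_add, pull4_sum, pull4_mul_apply,
    pull4_mul_apply', pull4_mul_apply'', hd]

theorem torsion_coordMap (a n : Fin 7) :
    torsion (fun y => pull3 B (φ (coordMap B y))) z a n
      = pull2 B (torsion φ (coordMap B z)) a n := by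
  have hu : IsUnit B.det := hB.isUnit
  set x := coordMap B z with hx
  set χ : Tensor3 := fun j k l => ∑ i, B i a * covDerivPhi φ x i j k l with hχ
  set Y : Tensor1 := fun m => ∑ b, ∑ c, ∑ d, χ b c d * psiUp (φ x) m b c d with hY
  have h1 : ∀ b c d, covDerivPhi (fun y => pull3 B (φ (coordMap B y))) z a b c d
      = pull3 B χ b c d := fun b c d => by
    rw [covDerivPhi_coordMap h hB]
    exact (pull3_sum_smul B (fun i => B i a) (covDerivPhi φ x) b c d).symm
  have h2 : B *ᵥ pull1 B⁻¹ᵀ Y = Y := by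
    rw [pull1_eq, transpose_transpose, mulVec_mulVec, Matrix.mul_nonsing_inv _ hu, one_mulVec]
  have h3 : ∀ m, Y m
      = ∑ i, B i a * ∑ b, ∑ c, ∑ d, covDerivPhi φ x i b c d * psiUp (φ x) m b c d := fun m => by
    simp only [hY, hχ, sum_mul, mul_sum]
    refine (sum_congr rfl fun b _ => (sum_congr rfl fun c _ => sum_comm).trans
      sum_comm).trans (sum_comm.trans ?_)
    exact sum_congr rfl fun _ _ => sum_congr rfl fun _ _ => sum_congr rfl fun _ _ =>
      sum_congr rfl fun _ _ => by ring
  simp only [torsion, h1, psiUp_pull3 hB, sum_pull3_mul_pull4 hB, metric_pull3_apply hB]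
  simp only [mul_assoc, ← mul_sum, ← hx]
  change 1 / 24 * ∑ m, pull1 B⁻¹ᵀ Y m * pull2 B (fun i j => metric (φ x) i j) m n = _
  rw [sum_mul_pull2, h2]
  refine Eq.trans ?_ (pull1_sum_smul B (fun i => B i a) (torsion φ x) n)
  rw [← pull1_const_mul]
  congr 1
  funext j
  have h4 : ∀ (D : Tensor2) (G : Tensor1), 1 / 24 * ∑ m, (∑ i, B i a * D i m) * G m
      = ∑ i, B i a * ∑ m, (1 / 24 * D i m) * G m := fun D G => by
    simp only [sum_mul, mul_sum]
    rw [sum_comm]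
    exact sum_congr rfl fun _ _ => sum_congr rfl fun _ _ => by ring
  simp only [h3, torsion]
  exact h4 (fun i m => ∑ b, ∑ c, ∑ d, covDerivPhi φ x i b c d * psiUp (φ x) m b c d) _

theorem covDerivVector_coordMap (hv : ∀ a, ContDiffAt ℝ ∞ (fun y => v y a) (coordMap B z))
    (a n : Fin 7) :
    covDerivVector (fun y => pull3 B (φ (coordMap B y))) (fun y => B⁻¹ *ᵥ v (coordMap B y)) z a n
      = pull2 B (covDerivVector φ v (coordMap B z)) a n := by
  have hu : IsUnit B.det := hB.isUnit
  have hf : ∀ y, flat (pull3 B (φ (coordMap B y))) (B⁻¹ *ᵥ v (coordMap B y))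
      = pull1 B (flat (φ (coordMap B y)) (v (coordMap B y))) := fun y => by
    rw [flat_pull3 hB, mulVec_mulVec, Matrix.mul_nonsing_inv _ hu, one_mulVec]
  have hd : partialDeriv a (fun y => pull1 B (flat (φ (coordMap B y)) (v (coordMap B y))) n) z
      = pull2 B (fun a b => partialDeriv a (fun y => flat (φ y) (v y) b) (coordMap B z)) a n := by
    rw [partialDeriv_pull1 (α := fun y => flat (φ (coordMap B y)) (v (coordMap B y)))
      fun i => differentiableAt_comp_coordMap (h.flat_differentiableAt hv i)]
    simp only [partialDeriv_coordMap (h.flat_differentiableAt hv _)]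
    exact pull1_sum_smul B (fun m => B m a)
      (fun m i => partialDeriv m (fun y => flat (φ y) (v y) i) (coordMap B z)) n
  simp only [covDerivVector, hf, hd, sum_mul_pull1, christoffel_coordMap h hB]
  simp only [mul_comm _ (flat _ _ _)]
  rw [← pull2_sum_smul B (flat (φ (coordMap B z)) (v (coordMap B z))) fun i j k =>
    christoffel φ (coordMap B z) i j k, ← pull2_sub]
  congr 1
  funext j k
  simp only [covDerivVector, mul_comm]

end LinearChange

/-! ### The formulas at an arbitrary point -/

/-- The standard form, the vector and the torsion in a suitable frame at a point. -/
theorem IsG2StructureAt.exists_gauge {φ : Coords → Tensor3} {v : Coords → Tensor1} {x : Coords}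
    (h : IsG2StructureAt φ x) (hv : ∀ a, ContDiffAt ℝ ∞ (fun y => v y a) x) :
    ∃ (A : Matrix (Fin 7) (Fin 7) ℝ) (t : ℝ), A.det ≠ 0 ∧ φ x = pull3 A stdForm ∧
      A *ᵥ v x = t • Pi.single 0 1 ∧
      pull2 A⁻¹ (torsion (fun y => G2Deformation.deform (φ y) (v y)) x)
        = fun a b => ((1 + t ^ 2) ^ (1 / 3 : ℝ))⁻¹ *
          stdTorsion t (pull2 A⁻¹ (torsion φ x)) (pull2 A⁻¹ (covDerivVector φ v x)) a b := by
  obtain ⟨A, t, hA, h0, hv0⟩ := h.pos.self_of_nhds.exists_gauge (v x)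
  refine ⟨A, t, hA, h0, hv0, ?_⟩
  have hu : IsUnit A.det := hA.isUnit
  have hB : A⁻¹.det ≠ 0 := by
    rw [det_nonsing_inv, Ring.inverse_eq_inv']
    exact inv_ne_zero hA
  -- In the coordinates `A x` the form is the standard one and the vector is `t e₀`, both at the
  -- point `z` only.
  set z := G2Deformation.coordMap A x with hz
  have hx : G2Deformation.coordMap A⁻¹ z = x := by
    rw [hz, coordMap_mul, Matrix.nonsing_inv_mul _ hu, coordMap_one]
  rw [← hx] at h hv ⊢
  have hv' : ∀ a, ContDiffAt ℝ ∞ (fun y => (A⁻¹⁻¹ *ᵥ v (G2Deformation.coordMap A⁻¹ y)) a) z := fun a => by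
    simp only [mulVec, dotProduct]
    exact ContDiffAt.sum fun i _ => contDiffAt_const.mul
      ((hv i).comp z (G2Deformation.coordMap A⁻¹).contDiff.contDiffAt)
  have h1 : pull3 A⁻¹ (φ (G2Deformation.coordMap A⁻¹ z)) = stdForm := by
    rw [hx, h0, pull3_pull3, Matrix.mul_nonsing_inv _ hu, pull3_one]
  have h2 : A⁻¹⁻¹ *ᵥ v (G2Deformation.coordMap A⁻¹ z) = t • Pi.single 0 1 := by
    rw [hx, Matrix.nonsing_inv_nonsing_inv _ hu, hv0]
  have key := (h.coordMap hB).torsion_deform hv' h1 h2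
  have h3 : (fun y => G2Deformation.deform (pull3 A⁻¹ (φ (G2Deformation.coordMap A⁻¹ y)))
      (A⁻¹⁻¹ *ᵥ v (G2Deformation.coordMap A⁻¹ y)))
      = fun y => pull3 A⁻¹ ((fun y => G2Deformation.deform (φ y) (v y)) (G2Deformation.coordMap A⁻¹ y)) := by
    funext y
    rw [deform_pull3 hB, mulVec_mulVec, Matrix.mul_nonsing_inv _ hB.isUnit, one_mulVec]
  have h4 : torsion (fun y => pull3 A⁻¹ (φ (G2Deformation.coordMap A⁻¹ y))) z
      = pull2 A⁻¹ (torsion φ (G2Deformation.coordMap A⁻¹ z)) := by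
    funext a n
    exact torsion_coordMap h hB a n
  have h5 : covDerivVector (fun y => pull3 A⁻¹ (φ (G2Deformation.coordMap A⁻¹ y)))
      (fun y => A⁻¹⁻¹ *ᵥ v (G2Deformation.coordMap A⁻¹ y)) z
      = pull2 A⁻¹ (covDerivVector φ v (G2Deformation.coordMap A⁻¹ z)) := by
    funext a n
    exact covDerivVector_coordMap h hB hv a n
  rw [h3, h4, h5] at key
  funext a n
  rw [← key, torsion_coordMap (h.deform hv) hB]

/-! ### Inverting the formulas: from components of `∇v` back to the torsion. -/

/-- All formulas together. -/
def formulas (φ : Tensor3) (v : Tensor1) (τ ρ : Components) : Components where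
  c1 := formula1 φ v τ ρ
  c7 := formula7 φ v τ ρ
  c14 := formula14 φ v τ ρ
  c27 := formula27 φ v τ ρ

theorem formulas_pull3 {P : Matrix (Fin 7) (Fin 7) ℝ} (hP : P.det ≠ 0) (φ : Tensor3) (v : Tensor1)
    (τ ρ : Components) :
    formulas (pull3 P φ) v (τ.pull P) (ρ.pull P) = (formulas φ (P *ᵥ v) τ ρ).pull P := by
  simp only [formulas, formula1_pull3 hP, formula7_pull3 hP, formula14_pull3 hP,
    formula27_pull3 hP]
  rfl

theorem Components.pull_inv_pull {P : Matrix (Fin 7) (Fin 7) ℝ} (hP : P.det ≠ 0)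
    (τ : Components) : (τ.pull P).pull P⁻¹ = τ := by
  simp only [Components.pull, pull1_pull1, pull2_pull2, Matrix.mul_nonsing_inv _ hP.isUnit,
    pull1_one, pull2_one]

/-- The parts of types 14 and 27 are defined as remainders, so the four parts add up to `W` for
every `φ`. -/
theorem components_injective (φ : Tensor3) : Function.Injective (components φ) := by
  intro W W' h
  have key : ∀ W : Tensor2, ∀ a b, W a b = (components φ W).c14 a b
      + phiContr φ (sharp φ (components φ W).c7) a b
      + (components φ W).c27 a b + (components φ W).c1 * metric φ a b := fun W a b => by
    simp only [components, altPart, symPart]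
    ring
  funext a b
  rw [key W, key W', h]

theorem components_zero (φ : Tensor3) : components φ (fun _ _ => 0) = ⟨0, 0, 0, 0⟩ := by
  ext <;> simp [components, raise2, altPart, symPart, phiContr, sharp]

theorem formulas_zero (φ : Tensor3) (v : Tensor1) :
    formulas φ v ⟨0, 0, 0, 0⟩ ⟨0, 0, 0, 0⟩ = ⟨0, 0, 0, 0⟩ := by
  ext <;> simp [formulas, formula1, formula7, formula14, formula27, pair, outer, contract, sharp,
    phiCross, phiContr, psiContr, phiMul, phiPhi, raise2, altPart, symPart]

theorem components_eq_formulas_stdForm {t k : ℝ} (hk : k = (1 + t ^ 2) ^ (1 / 3 : ℝ))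
    (T W : Tensor2) :
    components stdForm W = formulas stdForm (t • Pi.single 0 1) (components stdForm T)
      (components (deform stdForm (t • Pi.single 0 1)) fun a b => k⁻¹ * stdTorsion t T W a b) := by
  rw [components_deform_stdTorsion hk]
  ext
  · exact stdFormula1 hk T W
  · exact stdFormula7 hk _ T W
  · exact stdFormula14 hk _ _ T W
  · exact stdFormula27 hk _ _ T W

set_option maxHeartbeats 1000000 in
-- The torsion is affine in `W` with a linear part independent of `T`. This one identity yields
-- additivity, homogeneity and the splitting into the two contributions.
theorem stdTorsion_mul_add (t c : ℝ) (T W W' : Tensor2) (a b : Fin 7) :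
    stdTorsion t T (fun i j => c * W i j + W' i j) a b
      = c * stdTorsion t (fun _ _ => 0) W a b + stdTorsion t T W' a b := by
  obtain rfl | rfl | rfl | rfl | rfl | rfl | rfl :
      a = 0 ∨ a = 1 ∨ a = 2 ∨ a = 3 ∨ a = 4 ∨ a = 5 ∨ a = 6 := by omega
  all_goals
    obtain rfl | rfl | rfl | rfl | rfl | rfl | rfl :
      b = 0 ∨ b = 1 ∨ b = 2 ∨ b = 3 ∨ b = 4 ∨ b = 5 ∨ b = 6 := by omega
  all_goals
    simp only [stdTorsion_apply, Matrix.cons_val]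
    ring

theorem stdTorsion_zero (t : ℝ) (a b : Fin 7) :
    stdTorsion t (fun _ _ => 0) (fun _ _ => 0) a b = 0 := by
  have h := stdTorsion_mul_add t 1 (fun _ _ => 0) (fun _ _ => 0) (fun _ _ => 0) a b
  simp only [mul_zero, add_zero, one_mul] at h
  linarith

/-- The part of `stdTorsion` that depends on `∇v`, as a linear map. -/
def stdTorsionLinear (t : ℝ) : Tensor2 →ₗ[ℝ] Tensor2 where
  toFun W := stdTorsion t (fun _ _ => 0) W
  map_add' W W' := by
    funext a b
    have h := stdTorsion_mul_add t 1 (fun _ _ => 0) W W' a b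
    simp only [one_mul] at h
    exact h
  map_smul' c W := by
    funext a b
    have h := stdTorsion_mul_add t c (fun _ _ => 0) W (fun _ _ => 0) a b
    simp only [stdTorsion_zero, add_zero] at h
    exact h

/-- If `W` contributes no torsion at `T = 0`, the formulas make all its components vanish, so `W =
0`; an injective endomorphism in finite dimension is onto. -/
theorem stdTorsionLinear_surjective (t : ℝ) : Function.Surjective (stdTorsionLinear t) := by
  rw [← LinearMap.injective_iff_surjective, injective_iff_map_eq_zero]
  intro W hW
  have h := components_eq_formulas_stdForm (t := t) rfl (fun _ _ => 0) W
  have h0 : ∀ a b, stdTorsion t (fun _ _ => 0) W a b = 0 := fun a b => congrFun₂ hW a b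
  simp only [h0, mul_zero, components_zero, formulas_zero] at h
  exact components_injective stdForm (h.trans (components_zero stdForm).symm)

/-- For the forward direction, surjectivity gives some `W'` whose torsion is `Y`. The formulas hold
for `W'` too, and their right sides involve only `T` and `Y`, so `W` and `W'` have the same
components and coincide. -/
theorem components_eq_formulas_stdForm_iff {t k : ℝ} (hk : k = (1 + t ^ 2) ^ (1 / 3 : ℝ))
    (T W Y : Tensor2) :
    components stdForm W = formulas stdForm (t • Pi.single 0 1) (components stdForm T)
        (components (deform stdForm (t • Pi.single 0 1)) Y) ↔
      (fun a b => k⁻¹ * stdTorsion t T W a b) = Y := by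
  have hkpos : 0 < k := by rw [hk]; positivity
  refine ⟨fun h => ?_, fun h => h ▸ components_eq_formulas_stdForm hk T W⟩
  obtain ⟨W', hW'⟩ := stdTorsionLinear_surjective t
    fun a b => k * Y a b - stdTorsion t T (fun _ _ => 0) a b
  have e : ∀ a b, k⁻¹ * stdTorsion t T W' a b = Y a b := fun a b => by
    have h1 := stdTorsion_mul_add t 1 T W' (fun _ _ => 0) a b
    have h2 : stdTorsion t (fun _ _ => 0) W' a b
      = k * Y a b - stdTorsion t T (fun _ _ => 0) a b := congrFun₂ hW' a b
    simp only [one_mul, add_zero] at h1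
    rw [h1, h2]
    field_simp
    ring
  have h' := components_eq_formulas_stdForm hk T W'
  simp only [e] at h'
  have hWW : W = W' := components_injective stdForm (h.trans h'.symm)
  funext a b
  rw [hWW, e]

/-- The formulas characterize the torsion of the deformed form. -/
theorem IsG2StructureAt.components_eq_formulas_iff {φ : Coords → Tensor3} {v : Coords → Tensor1}
    {x : Coords} (h : IsG2StructureAt φ x) (hv : ∀ a, ContDiffAt ℝ ∞ (fun y => v y a) x)
    (Y : Tensor2) :
    components (φ x) (covDerivVector φ v x) =
        formulas (φ x) (v x) (components (φ x) (torsion φ x))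
          (components (G2Deformation.deform (φ x) (v x)) Y) ↔
      torsion (fun y => G2Deformation.deform (φ y) (v y)) x = Y := by
  obtain ⟨A, t, hA, h0, hv0, hT⟩ := h.exists_gauge hv
  have hu : IsUnit A.det := hA.isUnit
  have hpull : ∀ W : Tensor2, pull2 A (pull2 A⁻¹ W) = W := fun W => by
    rw [pull2_pull2, Matrix.nonsing_inv_mul _ hu, pull2_one]
  have hcomp : ∀ (χ : Tensor3) (W : Tensor2),
      components (pull3 A χ) W = (components χ (pull2 A⁻¹ W)).pull A := fun χ W => by
    rw [← components_pull3 hA, hpull]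
  have hinj : Function.Injective (Components.pull A) :=
    Function.LeftInverse.injective (g := Components.pull A⁻¹) (Components.pull_inv_pull hA)
  have hinj' : Function.Injective (pull2 A⁻¹) :=
    Function.LeftInverse.injective (g := pull2 A) hpull
  -- In the adapted frame both statements are pull-backs by the invertible `A`, which can be
  -- cancelled.
  rw [h0, deform_pull3 hA, hcomp, hcomp, hcomp, formulas_pull3 hA, hv0, hinj.eq_iff,
    components_eq_formulas_stdForm_iff rfl, ← hT, hinj'.eq_iff]

/-! ### The exterior derivative of `dv♭` -/

theorem partialDeriv_comm {f : Coords → ℝ} {x : Coords} (hf : ContDiffAt ℝ ∞ f x) (a b : Fin 7) :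
    partialDeriv a (fun y => partialDeriv b f y) x
      = partialDeriv b (fun y => partialDeriv a f y) x := by
  have hd : DifferentiableAt ℝ (fderiv ℝ f) x :=
    (hf.fderiv_right (m := 1) (by norm_cast)).differentiableAt (by simp)
  have h : ∀ a b, partialDeriv a (fun y => partialDeriv b f y) x
      = fderiv ℝ (fderiv ℝ f) x (EuclideanSpace.single a 1) (EuclideanSpace.single b 1) :=
    fun a b => by
      simp only [partialDeriv]
      rw [fderiv_clm_apply hd (differentiableAt_const _)]
      simp
  rw [h, h]
  exact (hf.isSymmSndFDerivAt (by simpa using by norm_cast)).eq _ _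

theorem differentiableAt_partialDeriv {f : Coords → ℝ} {x : Coords} (hf : ContDiffAt ℝ ∞ f x)
    (a : Fin 7) : DifferentiableAt ℝ (fun y => partialDeriv a f y) x := by
  have hd : DifferentiableAt ℝ (fderiv ℝ f) x :=
    (hf.fderiv_right (m := 1) (by norm_cast)).differentiableAt (by simp)
  exact hd.clm_apply (differentiableAt_const _)

theorem partialDeriv_sub_div_two {f g : Coords → ℝ} {x : Coords} (hf : DifferentiableAt ℝ f x)
    (hg : DifferentiableAt ℝ g x) (a : Fin 7) :
    partialDeriv a (fun y => (f y - g y) / 2) x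
      = (partialDeriv a f x - partialDeriv a g x) / 2 := by
  have h : HasFDerivAt (fun y => (f y - g y) / 2) ((2 : ℝ)⁻¹ • (fderiv ℝ f x - fderiv ℝ g x)) x := by
    simp only [div_eq_inv_mul]
    exact (hf.hasFDerivAt.fun_sub hg.hasFDerivAt).const_mul (2 : ℝ)⁻¹
  rw [partialDeriv, h.fderiv]
  simp only [partialDeriv, _root_.smul_apply, _root_.sub_apply, smul_eq_mul]
  ring

/-- The part of type 14 is the alternating part minus the vector term, so the sum is immediate. -/
theorem phiContr_sharp_components_add (φ : Tensor3) (W : Tensor2) (a b : Fin 7) :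
    phiContr φ (sharp φ (components φ W).c7) a b + (components φ W).c14 a b = altPart W a b :=
  add_sub_cancel _ _

/-- The connection is torsion-free, so its terms cancel on alternation and half of `dv♭` remains. -/
theorem IsG2StructureAt.altPart_covDerivVector {φ : Coords → Tensor3} {v : Coords → Tensor1}
    {x : Coords} (h : IsG2StructureAt φ x) (a b : Fin 7) :
    altPart (covDerivVector φ v x) a b = (partialDeriv a (fun y => flat (φ y) (v y) b) x
      - partialDeriv b (fun y => flat (φ y) (v y) a) x) / 2 := by
  simp only [altPart, covDerivVector, h.christoffel_comm _ a b]
  ring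

/-- The skew part of `∇v` is closed. -/
theorem extDeriv2_components_covDerivVector {φ : Coords → Tensor3} {v : Coords → Tensor1}
    {x : Coords} (h : ∀ᶠ y in 𝓝 x, IsG2StructureAt φ y)
    (hv : ∀ a, ContDiffAt ℝ ∞ (fun y => v y a) x) (a b c : Fin 7) :
    extDeriv2 (fun y a b =>
      phiContr (φ y) (sharp (φ y) (components (φ y) (covDerivVector φ v y)).c7) a b
        + (components (φ y) (covDerivVector φ v y)).c14 a b) x a b c = 0 := by
  have hf : ∀ b, ContDiffAt ℝ ∞ (fun y => flat (φ y) (v y) b) x :=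
    contDiffAt_flat h.self_of_nhds.smooth hv h.self_of_nhds.pos.self_of_nhds
  have key : ∀ a b c, partialDeriv a (fun y => altPart (covDerivVector φ v y) b c) x
      = (partialDeriv a (fun y => partialDeriv b (fun y => flat (φ y) (v y) c) y) x
        - partialDeriv a (fun y => partialDeriv c (fun y => flat (φ y) (v y) b) y) x) / 2 :=
    fun a b c => by
    rw [partialDeriv_congr (h.mono fun y hy => hy.altPart_covDerivVector b c),
      partialDeriv_sub_div_two (differentiableAt_partialDeriv (hf c) b)
        (differentiableAt_partialDeriv (hf b) c)]
  simp only [extDeriv2, phiContr_sharp_components_add, key]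
  -- The six second derivatives cancel in pairs by their symmetry: `d² = 0`.
  rw [partialDeriv_comm (hf c) a b, partialDeriv_comm (hf b) a c, partialDeriv_comm (hf a) b c]
  ring

/-! ### Tensor fields in a chart -/

section Manifold

variable {M : Type*} [TopologicalSpace M] [ChartedSpace Coords M]
  {φ : ∀ p : M, (TangentSpace (𝓡 7) p) [⋀^Fin 3]→L[ℝ] ℝ} {v : ∀ p : M, TangentSpace (𝓡 7) p}
  {e : OpenPartialHomeomorph M Coords} {x : Coords}

/-- The components are the fibre part of the tangent map of the chart applied to the smooth section
`v`; on the open source the derivative within the source is the full derivative. -/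
theorem contDiffAt_vectorCoord [IsManifold (𝓡 7) ∞ M]
    (hv : ContMDiff (𝓡 7) (𝓡 7).tangent ∞ (fun p => (⟨p, v p⟩ : TangentBundle (𝓡 7) M)))
    (he : e ∈ IsManifold.maximalAtlas (𝓡 7) ∞ M) (hx : x ∈ e.target) (a : Fin 7) :
    ContDiffAt ℝ ∞ (fun y => vectorCoord v e y a) x := by
  have h1 := (contMDiffOn_of_mem_maximalAtlas he).contMDiffOn_tangentMapWithin (m := ∞) le_rfl
    e.open_source.uniqueMDiffOn
  have h2 : ContMDiffOn (𝓡 7) (𝓡 7).tangent ∞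
      (fun y => (⟨e.symm y, v (e.symm y)⟩ : TangentBundle (𝓡 7) M)) e.target :=
    hv.comp_contMDiffOn (contMDiffOn_symm_of_mem_maximalAtlas he)
  have h3 := (contMDiff_snd_tangentBundle_modelSpace Coords (𝓡 7)).comp_contMDiffOn
    (h1.comp h2 fun y hy => e.map_target hy)
  have h4 : ContDiffOn ℝ ∞ (fun y => (show Coords from
      mfderivWithin (𝓡 7) (𝓡 7) e e.source (e.symm y) (v (e.symm y)))) e.target := h3.contDiffOn
  have h5 : ContDiffAt ℝ ∞ (fun y => (show Coords from
      mfderivWithin (𝓡 7) (𝓡 7) e e.source (e.symm y) (v (e.symm y))) a) x :=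
    (EuclideanSpace.proj (𝕜 := ℝ) a).contDiff.contDiffAt.comp x
      (h4.contDiffAt (e.open_target.mem_nhds hx))
  refine h5.congr_of_eventuallyEq ?_
  filter_upwards [e.open_target.mem_nhds hx] with y hy
  rw [vectorCoord, mfderivWithin_of_isOpen e.open_source (e.map_target hy)]

theorem IsG2Structure.at (hφ : IsG2Structure φ) (he : e ∈ IsManifold.maximalAtlas (𝓡 7) ∞ M)
    (hx : x ∈ e.target) : IsG2StructureAt (formCoord φ e) x := by
  have hU : e.target ∈ 𝓝 x := e.open_target.mem_nhds hx
  obtain ⟨h1, h2⟩ := hφ e he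
  exact ⟨fun a b c => (h1 a b c).contDiffAt hU, Filter.mem_of_superset hU h2⟩

end Manifold

end G2Deformation

end

/-! ### Assembly in the charts of the manifold. -/

theorem mainTheorem2 {M : Type*} [TopologicalSpace M] [ChartedSpace G2Deformation.Coords M]
    [IsManifold (𝓡 7) ∞ M]
    (φ : ∀ p : M, (TangentSpace (𝓡 7) p) [⋀^Fin 3]→L[ℝ] ℝ)
    (hφ : G2Deformation.IsG2Structure φ)
    (v : ∀ p : M, TangentSpace (𝓡 7) p)
    (hv : ContMDiff (𝓡 7) (𝓡 7).tangent ∞ (fun p => (⟨p, v p⟩ : TangentBundle (𝓡 7) M)))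
    (T' : ∀ p : M, TangentSpace (𝓡 7) p →L[ℝ] TangentSpace (𝓡 7) p →L[ℝ] ℝ) :
    -- the deformed form is a positive 3-form
    (∀ e ∈ IsManifold.maximalAtlas (𝓡 7) ∞ M,
      G2Deformation.IsG2StructureOn e.target (G2Deformation.deformCoord φ v e)) ∧
    -- its torsion tensor is the prescribed one if and only if the formulas hold
    ((∀ e ∈ IsManifold.maximalAtlas (𝓡 7) ∞ M, ∀ x ∈ e.target,
        G2Deformation.torsion (G2Deformation.deformCoord φ v e) x
          = G2Deformation.tensorCoord T' e x) ↔
      (∀ e ∈ IsManifold.maximalAtlas (𝓡 7) ∞ M, ∀ x ∈ e.target,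
        let φx := G2Deformation.formCoord φ e x
        let vx := G2Deformation.vectorCoord v e x
        let τ := G2Deformation.torsionComponents φ e x
        let τ' := G2Deformation.deformedComponents φ v T' e x
        let w := G2Deformation.gradComponents φ v e x
        w.c1 = G2Deformation.formula1 φx vx τ τ' ∧
        w.c7 = G2Deformation.formula7 φx vx τ τ' ∧
        w.c14 = G2Deformation.formula14 φx vx τ τ' ∧
        w.c27 = G2Deformation.formula27 φx vx τ τ')) ∧
    -- the integrability condition
    (∀ e ∈ IsManifold.maximalAtlas (𝓡 7) ∞ M, ∀ x ∈ e.target, ∀ a b c,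
      G2Deformation.extDeriv2 (fun y a b =>
        G2Deformation.phiContr (G2Deformation.formCoord φ e y)
            (G2Deformation.sharp (G2Deformation.formCoord φ e y)
              (G2Deformation.gradComponents φ v e y).c7) a b
          + (G2Deformation.gradComponents φ v e y).c14 a b) x a b c = 0) := by
  refine ⟨fun e he => ?_, ?_, fun e he x hx a b c => ?_⟩
  · have h : ∀ x ∈ e.target, G2Deformation.IsG2StructureAt (G2Deformation.deformCoord φ v e) x :=
      fun x hx => (hφ.at he hx).deform (G2Deformation.contDiffAt_vectorCoord hv he hx)
    exact ⟨fun a b c x hx => ((h x hx).smooth a b c).contDiffWithinAt,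
      fun x hx => (h x hx).pos.self_of_nhds⟩
  -- The equivalence already holds chart by chart and point by point, so nothing has to be glued.
  · refine forall₂_congr fun e he => forall₂_congr fun x hx => ?_
    refine ((hφ.at he hx).components_eq_formulas_iff
      (G2Deformation.contDiffAt_vectorCoord hv he hx) _).symm.trans ?_
    exact G2Deformation.Components.ext_iff
  · refine G2Deformation.extDeriv2_components_covDerivVector ?_
      (G2Deformation.contDiffAt_vectorCoord hv he hx) a b c
    exact Filter.mem_of_superset (e.open_target.mem_nhds hx) fun y hy => hφ.at he hy
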